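/- **Setting.** Let $p>2$ be a prime, $\mathbb F$ a finite field of characteristic $p$, $A$ a compact (Hausdorff) local topological ring with maximal ideal $\mathfrak m$ and residue field $\mathbb F$ (hence a topological $W(\mathbb F)$-algebra), and $s:\mathbb F\to A$ the map induced by the Teichmüller lift $\mathbb F\to W(\mathbb F)$. A generalized matrix algebra (GMA) over $A$ is $R=\begin{pmatrix}A&B\\C&A\end{pmatrix}$ where $B,C$ are $A$-modules with an $A$-bilinear $m:B\times C\to A$, written $bc$, such that $(bc)b'=(b'c)b$ and $(bc')c=(bc)c'$; the product is the matrix product, $\operatorname{tr}$ and $\det$ are defined by the usual formulas. $R$ is faithful if $y=0$ whenever $\det y=0$ and $\operatorname{tr}(yx)=0$ for all $x\in R$. $B,C,R$ carry their natural $A$-module topology. For closed subgroups $X,Y$ (of $A$, $B$, $C$), $XY$ is the closure of the subgroup generated by the products; for a ring $S$ and a subset $X$ of an $S$-module, $SX$ is the $S$-submodule generated by $X$. An *admissible pseudo-deformation* $(\Pi,\bar\rho,t,d)$ over $A$ consists of: a profinite group $\Pi$ such that the largest pro-$p$ quotient of every open subgroup is topologically finitely generated; a continuous $\bar\rho:\Pi\to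 \mathrm{GL}_2(\mathbb F)$, either absolutely irreducible or a sum of two distinct characters with values in $\mathbb F^*$; a continuous two-dimensional pseudo-representation $(t,d)$, i.e. a homomorphism $d:\Pi\to A^*$ and a central function $t:\Pi\to A$ with $t(1)=2$ and $t(xy)+d(y)t(xy^{-1})=t(x)t(y)$, with $t\equiv\operatorname{tr}\bar\rho$ and $d\equiv\det\bar\rho \pmod{\mathfrak m}$, such that $d(\Pi)\subset s(\mathbb F)$ and $t(\Pi)$ generates $A$ as a topological $W(\mathbb F)$-algebra. A *$(t,d)$-representation* is a homomorphism $\rho:\Pi\to R^*$, with $R$ a faithful GMA over $A$, such that $\operatorname{tr}\rho=t$, $\det\rho=d$ and $A\rho(\Pi)=R$. When the projective image of $\bar\rho$ is cyclic (so that $\bar\rho$ is reducible and $BC\subset\mathfrak m$), $\rho$ is *well adapted* if (i) there is $g_0\in\Pi$ such that $\bar\rho(g_0)$ has distinct eigenvalues $\lambda_0,\mu_0\in\mathbb F$, $\rho(g_0)$ is diagonal and congruent to $\mathrm{diag}(\lambda_0,\mu_0)$ modulo $\mathfrak m$, and $\bar\rho(g_0)$ together with the scalar matrices of $\bar\rho(\Pi)$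 generates $\bar\rho(\Pi)$; and (ii) for every $g\in \Pi$, if $x,y\in\mathbb F$ are the reductions of the diagonal entries of $\rho(g)$, then $\mathrm{diag}(s(x),s(y))\in\rho(\Pi)$. The *Lie algebra attached to $\rho$* is the closed additive subgroup $L$ of $R$ generated by $\Theta(\Gamma)$, where $\Theta(r)=r-\frac{\operatorname{tr} r}{2}\mathrm{Id}$ and $\Gamma=\{r\in\rho(\Pi): \det r=1,\ r\in 1+\operatorname{rad}R\}$, $\operatorname{rad}R$ being the Jacobson radical. For subsets $I\subset A$, $B_1\subset B$, $C_1\subset C$, let $\begin{pmatrix}I&B_1\\C_1&I\end{pmatrix}^0$ be the set of trace-zero matrices with entries in the indicated sets. **Theorem.** (Direct part.) Let $(\Pi,\bar\rho,t,d)$ be an admissible pseudo-deformation over $A$ such that the projective image of $\bar\rho$ is cyclic of order $m>2$, let $\rho:\Pi\to R^*$ be a well adapted $(t,d)$-representation, and let $L$ be its Lie algebra. Let $\mathbb F_q\subset\mathbb F$ be any subfield such that $\gcd(m,q-1)>2$ (a condition always satisfied if $\mathbb F_q=\mathbb F$). Then there exist closed $W(\mathbb F_q)$-submodules $\tilde I_1\subset\mathfrak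 m$, $\tilde B_1\subset B$ and $\tilde C_1\subset C$ such that $$W(\mathbb F_q)L=\begin{pmatrix}\tilde I_1&\tilde B_1\\ \tilde C_1&\tilde I_1\end{pmatrix}^0$$ and (1) $\tilde B_1\tilde C_1\subset\tilde I_1$; (2) $\tilde I_1^3\subset\tilde I_1$; (3) $W(\mathbb F)1+W(\mathbb F)\tilde I_1+W(\mathbb F)\tilde I_1^2=A$; (4) $W(\mathbb F)\tilde B_1=B$ and $W(\mathbb F)\tilde C_1=C$. (Converse.) Suppose $|\mathbb F|>3$, $A$ is noetherian, and $R=\begin{pmatrix}A&B\\C&A\end{pmatrix}$ is a faithful GMA over $A$ that is of finite type as an $A$-module. Let $\tilde I_1\subset\mathfrak m$, $\tilde B_1\subset B$, $\tilde C_1\subset C$ be closed $W(\mathbb F)$-submodules satisfying (1)–(4). Then there exist an admissible pseudo-deformation $(\Pi,\bar\rho,t,d)$ over $A$ such that the projective image of $\bar\rho$ is cyclic of order $>2$, and a $(t,d)$-representation $\rho:\Pi\to R^*$ whose attached Lie algebra is $L=\begin{pmatrix}\tilde I_1&\tilde B_1\\ \tilde C_1&\tilde I_1\end{pmatrix}^0$;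 in particular $L=W(\mathbb F)L$. -/

import Mathlib

open scoped MatrixGroups

universe uF uA uB uC uP

noncomputable section

namespace PinkGMA

/-! ### Generalized matrix algebras of type (1,1) -/

/-- The data `(A, B, C, m)` of a generalized matrix algebra: two `A`-modules `B`, `C` and an
`A`-linear map `m : B ⊗ C → A` (given as a bilinear map), with
`m(b,c) b' = m(b',c) b` and `m(b,c') c = m(b,c) c'`. -/
structure GMAData (A : Type uA) (B : Type uB) (C : Type uC) [CommRing A] [AddCommGroup B]
    [Module A B] [AddCommGroup C] [Module A C] where
  /-- The pairing `B × C → A`. -/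
  m : B →ₗ[A] C →ₗ[A] A
  assoc_left : ∀ b b' c, m b c • b' = m b' c • b
  assoc_right : ∀ b c c', m b c' • c = m b c • c'

/-- The algebra of matrices `(a b; c d)` with `a, d ∈ A`, `b ∈ B`, `c ∈ C`. -/
@[ext]
structure GMA {A : Type uA} {B : Type uB} {C : Type uC} [CommRing A] [AddCommGroup B]
    [Module A B] [AddCommGroup C] [Module A C] (D : GMAData A B C) where
  a : A
  b : B
  c : C
  d : A

namespace GMA

variable {A : Type uA} {B : Type uB} {C : Type uC} [CommRing A] [AddCommGroup B]
    [Module A B] [AddCommGroup C] [Module A C] {D : GMAData A B C}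

instance : Zero (GMA D) := ⟨⟨0, 0, 0, 0⟩⟩
instance : One (GMA D) := ⟨⟨1, 0, 0, 1⟩⟩
instance : Add (GMA D) := ⟨fun x y => ⟨x.a + y.a, x.b + y.b, x.c + y.c, x.d + y.d⟩⟩
instance : Neg (GMA D) := ⟨fun x => ⟨-x.a, -x.b, -x.c, -x.d⟩⟩
instance : SMul A (GMA D) := ⟨fun r x => ⟨r * x.a, r • x.b, r • x.c, r * x.d⟩⟩
/-- Multiplication of matrices, with `m` for the product of an element of `B` and one of `C`. -/
instance : Mul (GMA D) := ⟨fun x y =>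
  ⟨x.a * y.a + D.m x.b y.c, x.a • y.b + y.d • x.b, y.a • x.c + x.d • y.c,
    x.d * y.d + D.m y.b x.c⟩⟩

@[simp] lemma zero_a : (0 : GMA D).a = 0 := rfl
@[simp] lemma zero_b : (0 : GMA D).b = 0 := rfl
@[simp] lemma zero_c : (0 : GMA D).c = 0 := rfl
@[simp] lemma zero_d : (0 : GMA D).d = 0 := rfl
@[simp] lemma one_a : (1 : GMA D).a = 1 := rfl
@[simp] lemma one_b : (1 : GMA D).b = 0 := rfl
@[simp] lemma one_c : (1 : GMA D).c = 0 := rfl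
@[simp] lemma one_d : (1 : GMA D).d = 1 := rfl
@[simp] lemma add_a (x y : GMA D) : (x + y).a = x.a + y.a := rfl
@[simp] lemma add_b (x y : GMA D) : (x + y).b = x.b + y.b := rfl
@[simp] lemma add_c (x y : GMA D) : (x + y).c = x.c + y.c := rfl
@[simp] lemma add_d (x y : GMA D) : (x + y).d = x.d + y.d := rfl
@[simp] lemma neg_a (x : GMA D) : (-x).a = -x.a := rfl
@[simp] lemma neg_b (x : GMA D) : (-x).b = -x.b := rfl
@[simp] lemma neg_c (x : GMA D) : (-x).c = -x.c := rfl
@[simp] lemma neg_d (x : GMA D) : (-x).d = -x.d := rfl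
@[simp] lemma smul_a (r : A) (x : GMA D) : (r • x).a = r * x.a := rfl
@[simp] lemma smul_b (r : A) (x : GMA D) : (r • x).b = r • x.b := rfl
@[simp] lemma smul_c (r : A) (x : GMA D) : (r • x).c = r • x.c := rfl
@[simp] lemma smul_d (r : A) (x : GMA D) : (r • x).d = r * x.d := rfl
@[simp] lemma mul_a (x y : GMA D) : (x * y).a = x.a * y.a + D.m x.b y.c := rfl
@[simp] lemma mul_b (x y : GMA D) : (x * y).b = x.a • y.b + y.d • x.b := rfl
@[simp] lemma mul_c (x y : GMA D) : (x * y).c = y.a • x.c + x.d • y.c := rfl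
@[simp] lemma mul_d (x y : GMA D) : (x * y).d = x.d * y.d + D.m y.b x.c := rfl

instance : AddCommGroup (GMA D) where
  add_assoc x y z := by ext <;> simp [add_assoc]
  zero_add x := by ext <;> simp
  add_zero x := by ext <;> simp
  nsmul := nsmulRec
  zsmul := zsmulRec
  neg_add_cancel x := by ext <;> simp
  add_comm x y := by ext <;> simp [add_comm]

instance : Ring (GMA D) where
  __ := (inferInstance : AddCommGroup (GMA D))
  left_distrib x y z := by
    ext <;> simp [mul_add, add_smul, smul_add] <;> abel
  right_distrib x y z := by
    ext <;> simp [add_mul, add_smul, smul_add] <;> abel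
  zero_mul x := by ext <;> simp
  mul_zero x := by ext <;> simp
  one_mul x := by ext <;> simp
  mul_one x := by ext <;> simp
  mul_assoc x y z := by
    ext
    · simp; ring
    · simp only [mul_b, mul_a, mul_d, smul_add, add_smul, smul_smul, D.assoc_left x.b z.b y.c]
      module
    · simp only [mul_c, mul_a, mul_d, smul_add, add_smul, smul_smul]
      rw [D.assoc_right y.b x.c z.c]
      module
    · simp; ring
  zsmul := zsmulRec
  neg_add_cancel x := by ext <;> simp

instance : Module A (GMA D) where
  one_smul x := by ext <;> simp
  mul_smul r s x := by ext <;> simp [mul_assoc, mul_smul]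
  smul_zero r := by ext <;> simp
  smul_add r x y := by ext <;> simp [mul_add]
  add_smul r s x := by ext <;> simp [add_mul, add_smul]
  zero_smul x := by ext <;> simp

/-- The trace `a + d`. -/
def trace (x : GMA D) : A := x.a + x.d

/-- The determinant `ad - bc`. -/
def det (x : GMA D) : A := x.a * x.d - D.m x.b x.c

/-- The topology of `A × B × C × A`. -/
instance [TopologicalSpace A] [TopologicalSpace B] [TopologicalSpace C] :
    TopologicalSpace (GMA D) :=
  TopologicalSpace.induced (fun x => (x.a, x.b, x.c, x.d)) inferInstance

/-- The map `Θ(r) = r - (tr r / 2) Id`; it is used only when `2` is invertible in `A`. -/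
def theta (x : GMA D) : GMA D := x - (Ring.inverse (2 : A) * trace x) • (1 : GMA D)

end GMA

/-- The generalized matrix algebra is faithful: the kernel
`{y | det y = 0 and tr (y x) = 0 for all x}` of the pseudo-representation `(tr, det)` is zero. -/
def GMAData.Faithful {A : Type uA} {B : Type uB} {C : Type uC} [CommRing A] [AddCommGroup B]
    [Module A B] [AddCommGroup C] [Module A C] (D : GMAData A B C) : Prop :=
  ∀ y : GMA D, y.det = 0 → (∀ x : GMA D, (y * x).trace = 0) → y = 0

/-! ### Witt vectors and constants -/

/-- The constant `s(x)` of `A`: the image of the Teichmüller lift of `x ∈ F` in `W(F)`. -/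
def const (p : ℕ) [Fact p.Prime] {F : Type uF} [Field F] [CharP F p] (A : Type uA) [CommRing A]
    [Algebra (WittVector p F) A] : F →* A :=
  (algebraMap (WittVector p F) A : WittVector p F →* A).comp (WittVector.teichmuller p)

/-- The image of `W(K) ⊆ W(F)` in `A`, for a subfield `K` of `F`. The `W(K)`-submodules of an
`A`-module are its submodules over this subring of `A`. -/
def wittSubring (p : ℕ) [Fact p.Prime] {F : Type uF} [Field F] [CharP F p] (A : Type uA)
    [CommRing A] [Algebra (WittVector p F) A] (K : Subfield F) : Subring A :=
  ((algebraMap (WittVector p F) A).comp (WittVector.map K.subtype)).range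

/-! ### Profinite groups and the `p`-finiteness condition -/

/-- The kernel of the map from a profinite group to its largest pro-`p` quotient: the intersection
of the open normal subgroups whose index is a power of `p`. -/
def proPKernel (p : ℕ) (H : Type*) [Group H] [TopologicalSpace H] : Subgroup H :=
  sInf {N : Subgroup H | N.Normal ∧ IsOpen (N : Set H) ∧ ∃ k : ℕ, N.index = p ^ k}

instance (p : ℕ) (H : Type*) [Group H] [TopologicalSpace H] : (proPKernel p H).Normal := by
  refine ⟨fun n hn g => ?_⟩
  simp only [proPKernel, Subgroup.mem_sInf] at hn ⊢
  exact fun N hN => hN.1.conj_mem n (hn N hN) g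

/-- Mazur's finiteness condition: the largest pro-`p` quotient of every open subgroup is
topologically finitely generated. -/
def PFinite (p : ℕ) (P : Type*) [Group P] [TopologicalSpace P] : Prop :=
  ∀ H : Subgroup P, IsOpen (H : Set P) →
    ∃ S : Set (H ⧸ proPKernel p H), S.Finite ∧
      Dense (Subgroup.closure S : Set (H ⧸ proPKernel p H))

/-! ### Residual representations -/

section residual

variable {P : Type*} [Group P] {F : Type uF} [Field F]

/-- The representation `ρ̄` becomes irreducible over an algebraic closure of `F`;
it is stated through the representation on the column vectors. -/
def IsAbsolutelyIrreducible (rhobar : P →* GL (Fin 2) F) : Prop :=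
  Representation.IsIrreducible
    ((((Matrix.toLinAlgEquiv' :
          Matrix (Fin 2) (Fin 2) (AlgebraicClosure F) ≃ₐ[AlgebraicClosure F] _) :
        Matrix (Fin 2) (Fin 2) (AlgebraicClosure F) →*
          Module.End (AlgebraicClosure F) (Fin 2 → AlgebraicClosure F)).comp
      ((Units.coeHom _).comp
        ((Matrix.GeneralLinearGroup.map (algebraMap F (AlgebraicClosure F))).comp rhobar))) :
      Representation (AlgebraicClosure F) P (Fin 2 → AlgebraicClosure F))

/-- `ρ̄` is isomorphic to the direct sum of two distinct characters of `P` with values in `F`. -/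
def IsSumOfDistinctCharacters (rhobar : P →* GL (Fin 2) F) : Prop :=
  ∃ χ₁ χ₂ : P →* Fˣ, χ₁ ≠ χ₂ ∧ ∃ Q : GL (Fin 2) F, ∀ g : P,
    ((Q * rhobar g * Q⁻¹ : GL (Fin 2) F) : Matrix (Fin 2) (Fin 2) F) =
      !![(χ₁ g : F), 0; 0, (χ₂ g : F)]

/-- The projective image of `ρ̄`, a subgroup of `PGL₂(F)`. -/
def projImage (rhobar : P →* GL (Fin 2) F) : Subgroup (PGL(2, F)) :=
  rhobar.range.map Matrix.ProjGenLinGroup.mk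

end residual

/-! ### Pseudo-representations and admissible pseudo-deformations -/

/-- `(t, d)` is a pseudo-representation of dimension 2 of `P` with values in `A`. -/
structure IsPseudoRep {P : Type*} [Group P] {A : Type uA} [CommRing A] (t : P → A) (d : P →* Aˣ) :
    Prop where
  central : ∀ x y, t (x * y) = t (y * x)
  map_one : t 1 = 2
  identity : ∀ x y, t (x * y) + d y * t (x * y⁻¹) = t x * t y

/-- `(P, ρ̄, t, d)` is an admissible pseudo-deformation over the local ring `A`, where `P` is a
profinite group. Congruences with elements of `F` are expressed with the section `s` of
`A → A/𝔪 = F`, and a homomorphism to the finite group `GL₂(F)` is continuous if its kernel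
is open. -/
structure IsAdmissible (p : ℕ) [Fact p.Prime] {F : Type uF} [Field F] [CharP F p] {A : Type uA}
    [CommRing A] [TopologicalSpace A] [IsLocalRing A] [Algebra (WittVector p F) A]
    (P : ProfiniteGrp.{uP}) (rhobar : P →* GL (Fin 2) F) (t : P → A) (d : P →* Aˣ) : Prop where
  pFinite : PFinite p P
  rhobar_continuous : IsOpen (rhobar.ker : Set P)
  rhobar_multFree : IsAbsolutelyIrreducible rhobar ∨ IsSumOfDistinctCharacters rhobar
  pseudoRep : IsPseudoRep t d
  t_continuous : Continuous t
  d_continuous : Continuous d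
  trace_congr : ∀ g, t g - const p A (rhobar g : Matrix (Fin 2) (Fin 2) F).trace ∈
    IsLocalRing.maximalIdeal A
  det_congr : ∀ g, (d g : A) - const p A (rhobar g : Matrix (Fin 2) (Fin 2) F).det ∈
    IsLocalRing.maximalIdeal A
  det_const : ∀ g, ∃ x : F, (d g : A) = const p A x
  generate : Dense (Algebra.adjoin (WittVector p F) (Set.range t) : Set A)

/-! ### `(t,d)`-representations and Pink's Lie algebra -/

section representations

variable {A : Type uA} {B : Type uB} {C : Type uC} [CommRing A] [AddCommGroup B]
    [Module A B] [AddCommGroup C] [Module A C] {D : GMAData A B C} {P : Type*} [Group P]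

/-- `ρ : P → Rˣ` is a `(t,d)`-representation: `R` is faithful, `ρ` has trace `t` and determinant
`d`, and `A ρ(P) = R`. -/
structure IsTDRep (rho : P →* (GMA D)ˣ) (t : P → A) (d : P →* Aˣ) : Prop where
  faithful : D.Faithful
  trace_eq : ∀ g, (rho g : GMA D).trace = t g
  det_eq : ∀ g, (rho g : GMA D).det = d g
  span_eq : Submodule.span A (Set.range fun g => (rho g : GMA D)) = ⊤

/-- `ρ` is adapted to `(g₀, λ₀, μ₀)`, where `λ₀ ≠ μ₀` are the eigenvalues of `ρ̄(g₀)`: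
`ρ(g₀)` is diagonal, and reduces to the diagonal matrix `(λ₀, μ₀)`. -/
structure IsAdapted (p : ℕ) [Fact p.Prime] {F : Type uF} [Field F] [CharP F p] [IsLocalRing A]
    [Algebra (WittVector p F) A] (rhobar : P →* GL (Fin 2) F) (rho : P →* (GMA D)ˣ)
    (g₀ : P) (l₀ m₀ : F) : Prop where
  ne : l₀ ≠ m₀
  charpoly_eq : (rhobar g₀ : Matrix (Fin 2) (Fin 2) F).charpoly =
    (Polynomial.X - Polynomial.C l₀) * (Polynomial.X - Polynomial.C m₀)
  b_eq : (rho g₀ : GMA D).b = 0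
  c_eq : (rho g₀ : GMA D).c = 0
  a_congr : (rho g₀ : GMA D).a - const p A l₀ ∈ IsLocalRing.maximalIdeal A
  d_congr : (rho g₀ : GMA D).d - const p A m₀ ∈ IsLocalRing.maximalIdeal A

/-- The `(t,d)`-representation `ρ` is well adapted, in the case where the projective image of `ρ̄`
is cyclic. In this case `ρ̄` is reducible, `BC ⊆ 𝔪`, the quotient of `R` by its radical consists of
the diagonal matrices over `F`, and the section `s` sends `(x, y)` to the diagonal matrix
`(s x, s y)`. The first condition is that `ρ` is adapted to some `g₀` such that `ρ̄(g₀)` and the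
scalars of `Ḡ = ρ̄(P)` generate `Ḡ`; the second is that `s(Ḡ) ⊆ ρ(P)`. -/
structure IsWellAdaptedCyclic (p : ℕ) [Fact p.Prime] {F : Type uF} [Field F] [CharP F p]
    [IsLocalRing A] [Algebra (WittVector p F) A] (rhobar : P →* GL (Fin 2) F)
    (rho : P →* (GMA D)ˣ) : Prop where
  adapted : ∃ (g₀ : P) (l₀ m₀ : F), IsAdapted p rhobar rho g₀ l₀ m₀ ∧
    Subgroup.zpowers (rhobar g₀) ⊔ (rhobar.range ⊓ Subgroup.center (GL (Fin 2) F)) = rhobar.range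
  const_mem : ∀ (g : P) (x y : F),
    (rho g : GMA D).a - const p A x ∈ IsLocalRing.maximalIdeal A →
    (rho g : GMA D).d - const p A y ∈ IsLocalRing.maximalIdeal A →
    ∃ h : P, (rho h : GMA D) = ⟨const p A x, 0, 0, const p A y⟩

/-- `Γ = ρ(P) ∩ SR¹`, where `SR¹` is the group of the elements of determinant `1` of
`1 + rad R`. -/
def pinkGroup (rho : P →* (GMA D)ˣ) : Set (GMA D) :=
  {r | (∃ g, (rho g : GMA D) = r) ∧ r.det = 1 ∧ r - 1 ∈ Ring.jacobson (GMA D)}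

/-- Pink's Lie algebra `L`: the closure of the additive subgroup generated by `Θ(Γ)`. -/
def pinkLie [TopologicalSpace A] [TopologicalSpace B] [TopologicalSpace C]
    (rho : P →* (GMA D)ˣ) : Set (GMA D) :=
  closure (AddSubgroup.closure (GMA.theta '' pinkGroup rho) : Set (GMA D))

/-- The matrices of trace zero of `(I B₁; C₁ I)`. -/
def matZero (D : GMAData A B C) (I : Set A) (B₁ : Set B) (C₁ : Set C) : Set (GMA D) :=
  {r | r.a ∈ I ∧ r.b ∈ B₁ ∧ r.c ∈ C₁ ∧ r.d ∈ I ∧ r.trace = 0}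

/-- The product of two additive subgroups for a biadditive product `f` with values in `A`: the
closure of the additive subgroup generated by the products. -/
def closedProd {X Y : Type*} [TopologicalSpace A] (f : X → Y → A) (S : Set X) (T : Set Y) :
    Set A :=
  closure (AddSubgroup.closure (Set.image2 f S T) : Set A)

/-- `I₁`, `B₁`, `C₁` are closed `W(K)`-submodules of `𝔪`, `B`, `C` with `B₁C₁ ⊆ I₁`, `I₁³ ⊆ I₁`,
`W(F) + W(F) I₁ + W(F) I₁² = A`, `W(F) B₁ = B` and `W(F) C₁ = C`. -/
structure IsPinkDatum (p : ℕ) [Fact p.Prime] {F : Type uF} [Field F] [CharP F p] [IsLocalRing A]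
    [Algebra (WittVector p F) A] [TopologicalSpace A] [TopologicalSpace B] [TopologicalSpace C]
    (D : GMAData A B C) (K : Subfield F) (I₁ : Submodule (wittSubring p A K) A)
    (B₁ : Submodule (wittSubring p A K) B) (C₁ : Submodule (wittSubring p A K) C) : Prop where
  isClosed_I : IsClosed (I₁ : Set A)
  isClosed_B : IsClosed (B₁ : Set B)
  isClosed_C : IsClosed (C₁ : Set C)
  subset_maximalIdeal : (I₁ : Set A) ⊆ IsLocalRing.maximalIdeal A
  prod_subset : closedProd (fun b c => D.m b c) (B₁ : Set B) (C₁ : Set C) ⊆ I₁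
  cube_subset : closedProd (· * ·) (closedProd (· * ·) (I₁ : Set A) (I₁ : Set A)) (I₁ : Set A) ⊆ I₁
  span_A : Submodule.span (wittSubring p A (⊤ : Subfield F)) ({1} : Set A) ⊔
      Submodule.span (wittSubring p A (⊤ : Subfield F)) (I₁ : Set A) ⊔
      Submodule.span (wittSubring p A (⊤ : Subfield F))
        (closedProd (· * ·) (I₁ : Set A) (I₁ : Set A)) = ⊤
  span_B : Submodule.span (wittSubring p A (⊤ : Subfield F)) (B₁ : Set B) = ⊤
  span_C : Submodule.span (wittSubring p A (⊤ : Subfield F)) (C₁ : Set C) = ⊤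

end representations

end PinkGMA

end

set_option linter.unusedSectionVars false

/-! Everything rests on Pink's identities. If det x = 1, then adj x = x⁻¹, so tr(x)Θ(y) = Θ(xy) +
Θ(x⁻¹y), while [Θ(x), Θ(y)] = Θ(xy) − Θ(yx). Hence L is a closed Lie algebra with tr(LL)L ⊆ L
(`isPinkStable_topologicalClosure`).

Direct part. Well-adaptedness puts in ρ(Π) a constant diagonal matrix whose ratio of entries reduces
to some z in F_q with z² ≠ 1. Conjugation by it has eigenvalues 1, z, z⁻¹ on the diagonal, upper and
lower parts, so W(F_q)L splits into these parts (`mem_components`). Brackets give (1) and the trace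
relation gives (2). For (3) and (4), each ρ(g) is a constant diagonal matrix times some γ in Γ,
whose diagonal entries are τ + k and τ − k with k ∈ I₁ and τ² = 1 + k² + bc. Since τ ≡ 1, it is a
limit of powers of τ². So the closed ring W + WI₁ + WI₁² contains all traces and is A, and W(F)B₁,
W(F)C₁ are A-modules (`exists_isPinkDatum`). These arguments need B and C compact Hausdorff.
Faithfulness separates points, and finite generation follows from Mazur's condition, because the
off-diagonal entries are cocycles on an open subgroup whose image under ρ factors through its pro-p
quotient (`finite_of_pFinite`).

Converse. Over F itself, (4) forces B₁ = B and C₁ = C. The matrices of determinant 1, congruent to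
1, with Θ in the prescribed space form a group, on which Θ is onto thanks to square roots in 1 + 𝔪;
the Teichmüller torus normalizes it. To secure p-finiteness one keeps only the closed subgroup
generated by the torus and finitely many such matrices. Finitely many suffice because A is finite
over a closed ring E generated by W(F) and products of pairs from a finite subset of I₁, so by
Eakin–Nagata I₁ is a finitely generated E-module (`exists_finite_generating`, `pinkLie_subtype_eq`).
-/

namespace PinkGMA

open Filter Topology Pointwise

/-! ### Compact local rings -/

section compactRing

variable {A : Type*} [CommRing A] [TopologicalSpace A]

/-- Multiples of elements close to zero by elements of a compact ring are uniformly small in a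
topological module. -/
lemma exists_nhds_smul_subset {X : Type*} [AddCommGroup X] [Module A X] [TopologicalSpace X]
    [ContinuousSMul A X] {T : Set X} (hT : IsCompact T) {U : Set X} (hU : U ∈ 𝓝 0) :
    ∃ V ∈ 𝓝 (0 : A), ∀ v ∈ V, ∀ x ∈ T, v • x ∈ U := by
  obtain ⟨O, hOU, hO, h0⟩ := mem_nhds_iff.mp hU
  obtain ⟨u, v, hu, -, h1, h2, h3⟩ := generalized_tube_lemma (isCompact_singleton (x := (0 : A)))
    hT (n := (fun q : A × X => q.1 • q.2) ⁻¹' O) (hO.preimage continuous_smul)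
    (by rintro ⟨a, b⟩ ⟨ha, -⟩; simp only [Set.mem_singleton_iff] at ha; simpa [ha] using h0)
  exact ⟨u, hu.mem_nhds (by simpa using h1), fun a ha x hx =>
    hOU (h3 (show (a, x) ∈ u ×ˢ v from ⟨ha, h2 hx⟩))⟩

variable [IsTopologicalRing A] [CompactSpace A]

lemma exists_nhds_mul_subset {U : Set A} (hU : U ∈ 𝓝 0) :
    ∃ V ∈ 𝓝 (0 : A), ∀ v ∈ V, ∀ x : A, v * x ∈ U := by
  obtain ⟨V, hV, h⟩ := exists_nhds_smul_subset (A := A) (X := A) isCompact_univ hU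
  exact ⟨V, hV, fun v hv x => h v hv x trivial⟩

variable [T2Space A] [IsLocalRing A]

/-- By compactness, all multiples of an element near 0 avoid 1, so such an element is not a unit. No
finiteness of 𝔪 is involved. -/
lemma isOpen_maximalIdeal : IsOpen (IsLocalRing.maximalIdeal A : Set A) := by
  obtain ⟨V, hV, h⟩ := exists_nhds_mul_subset (A := A) (U := {1}ᶜ)
    (isOpen_compl_singleton.mem_nhds (by simp))
  refine AddSubgroup.isOpen_of_mem_nhds
    (IsLocalRing.maximalIdeal A).toAddSubgroup (g := 0) (mem_of_superset hV fun v hv => ?_)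
  simp only [Submodule.coe_toAddSubgroup, SetLike.mem_coe, IsLocalRing.mem_maximalIdeal,
    mem_nonunits_iff]
  rintro ⟨u, rfl⟩
  exact h u hv (u⁻¹ : Aˣ) (by simp)

lemma isClosed_maximalIdeal : IsClosed (IsLocalRing.maximalIdeal A : Set A) :=
  AddSubgroup.isClosed_of_isOpen (IsLocalRing.maximalIdeal A).toAddSubgroup isOpen_maximalIdeal

/-- The powers of the ideal tend uniformly to zero. -/
def TopNil {A : Type*} [CommRing A] [TopologicalSpace A] (J : Ideal A) : Prop :=
  ∀ U ∈ 𝓝 (0 : A), ∃ n, ((J ^ n : Ideal A) : Set A) ⊆ U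

/-- The closure of the positive powers of v is a compact semigroup, hence contains an idempotent. It
lies in 𝔪, and the only idempotent of a local ring in 𝔪 is 0. So some power of v is close to 0, and
with it all its multiples. -/
lemma topNil_span_singleton {v : A} (hv : v ∈ IsLocalRing.maximalIdeal A) :
    TopNil (Ideal.span {v}) := by
  intro U hU
  obtain ⟨V, hV, h⟩ := exists_nhds_mul_subset hU
  set T : Set A := closure (Set.range fun n : ℕ => v ^ (n + 1)) with hT
  have hsub : ∀ x ∈ T, ∀ y ∈ T, x * y ∈ T := fun x hx y hy =>
    map_mem_closure₂ continuous_mul hx hy (by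
      rintro _ ⟨n, rfl⟩ _ ⟨k, rfl⟩
      exact ⟨n + k + 1, by simp only [← pow_add]; congr 1; ring⟩)
  obtain ⟨e, heT, he⟩ := exists_idempotent_in_compact_subsemigroup (M := A)
    (fun r => continuous_id.mul continuous_const) T
    (Set.range_nonempty _).closure isClosed_closure.isCompact hsub
  have hem : e ∈ IsLocalRing.maximalIdeal A := by
    refine closure_minimal ?_ (isClosed_maximalIdeal (A := A)) heT
    rintro _ ⟨n, rfl⟩
    exact Ideal.pow_mem_of_mem _ hv _ (Nat.succ_pos n)
  have he0 : e = 0 := by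
    have hu : IsUnit (1 - e) := by
      by_contra hc
      have := (IsLocalRing.maximalIdeal A).add_mem hem
        ((IsLocalRing.mem_maximalIdeal _).mpr (mem_nonunits_iff.mpr hc))
      simp at this
    have : (1 - e) * e = 0 := by rw [sub_mul, one_mul, he, sub_self]
    simpa using (hu.mul_right_eq_zero).mp this
  obtain ⟨_, hn, n, rfl⟩ := mem_closure_iff_nhds.mp (he0 ▸ heT) V hV
  refine ⟨n + 1, fun x hx => ?_⟩
  rw [SetLike.mem_coe, Ideal.span_singleton_pow, Ideal.mem_span_singleton] at hx
  obtain ⟨a, rfl⟩ := hx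
  exact h _ hn _

/-- The inclusion (N₁ + N₂)^(n+k) ⊆ N₁^n + N₂^k reduces this to principal ideals. A itself need not
be noetherian. -/
lemma topNil_of_fg {J : Ideal A} (hJ : J.FG) (h : J ≤ IsLocalRing.maximalIdeal A) : TopNil J := by
  revert h
  refine Submodule.fg_induction (motive := fun N _ => N ≤ IsLocalRing.maximalIdeal A → TopNil N)
    (fun x hx => ?_) (fun N₁ N₂ _ _ h1 h2 hN U hU => ?_) J hJ
  · exact topNil_span_singleton (hx (Submodule.mem_span_singleton_self x))
  · obtain ⟨V, hV, hVU⟩ := exists_nhds_zero_half hU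
    obtain ⟨n, hn⟩ := h1 (le_sup_left.trans hN) V hV
    obtain ⟨k, hk⟩ := h2 (le_sup_right.trans hN) V hV
    refine ⟨n + k, fun x hx => ?_⟩
    obtain ⟨y, hy, z, hz, rfl⟩ := Submodule.mem_sup.mp (Ideal.sup_pow_add_le_pow_sup_pow hx)
    exact hVU y (hn hy) z (hk hz)

lemma eventually_pow_mul_mem {v : A} (hv : v ∈ IsLocalRing.maximalIdeal A) {X : Type*}
    [AddCommGroup X] [Module A X] [TopologicalSpace X] [ContinuousSMul A X] (y : X) {U : Set X}
    (hU : U ∈ 𝓝 0) : ∃ n, ∀ a : A, (v ^ n * a) • y ∈ U := by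
  obtain ⟨V, hV, h⟩ := exists_nhds_smul_subset (A := A) (isCompact_singleton (x := y)) hU
  obtain ⟨n, hn⟩ := topNil_span_singleton hv V hV
  refine ⟨n, fun a => h _ (hn ?_) y rfl⟩
  rw [SetLike.mem_coe, Ideal.span_singleton_pow, Ideal.mem_span_singleton]
  exact ⟨a, rfl⟩

end compactRing

/-- If u ≡ 1 modulo J, then u^p − 1 = (u − 1)(1 + u + … + u^(p−1)), and the second factor is ≡ p ≡
0. -/
lemma pow_prime_pow_sub_one_mem {R : Type*} [CommRing R] {J : Ideal R} {p : ℕ}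
    (hp : (p : R) ∈ J) {u : R} (hu : u - 1 ∈ J) (n : ℕ) : u ^ p ^ n - 1 ∈ J ^ (n + 1) := by
  induction n with
  | zero => simpa using hu
  | succ n ih =>
    have hy : u ^ p ^ n - 1 ∈ J := Ideal.pow_le_self (Nat.succ_ne_zero n) ih
    rw [pow_succ p n, pow_mul, ← mul_geom_sum, pow_succ]
    refine Ideal.mul_mem_mul ih ?_
    rw [← Ideal.Quotient.eq_zero_iff_mem] at hp hy ⊢
    rw [map_sub, map_one, sub_eq_zero] at hy
    rw [map_sum]
    simp only [map_pow] at hy ⊢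
    simp [hy, ← hp]

open Filter Topology Pointwise

/-! ### Constants and Witt vectors -/

section witt

variable {p : ℕ} [Fact p.Prime] {F : Type uF} [Field F] [CharP F p]
  {A : Type uA} [CommRing A] [Algebra (WittVector p F) A]

variable (p) in
/-- `φ : A → F` is the reduction modulo the maximal ideal, compatible with `W(F) → F`. -/
structure IsResidueMap [IsLocalRing A] (φ : A →+* F) : Prop where
  algebraMap_eq : ∀ w : WittVector p F, φ (algebraMap _ A w) = w.coeff 0
  mem_maximalIdeal_iff : ∀ a, a ∈ IsLocalRing.maximalIdeal A ↔ φ a = 0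

/-- The kernels of W(F) → A/𝔪 and of the zeroth coefficient are both maximal, and W(F) is local, so
they agree. The residue field is thus identified with F in such a way that s(x) reduces to x. -/
lemma exists_isResidueMap [Finite F] [IsLocalRing A]
    (hA : Function.Surjective ((IsLocalRing.residue A).comp (algebraMap (WittVector p F) A))) :
    ∃ φ : A →+* F, IsResidueMap p φ := by
  set g := (IsLocalRing.residue A).comp (algebraMap (WittVector p F) A) with hg
  have hker : RingHom.ker g = RingHom.ker (WittVector.constantCoeff (p := p) (R := F)) := by
    have := RingHom.ker_isMaximal_of_surjective g hA
    refine this.eq_of_le (RingHom.ker_ne_top _) fun w hw => ?_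
    by_contra hc
    refine this.ne_top (Ideal.eq_top_of_isUnit_mem _ hw ?_)
    exact WittVector.isUnit_of_coeff_zero_ne_zero w hc
  let e := (RingHom.quotientKerEquivOfSurjective hA).symm.trans
    ((Ideal.quotEquivOfEq hker).trans
    (RingHom.quotientKerEquivOfSurjective (WittVector.constantCoeff_surjective (R := F) p)))
  refine ⟨(e : IsLocalRing.ResidueField A →+* F).comp (IsLocalRing.residue A), fun w => ?_,
    fun a => ?_⟩
  · have h1 : (RingHom.quotientKerEquivOfSurjective hA).symm
        (IsLocalRing.residue A (algebraMap _ A w)) = Ideal.Quotient.mk _ w := by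
      rw [RingEquiv.symm_apply_eq]; rfl
    change e _ = _
    simp only [e, RingEquiv.trans_apply, h1]
    rfl
  · simp [IsLocalRing.residue_eq_zero_iff]

lemma const_zero : const p A (0 : F) = 0 := by simp [const]

lemma const_mem_wittSubring {K : Subfield F} {x : F} (hx : x ∈ K) :
    const p A x ∈ wittSubring p A K :=
  ⟨WittVector.teichmuller p (⟨x, hx⟩ : K), by simp [const, WittVector.map_teichmuller]⟩

lemma algebraMap_mem_wittSubring_top (w : WittVector p F) :
    algebraMap _ A w ∈ wittSubring p A (⊤ : Subfield F) := by
  obtain ⟨v, rfl⟩ := WittVector.map_surjective (p := p) ((⊤ : Subfield F).subtype)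
    (fun x => ⟨⟨x, trivial⟩, rfl⟩) w
  exact ⟨v, rfl⟩

/-- One step of the Teichmüller expansion. As K is finite, hence perfect, a Witt vector over K with
zero leading coefficient is divisible by p. -/
lemma exists_eq_const_add [Finite F] {K : Subfield F} {a : A} (ha : a ∈ wittSubring p A K) :
    ∃ x ∈ K, ∃ a' ∈ wittSubring p A K, a = const p A x + p * a' := by
  obtain ⟨w, rfl⟩ := ha
  have : w - WittVector.teichmuller p (w.coeff 0) ∈ Ideal.span {(p : WittVector p K)} := by
    rw [WittVector.mem_span_p_iff_coeff_zero_eq_zero]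
    refine (map_sub WittVector.constantCoeff w _).trans (sub_eq_zero.mpr ?_)
    exact (WittVector.teichmuller_coeff_zero p (w.coeff 0)).symm
  obtain ⟨v, hv⟩ := Ideal.mem_span_singleton.mp this
  refine ⟨w.coeff 0, (w.coeff 0).2, _, ⟨v, rfl⟩, ?_⟩
  rw [sub_eq_iff_eq_add'] at hv
  conv_lhs => rw [hv]
  simp [const, WittVector.map_teichmuller]

namespace IsResidueMap

variable [IsLocalRing A] {φ : A →+* F} (hφ : IsResidueMap p φ)
include hφ

lemma const_eq (x : F) : φ (const p A x) = x := by
  simp [const, hφ.algebraMap_eq, WittVector.teichmuller_coeff_zero]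

lemma natCast_mem : (p : A) ∈ IsLocalRing.maximalIdeal A := by
  rw [hφ.mem_maximalIdeal_iff, map_natCast, CharP.cast_eq_zero]

lemma sub_const_mem_iff {a : A} {x : F} :
    a - const p A x ∈ IsLocalRing.maximalIdeal A ↔ φ a = x := by
  rw [hφ.mem_maximalIdeal_iff, map_sub, hφ.const_eq, sub_eq_zero]

lemma isUnit_iff {a : A} : IsUnit a ↔ φ a ≠ 0 := by
  rw [← not_iff_not, not_not, ← hφ.mem_maximalIdeal_iff]; rfl

lemma isUnit_two (hp : p ≠ 2) : IsUnit (2 : A) := by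
  rw [hφ.isUnit_iff, map_ofNat]
  exact Ring.two_ne_zero (by rwa [ringChar.eq F p])

/-- As p ∈ 𝔪, the error p^n a' y tends to 0 uniformly in the uncontrolled a', so a • y is a limit of
the elements c • y. -/
lemma smul_mem_of_approx [TopologicalSpace A] [IsTopologicalRing A] [CompactSpace A]
    [T2Space A] {X : Type*} [AddCommGroup X] [Module A X] [TopologicalSpace X] [ContinuousSMul A X]
    [ContinuousAdd X] {M : AddSubgroup X} (hM : IsClosed (M : Set X)) {a : A} {y : X}
    (key : ∀ n, ∃ c a' : A, a = c + p ^ n * a' ∧ c • y ∈ M) : a • y ∈ M := by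
  by_contra hc
  have hcont : Continuous fun z : X => a • y + (-1 : A) • z := by fun_prop
  have hU : (fun z : X => a • y + (-1 : A) • z) ⁻¹' (M : Set X)ᶜ ∈ 𝓝 0 :=
    (hM.isOpen_compl.preimage hcont).mem_nhds (by simpa using hc)
  obtain ⟨n, hn⟩ := eventually_pow_mul_mem hφ.natCast_mem y hU
  obtain ⟨c, a', h1, h2⟩ := key n
  refine hn a' ?_
  have : a • y + (-1 : A) • ((p : A) ^ n * a') • y = c • y := by
    rw [h1]; module
  change a • y + (-1 : A) • ((p : A) ^ n * a') • y ∈ M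
  rwa [this]

/-- A closed subgroup of a topological module which is stable under the constants of `K` is stable
under the image of `W(K)`. -/
lemma smul_mem_of_const [Finite F] [TopologicalSpace A] [IsTopologicalRing A] [CompactSpace A]
    [T2Space A] {X : Type*} [AddCommGroup X] [Module A X] [TopologicalSpace X] [ContinuousSMul A X]
    [ContinuousAdd X] {K : Subfield F} {M : AddSubgroup X} (hM : IsClosed (M : Set X))
    (h : ∀ x ∈ K, ∀ y ∈ M, const p A x • y ∈ M) {a : A} (ha : a ∈ wittSubring p A K) {y : X}
    (hy : y ∈ M) : a • y ∈ M := by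
  -- `c` is a partial sum of the Teichmüller expansion of a; the factor p^n acts as an integer,
  -- hence preserves M.
  have key : ∀ n, ∃ c : A, ∃ a' ∈ wittSubring p A K, a = c + p ^ n * a' ∧ c • y ∈ M := by
    intro n
    induction n with
    | zero => exact ⟨0, a, ha, by simp, by simp [M.zero_mem]⟩
    | succ n ih =>
      obtain ⟨c, a', ha', rfl, hc⟩ := ih
      obtain ⟨x, hx, a'', ha'', rfl⟩ := exists_eq_const_add ha'
      refine ⟨c + p ^ n * const p A x, a'', ha'', by ring, ?_⟩
      rw [add_smul, mul_smul, ← Nat.cast_pow, Nat.cast_smul_eq_nsmul]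
      exact M.add_mem hc (M.nsmul_mem (h x hx y hy) _)
  refine hφ.smul_mem_of_approx hM fun n => ?_
  obtain ⟨c, a', -, h⟩ := key n
  exact ⟨c, a', h⟩

lemma inverse_two_mul_two (hp : p ≠ 2) : Ring.inverse (2 : A) * 2 = 1 :=
  Ring.inverse_mul_cancel _ (hφ.isUnit_two hp)

/-- 1/2 is the p-adic limit of the integers (p^n + 1)/2, which preserve every subgroup. -/
lemma inverse_two_smul_mem [TopologicalSpace A] [IsTopologicalRing A] [CompactSpace A]
    [T2Space A] {X : Type*} [AddCommGroup X] [Module A X] [TopologicalSpace X] [ContinuousSMul A X]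
    [ContinuousAdd X] (hp : p ≠ 2) {M : AddSubgroup X} (hM : IsClosed (M : Set X)) {y : X}
    (hy : y ∈ M) : Ring.inverse (2 : A) • y ∈ M := by
  refine hφ.smul_mem_of_approx hM fun n => ?_
  obtain ⟨k, hk⟩ : Odd (p ^ n) := ((Fact.out : p.Prime).odd_of_ne_two hp).pow
  refine ⟨(k + 1 : ℕ), -Ring.inverse 2, ?_, ?_⟩
  · have h2 := hφ.inverse_two_mul_two hp
    have hk' : (p : A) ^ n = 2 * k + 1 := by exact_mod_cast congrArg (Nat.cast (R := A)) hk
    rw [hk']; push_cast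
    linear_combination ((k : A) + 1) * h2
  · rw [Nat.cast_smul_eq_nsmul]
    exact M.nsmul_mem hy _

/-- The inverse is taken in W(K) before mapping to A; this allows eigenvalue differences to be
inverted inside a W(K)-module. -/
lemma exists_mul_eq_one {K : Subfield F} {a : A} (ha : a ∈ wittSubring p A K) (h0 : φ a ≠ 0) :
    ∃ a' ∈ wittSubring p A K, a' * a = 1 := by
  obtain ⟨w, rfl⟩ := ha
  have hw : IsUnit w := by
    refine WittVector.isUnit_of_coeff_zero_ne_zero w fun h => h0 ?_
    simp [hφ.algebraMap_eq, WittVector.map_coeff, h]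
  obtain ⟨v, hv⟩ := hw.exists_left_inv
  refine ⟨_, ⟨v, rfl⟩, ?_⟩
  rw [← map_mul, hv, map_one]

end IsResidueMap

end witt

open Filter Topology Pointwise

/-! ### Algebra of generalized matrix algebras -/

namespace GMA

section algebra

variable {A : Type uA} {B : Type uB} {C : Type uC} [CommRing A] [AddCommGroup B]
    [Module A B] [AddCommGroup C] [Module A C] {D : GMAData A B C}

@[simp] lemma sub_a (x y : GMA D) : (x - y).a = x.a - y.a := by simp [sub_eq_add_neg]
@[simp] lemma sub_b (x y : GMA D) : (x - y).b = x.b - y.b := by simp [sub_eq_add_neg]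
@[simp] lemma sub_c (x y : GMA D) : (x - y).c = x.c - y.c := by simp [sub_eq_add_neg]
@[simp] lemma sub_d (x y : GMA D) : (x - y).d = x.d - y.d := by simp [sub_eq_add_neg]

instance : IsScalarTower A (GMA D) (GMA D) where
  smul_assoc r x y := by
    ext <;> simp only [smul_eq_mul, smul_a, smul_b, smul_c, smul_d, mul_a, mul_b, mul_c, mul_d,
      map_smul, LinearMap.smul_apply, smul_add, smul_smul, mul_comm r]
    · ring
    · ring

instance : SMulCommClass A (GMA D) (GMA D) where
  smul_comm r x y := by
    ext <;> simp only [smul_eq_mul, smul_a, smul_b, smul_c, smul_d, mul_a, mul_b, mul_c, mul_d,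
      map_smul, LinearMap.smul_apply, smul_add, smul_smul, mul_comm r]
    · ring
    · ring

/-- The entries as linear maps. -/
@[simps] def aLin (D : GMAData A B C) : GMA D →ₗ[A] A where
  toFun := a
  map_add' _ _ := rfl
  map_smul' _ _ := rfl

@[simps] def bLin (D : GMAData A B C) : GMA D →ₗ[A] B where
  toFun := b
  map_add' _ _ := rfl
  map_smul' _ _ := rfl

@[simps] def cLin (D : GMAData A B C) : GMA D →ₗ[A] C where
  toFun := c
  map_add' _ _ := rfl
  map_smul' _ _ := rfl

@[simps] def dLin (D : GMAData A B C) : GMA D →ₗ[A] A where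
  toFun := d
  map_add' _ _ := rfl
  map_smul' _ _ := rfl

lemma trace_add (x y : GMA D) : (x + y).trace = x.trace + y.trace := by
  simp only [trace, add_a, add_d]; ring

lemma trace_sub (x y : GMA D) : (x - y).trace = x.trace - y.trace := by
  simp only [trace, sub_a, sub_d]; ring

lemma trace_neg (x : GMA D) : (-x).trace = -x.trace := by
  simp only [trace, neg_a, neg_d]; ring

lemma trace_smul (r : A) (x : GMA D) : (r • x).trace = r * x.trace := by
  simp only [trace, smul_a, smul_d]; ring

lemma trace_one : (1 : GMA D).trace = 2 := by simp only [trace, one_a, one_d]; norm_num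

lemma trace_zero : (0 : GMA D).trace = 0 := by simp [trace]

lemma trace_mul_comm (x y : GMA D) : (x * y).trace = (y * x).trace := by
  simp only [trace, mul_a, mul_d]; ring

/-- The associativity relation on B, paired with one more element of C. It is the relation behind
`det_mul`. -/
lemma m_mul_m_comm (D : GMAData A B C) (b b' : B) (c c' : C) :
    D.m b c' * D.m b' c = D.m b c * D.m b' c' := by
  have := congrArg (fun z => D.m z c) (D.assoc_left b b' c')
  simp only [map_smul, LinearMap.smul_apply, smul_eq_mul] at this
  rw [this, mul_comm]

lemma det_mul (x y : GMA D) : (x * y).det = x.det * y.det := by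
  have := m_mul_m_comm D x.b y.b x.c y.c
  simp only [det, mul_a, mul_b, mul_c, mul_d, map_add, map_smul, LinearMap.add_apply,
    LinearMap.smul_apply, smul_eq_mul]
  linear_combination this

lemma det_one : (1 : GMA D).det = 1 := by simp [det]

/-- The adjugate matrix. -/
def adj (x : GMA D) : GMA D := ⟨x.d, -x.b, -x.c, x.a⟩

lemma adj_mul (x : GMA D) : adj x * x = x.det • 1 := by
  ext <;> simp only [adj, det, mul_a, mul_b, mul_c, mul_d, smul_a, smul_b, smul_c, smul_d, one_a,
    one_b, one_c, one_d, map_neg, LinearMap.neg_apply, smul_neg, smul_zero] <;> first | ring | abel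

lemma mul_adj (x : GMA D) : x * adj x = x.det • 1 := by
  ext <;> simp only [adj, det, mul_a, mul_b, mul_c, mul_d, smul_a, smul_b, smul_c, smul_d, one_a,
    one_b, one_c, one_d, map_neg, LinearMap.neg_apply, smul_neg, smul_zero] <;> first | ring | abel

lemma add_adj (x : GMA D) : x + adj x = x.trace • 1 := by
  ext <;> simp [adj, trace, add_comm]

/-- Cayley–Hamilton, from adj x = tr(x) − x and adj(x) x = det x. -/
lemma mul_self_eq (x : GMA D) : x * x = x.trace • x - x.det • 1 := by
  have h1 : adj x = x.trace • 1 - x := by rw [← add_adj]; abel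
  have h2 := adj_mul x
  rw [h1, sub_mul, smul_mul_assoc, one_mul] at h2
  rw [← h2]; abel

lemma isUnit_of_isUnit_det {x : GMA D} (h : IsUnit x.det) : IsUnit x := by
  obtain ⟨u, hu⟩ := h
  refine ⟨⟨x, (↑u⁻¹ : A) • adj x, ?_, ?_⟩, rfl⟩
  · rw [mul_smul_comm, mul_adj, smul_smul, ← hu, Units.inv_mul, one_smul]
  · rw [smul_mul_assoc, adj_mul, smul_smul, ← hu, Units.inv_mul, one_smul]

/-- The determinant as a monoid homomorphism. -/
@[simps] def detHom (D : GMAData A B C) : GMA D →* A where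
  toFun := det
  map_one' := det_one
  map_mul' := det_mul

lemma isUnit_det (x : (GMA D)ˣ) : IsUnit (x : GMA D).det := (x.isUnit).map (detHom D)

lemma coe_inv_eq_adj {x : (GMA D)ˣ} (h : (x : GMA D).det = 1) :
    ((x⁻¹ : (GMA D)ˣ) : GMA D) = adj (x : GMA D) := by
  have := mul_adj (x : GMA D)
  rw [h, one_smul] at this
  exact (Units.eq_inv_of_mul_eq_one_left this).symm

/-- A diagonal matrix. -/
def diag (D : GMAData A B C) (a d : A) : GMA D := ⟨a, 0, 0, d⟩

@[simp] lemma diag_a (a d : A) : (diag D a d).a = a := rfl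
@[simp] lemma diag_b (a d : A) : (diag D a d).b = 0 := rfl
@[simp] lemma diag_c (a d : A) : (diag D a d).c = 0 := rfl
@[simp] lemma diag_d (a d : A) : (diag D a d).d = d := rfl

lemma diag_mul_diag (a d a' d' : A) : diag D a d * diag D a' d' = diag D (a * a') (d * d') := by
  ext <;> simp

lemma diag_one : diag D 1 1 = 1 := rfl

/-! ### Trace and commutator identities for Θ -/

section theta

lemma theta_add (x y : GMA D) : theta (x + y) = theta x + theta y := by
  simp only [theta, trace_add]; module

lemma theta_sub (x y : GMA D) : theta (x - y) = theta x - theta y := by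
  simp only [theta, trace_sub]; module

lemma theta_smul (r : A) (x : GMA D) : theta (r • x) = r • theta x := by
  simp only [theta, trace_smul]; module

variable (h2 : Ring.inverse (2 : A) * 2 = 1)
include h2

lemma theta_one : theta (1 : GMA D) = 0 := by
  rw [theta, trace_one, h2, one_smul, sub_self]

lemma trace_theta (x : GMA D) : (theta x).trace = 0 := by
  rw [theta, trace_sub, trace_smul, trace_one]; linear_combination -x.trace * h2

lemma theta_a (x : GMA D) : (theta x).a = Ring.inverse 2 * (x.a - x.d) := by
  simp only [theta, sub_a, smul_a, one_a, trace]
  linear_combination -x.a * h2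

omit h2 in
lemma theta_b (x : GMA D) : (theta x).b = x.b := by simp [theta]

omit h2 in
lemma theta_c (x : GMA D) : (theta x).c = x.c := by simp [theta]

-- Θ subtracts a scalar, which does not affect commutators, and xy and yx have the same trace.
omit h2 in
lemma theta_mul_sub_mul (x y : GMA D) :
    theta x * theta y - theta y * theta x = theta (x * y) - theta (y * x) := by
  rw [← theta_sub, theta, theta, theta, trace_sub, trace_mul_comm x y, sub_self, mul_zero,
    zero_smul, sub_zero]
  simp only [sub_mul, mul_sub, smul_mul_assoc, one_mul, mul_smul_comm, mul_one]
  module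

-- Because tr(x) = x + adj x. When det x = 1 the adjugate is x⁻¹, so multiplication by tr x
-- preserves the additive span of Θ of a group.
omit h2 in
lemma trace_smul_theta {x : GMA D} (y : GMA D) :
    x.trace • theta y = theta (x * y) + theta (adj x * y) := by
  rw [← theta_add, ← add_mul, add_adj, smul_mul_assoc, one_mul, theta_smul]

lemma trace_theta_mul_theta (x y : GMA D) :
    (theta x * theta y).trace = (x * y).trace - Ring.inverse 2 * (x.trace * y.trace) := by
  simp only [theta, sub_mul, mul_sub, smul_mul_assoc, one_mul, mul_smul_comm, mul_one,
    trace_sub, trace_smul, trace_one]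
  linear_combination x.trace * y.trace * Ring.inverse 2 * h2

end theta

end algebra

end GMA

open Filter Topology Pointwise

/-! ### Topology of generalized matrix algebras -/

namespace GMA

section topology

variable {A : Type uA} {B : Type uB} {C : Type uC} [CommRing A] [AddCommGroup B]
    [Module A B] [AddCommGroup C] [Module A C] {D : GMAData A B C}
    [TopologicalSpace A] [TopologicalSpace B] [TopologicalSpace C]

/-- The underlying space of a generalized matrix algebra. -/
def homeo (D : GMAData A B C) : GMA D ≃ₜ A × B × C × A :=
  Equiv.toHomeomorphOfIsInducing
    { toFun := fun x => (x.a, x.b, x.c, x.d)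
      invFun := fun q => ⟨q.1, q.2.1, q.2.2.1, q.2.2.2⟩
      left_inv := fun _ => rfl
      right_inv := fun _ => rfl } ⟨rfl⟩

@[fun_prop] lemma continuous_a : Continuous (a : GMA D → A) := (homeo D).continuous.fst
@[fun_prop] lemma continuous_b : Continuous (b : GMA D → B) := (homeo D).continuous.snd.fst
@[fun_prop] lemma continuous_c : Continuous (c : GMA D → C) := (homeo D).continuous.snd.snd.fst
@[fun_prop] lemma continuous_d : Continuous (d : GMA D → A) := (homeo D).continuous.snd.snd.snd

lemma continuous_of_entries {X : Type*} [TopologicalSpace X] {f : X → GMA D}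
    (ha : Continuous fun x => (f x).a) (hb : Continuous fun x => (f x).b)
    (hc : Continuous fun x => (f x).c) (hd : Continuous fun x => (f x).d) : Continuous f :=
  (homeo D).symm.continuous.comp (ha.prodMk (hb.prodMk (hc.prodMk hd)))

instance [T2Space A] [T2Space B] [T2Space C] : T2Space (GMA D) := (homeo D).symm.t2Space

instance [CompactSpace A] [CompactSpace B] [CompactSpace C] : CompactSpace (GMA D) :=
  (homeo D).symm.compactSpace

variable [IsTopologicalRing A] [ContinuousAdd B] [ContinuousAdd C]
  [ContinuousSMul A B] [ContinuousSMul A C]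

instance : ContinuousAdd (GMA D) where
  continuous_add := by
    apply continuous_of_entries <;> simp only [add_a, add_b, add_c, add_d] <;> fun_prop

instance : ContinuousSMul A (GMA D) where
  continuous_smul := by
    apply continuous_of_entries <;> simp only [smul_a, smul_b, smul_c, smul_d] <;> fun_prop

instance : IsTopologicalAddGroup (GMA D) where
  continuous_neg := by
    have : (fun x : GMA D => -x) = fun x => (-1 : A) • x := by ext1 x; simp
    rw [this]; fun_prop

lemma continuousMul (hm : Continuous fun q : B × C => D.m q.1 q.2) : ContinuousMul (GMA D) where
  continuous_mul := by
    have h1 : Continuous fun x : GMA D × GMA D => D.m x.1.b x.2.c :=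
      hm.comp ((continuous_b.comp continuous_fst).prodMk (continuous_c.comp continuous_snd))
    have h2 : Continuous fun x : GMA D × GMA D => D.m x.2.b x.1.c :=
      hm.comp ((continuous_b.comp continuous_snd).prodMk (continuous_c.comp continuous_fst))
    apply continuous_of_entries <;> simp only [mul_a, mul_b, mul_c, mul_d] <;> fun_prop

@[fun_prop] lemma continuous_trace : Continuous (trace : GMA D → A) := by
  unfold trace; fun_prop

end topology

/-! ### The radical -/

section radical

variable {p : ℕ} [Fact p.Prime] {F : Type uF} [Field F] [CharP F p]
  {A : Type uA} {B : Type uB} {C : Type uC} [CommRing A] [IsLocalRing A]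
  [Algebra (WittVector p F) A] [AddCommGroup B]
  [Module A B] [AddCommGroup C] [Module A C] {D : GMAData A B C} {φ : A →+* F}

/-- The left ideal of the matrices whose diagonal entry `a` reduces to zero. -/
def leftIdealA (D : GMAData A B C) (φ : A →+* F) (hBC : ∀ b c, φ (D.m b c) = 0) :
    Ideal (GMA D) where
  carrier := {x | φ x.a = 0}
  add_mem' hx hy := by simp_all
  zero_mem' := by simp
  smul_mem' y x hx := by simp_all

/-- The left ideal of the matrices whose diagonal entry `d` reduces to zero. -/
def leftIdealD (D : GMAData A B C) (φ : A →+* F) (hBC : ∀ b c, φ (D.m b c) = 0) :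
    Ideal (GMA D) where
  carrier := {x | φ x.d = 0}
  add_mem' hx hy := by simp_all
  zero_mem' := by simp
  smul_mem' y x hx := by simp_all

lemma leftIdealA_isMaximal (hφ : IsResidueMap p φ) (hBC : ∀ b c, φ (D.m b c) = 0) :
    (leftIdealA D φ hBC).IsMaximal := by
  refine Ideal.isMaximal_iff.mpr ⟨by simp [leftIdealA], fun J x hJ hx hxJ => ?_⟩
  obtain ⟨u, hu⟩ := (hφ.isUnit_iff (a := x.a)).mpr hx
  have h1 : diag D (↑u⁻¹ : A) 0 * x ∈ J := J.mul_mem_left _ hxJ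
  have h2 : 1 - diag D (↑u⁻¹ : A) 0 * x ∈ J := hJ (by simp [leftIdealA, ← hu])
  simpa using J.add_mem h1 h2

lemma leftIdealD_isMaximal (hφ : IsResidueMap p φ) (hBC : ∀ b c, φ (D.m b c) = 0) :
    (leftIdealD D φ hBC).IsMaximal := by
  refine Ideal.isMaximal_iff.mpr ⟨by simp [leftIdealD], fun J x hJ hx hxJ => ?_⟩
  obtain ⟨u, hu⟩ := (hφ.isUnit_iff (a := x.d)).mpr hx
  have h1 : diag D 0 (↑u⁻¹ : A) * x ∈ J := J.mul_mem_left _ hxJ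
  have h2 : 1 - diag D 0 (↑u⁻¹ : A) * x ∈ J := hJ (by simp [leftIdealD, ← hu])
  simpa using J.add_mem h1 h2

/-- As BC ⊆ 𝔪, reducing the diagonal entries gives a ring homomorphism R → F × F, whose coordinates
define two maximal left ideals. Conversely, if both entries reduce to 0, every yx + 1 has
determinant reducing to 1 and is invertible. -/
lemma mem_jacobson_iff (hφ : IsResidueMap p φ) (hBC : ∀ b c, φ (D.m b c) = 0) (x : GMA D) :
    x ∈ Ring.jacobson (GMA D) ↔ φ x.a = 0 ∧ φ x.d = 0 := by
  constructor
  · intro h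
    rw [Ring.jacobson_eq_sInf_isMaximal, Submodule.mem_sInf] at h
    exact ⟨h _ (leftIdealA_isMaximal hφ hBC), h _ (leftIdealD_isMaximal hφ hBC)⟩
  · rintro ⟨ha, hd⟩
    rw [← Ideal.jacobson_bot, Ideal.mem_jacobson_iff]
    intro y
    have hu : IsUnit (y * x + 1) := by
      apply isUnit_of_isUnit_det
      rw [hφ.isUnit_iff]
      simp [det, ha, hd, hBC]
    obtain ⟨z, hz⟩ := hu.exists_left_inv
    refine ⟨z, ?_⟩
    rw [mul_add, mul_one, ← mul_assoc] at hz
    simp [hz]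

end radical

end GMA

open Filter Topology Pointwise

/-! ### Pink's Lie algebra -/

section lie

variable {A : Type uA} {B : Type uB} {C : Type uC} [CommRing A] [AddCommGroup B]
    [Module A B] [AddCommGroup C] [Module A C] {D : GMAData A B C}

/-- A set of matrices of determinant one, closed under products and inverses. -/
structure IsSpecialGroup (G : Set (GMA D)) : Prop where
  mul_mem : ∀ x ∈ G, ∀ y ∈ G, x * y ∈ G
  adj_mem : ∀ x ∈ G, x.adj ∈ G
  det_eq : ∀ x ∈ G, x.det = 1

/-- The properties of Pink's Lie algebras: they consist of matrices of trace zero, are Lie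
algebras, and `tr(L L) L ⊆ L`. -/
structure IsPinkStable (M : AddSubgroup (GMA D)) : Prop where
  trace_eq : ∀ u ∈ M, u.trace = 0
  bracket_mem : ∀ u ∈ M, ∀ v ∈ M, u * v - v * u ∈ M
  trace_smul_mem : ∀ u ∈ M, ∀ v ∈ M, ∀ w ∈ M, (u * v).trace • w ∈ M

lemma bracket_mem_closure {G : Set (GMA D)} (hG : IsSpecialGroup G) {u v : GMA D}
    (hu : u ∈ AddSubgroup.closure (GMA.theta '' G))
    (hv : v ∈ AddSubgroup.closure (GMA.theta '' G)) :
    u * v - v * u ∈ AddSubgroup.closure (GMA.theta '' G) := by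
  induction hu using AddSubgroup.closure_induction with
  | mem u hu =>
    induction hv using AddSubgroup.closure_induction with
    | mem v hv =>
      obtain ⟨x, hx, rfl⟩ := hu
      obtain ⟨y, hy, rfl⟩ := hv
      rw [GMA.theta_mul_sub_mul]
      exact sub_mem (AddSubgroup.subset_closure ⟨_, hG.mul_mem x hx y hy, rfl⟩)
        (AddSubgroup.subset_closure ⟨_, hG.mul_mem y hy x hx, rfl⟩)
    | zero => simp
    | add v w _ _ h1 h2 => convert add_mem h1 h2 using 1; noncomm_ring
    | neg v _ h => convert neg_mem h using 1; noncomm_ring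
  | zero => simp
  | add v w _ _ h1 h2 => convert add_mem h1 h2 using 1; noncomm_ring
  | neg v _ h => convert neg_mem h using 1; noncomm_ring

lemma trace_smul_mem_closure {G : Set (GMA D)} (hG : IsSpecialGroup G) {x v : GMA D}
    (hx : x ∈ G) (hv : v ∈ AddSubgroup.closure (GMA.theta '' G)) :
    x.trace • v ∈ AddSubgroup.closure (GMA.theta '' G) := by
  induction hv using AddSubgroup.closure_induction with
  | mem v hv =>
    obtain ⟨y, hy, rfl⟩ := hv
    rw [GMA.trace_smul_theta]
    exact add_mem (AddSubgroup.subset_closure ⟨_, hG.mul_mem x hx y hy, rfl⟩)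
      (AddSubgroup.subset_closure ⟨_, hG.mul_mem _ (hG.adj_mem x hx) y hy, rfl⟩)
  | zero => simp
  | add v w _ _ h1 h2 => rw [smul_add]; exact add_mem h1 h2
  | neg v _ h => rw [smul_neg]; exact neg_mem h

variable {p : ℕ} [Fact p.Prime] {F : Type uF} [Field F] [CharP F p]
  [Algebra (WittVector p F) A] [IsLocalRing A] {φ : A →+* F}
  [TopologicalSpace A] [TopologicalSpace B] [TopologicalSpace C]
  [IsTopologicalRing A] [ContinuousAdd B] [ContinuousAdd C]
  [ContinuousSMul A B] [ContinuousSMul A C] [CompactSpace A] [T2Space A]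

/-- For the last property, tr(Θ(x)Θ(y)) = tr(xy) − ½ tr(x)tr(y), and traces of elements of G
preserve the span. Multiplication by ½ is available only in a closed subgroup, so the relation is
proved on generators with values in the closure and then extended by continuity. -/
lemma isPinkStable_topologicalClosure (hφ : IsResidueMap p φ) (hp : p ≠ 2) [T2Space B] [T2Space C]
    [ContinuousMul (GMA D)] {G : Set (GMA D)} (hG : IsSpecialGroup G) :
    IsPinkStable (AddSubgroup.closure (GMA.theta '' G)).topologicalClosure := by
  set L₀ := AddSubgroup.closure (GMA.theta '' G) with hL₀
  have h2 := hφ.inverse_two_mul_two hp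
  have hcl : IsClosed (L₀.topologicalClosure : Set (GMA D)) :=
    AddSubgroup.isClosed_topologicalClosure _
  refine ⟨fun u hu => ?_, fun u hu v hv => ?_, fun u hu v hv w hw => ?_⟩
  · have : L₀.topologicalClosure ≤ ((AddMonoidHom.mk' (GMA.trace (D := D)) GMA.trace_add).ker) := by
      refine AddSubgroup.topologicalClosure_minimal _ ?_ (isClosed_singleton.preimage
        GMA.continuous_trace)
      rw [hL₀, AddSubgroup.closure_le]
      rintro _ ⟨x, -, rfl⟩
      exact GMA.trace_theta h2 x
    exact this hu
  · exact map_mem_closure₂ (f := fun u v : GMA D => u * v - v * u) (by fun_prop) hu hv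
      fun u hu v hv => bracket_mem_closure hG hu hv
  · have key : ∀ w ∈ L₀, ∀ u ∈ L₀, ∀ v ∈ L₀, (u * v).trace • w ∈ L₀.topologicalClosure := by
      intro w hw u hu v hv
      induction hu using AddSubgroup.closure_induction with
      | mem u hu =>
        induction hv using AddSubgroup.closure_induction with
        | mem v hv =>
          obtain ⟨x, hx, rfl⟩ := hu
          obtain ⟨y, hy, rfl⟩ := hv
          rw [GMA.trace_theta_mul_theta h2, sub_smul, mul_smul, mul_smul]
          refine sub_mem (subset_closure (trace_smul_mem_closure hG (hG.mul_mem x hx y hy) hw))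
            (hφ.inverse_two_smul_mem hp hcl (subset_closure ?_))
          exact trace_smul_mem_closure hG hx (trace_smul_mem_closure hG hy hw)
        | zero => simp [GMA.trace_zero]
        | add v w _ _ h1 h2 =>
          rw [mul_add, GMA.trace_add, add_smul]; exact add_mem h1 h2
        | neg v _ h => rw [mul_neg, GMA.trace_neg, neg_smul]; exact neg_mem h
      | zero => simp [GMA.trace_zero]
      | add v w _ _ h1 h2 =>
        rw [add_mul, GMA.trace_add, add_smul]; exact add_mem h1 h2
      | neg v _ h => rw [neg_mul, GMA.trace_neg, neg_smul]; exact neg_mem h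
    -- Continuity is used first in u and v with w fixed in L₀, then in w.
    have key2 : ∀ w ∈ L₀, (u * v).trace • w ∈ L₀.topologicalClosure := by
      intro w hw
      have := map_mem_closure₂ (f := fun u v : GMA D => (u * v).trace • w) (by fun_prop) hu hv
        (key w hw)
      rwa [← SetLike.mem_coe, ← hcl.closure_eq]
    have := map_mem_closure (f := fun w : GMA D => (u * v).trace • w) (by fun_prop) hw key2
    rwa [← SetLike.mem_coe, ← hcl.closure_eq]

/-- `W(K) L` inherits the properties of Pink's Lie algebras. -/
lemma IsPinkStable.span {L : AddSubgroup (GMA D)} (hL : IsPinkStable L) (S : Subring A) :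
    IsPinkStable (Submodule.span S (L : Set (GMA D))).toAddSubgroup := by
  refine ⟨fun u hu => ?_, fun u hu v hv => ?_, fun u hu v hv w hw => ?_⟩
  · induction hu using Submodule.span_induction with
    | mem u hu => exact hL.trace_eq u hu
    | zero => exact GMA.trace_zero
    | add u v _ _ h1 h2 => rw [GMA.trace_add, h1, h2, add_zero]
    | smul r u _ h => rw [Subring.smul_def, GMA.trace_smul, h, mul_zero]
  · change _ ∈ Submodule.span S (L : Set (GMA D))
    induction hu using Submodule.span_induction with
    | mem u hu =>
      induction hv using Submodule.span_induction with
      | mem v hv => exact Submodule.subset_span (hL.bracket_mem u hu v hv)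
      | zero => simp
      | add v w _ _ h1 h2 => convert add_mem h1 h2 using 1; noncomm_ring
      | smul r v _ h =>
        convert Submodule.smul_mem _ r h using 1
        simp only [Subring.smul_def, smul_mul_assoc, mul_smul_comm, smul_sub]
    | zero => simp
    | add v w _ _ h1 h2 => convert add_mem h1 h2 using 1; noncomm_ring
    | smul r v _ h =>
      convert Submodule.smul_mem _ r h using 1
      simp only [Subring.smul_def, smul_mul_assoc, mul_smul_comm, smul_sub]
  · change _ ∈ Submodule.span S (L : Set (GMA D))
    induction hu using Submodule.span_induction with
    | mem u hu =>
      induction hv using Submodule.span_induction with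
      | mem v hv =>
        induction hw using Submodule.span_induction with
        | mem w hw => exact Submodule.subset_span (hL.trace_smul_mem u hu v hv w hw)
        | zero => simp
        | add w w' _ _ h1 h2 => rw [smul_add]; exact add_mem h1 h2
        | smul r w _ h =>
          convert Submodule.smul_mem _ r h using 1
          simp only [Subring.smul_def, smul_smul, mul_comm]
      | zero => simp [GMA.trace_zero]
      | add v w _ _ h1 h2 => rw [mul_add, GMA.trace_add, add_smul]; exact add_mem h1 h2
      | smul r v _ h =>
        convert Submodule.smul_mem _ r h using 1
        simp only [Subring.smul_def, mul_smul_comm, GMA.trace_smul, smul_smul]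
    | zero => simp [GMA.trace_zero]
    | add v w _ _ h1 h2 => rw [add_mul, GMA.trace_add, add_smul]; exact add_mem h1 h2
    | smul r v _ h =>
      convert Submodule.smul_mem _ r h using 1
      simp only [Subring.smul_def, smul_mul_assoc, GMA.trace_smul, smul_smul]

/-- The `W(K)`-span of a compact subgroup is compact. -/
lemma IsResidueMap.isCompact_span (hφ : IsResidueMap p φ) [Finite F] {X : Type*} [AddCommGroup X]
    [Module A X] [TopologicalSpace X] [ContinuousSMul A X] [ContinuousAdd X] [T2Space X]
    (K : Subfield F) {L : AddSubgroup X} (hL : IsCompact (L : Set X)) :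
    IsCompact (Submodule.span (wittSubring p A K) (L : Set X) : Set X) := by
  have := Fintype.ofFinite K
  -- K is finite, so the sum of the s(x)L over x ∈ K is a continuous image of the compact L^K. A
  -- nonzero constant permutes the summands, so this closed subgroup is stable under constants,
  -- hence under W(K), and is the whole span.
  let f : (K → X) →+ X :=
    { toFun := fun g => ∑ x : K, const p A (x : F) • g x
      map_zero' := by simp
      map_add' := fun g h => by simp [smul_add, Finset.sum_add_distrib] }
  have hf : Continuous f := by
    change Continuous fun g : K → X => ∑ x : K, const p A (x : F) • g x
    fun_prop
  set M : AddSubgroup X := (AddSubgroup.pi Set.univ fun _ : K => L).map f with hM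
  have hMc : IsCompact (M : Set X) := by
    rw [hM, AddSubgroup.coe_map, AddSubgroup.coe_pi]
    exact (isCompact_univ_pi fun _ => hL).image hf
  have hmem : ∀ y, y ∈ M ↔ ∃ g : K → X, (∀ x, g x ∈ L) ∧ f g = y := by
    intro y
    simp [hM, AddSubgroup.mem_map, AddSubgroup.mem_pi]
  have hst : ∀ x ∈ K, ∀ y ∈ M, const p A x • y ∈ M := by
    intro x hx y hy
    by_cases h0 : x = 0
    · rw [h0, const_zero, zero_smul]; exact M.zero_mem
    rw [hmem] at hy ⊢
    obtain ⟨g, hg, rfl⟩ := hy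
    have h0' : (⟨x, hx⟩ : K) ≠ 0 := fun h => h0 (congrArg Subtype.val h)
    refine ⟨fun z => g ((⟨x, hx⟩ : K)⁻¹ * z), fun z => hg _, ?_⟩
    change ∑ z : K, const p A (z : F) • g _ = const p A x • ∑ z : K, const p A (z : F) • g z
    rw [← Equiv.sum_comp (Equiv.mulLeft₀ (⟨x, hx⟩ : K) h0'), Finset.smul_sum]
    refine Finset.sum_congr rfl fun z _ => ?_
    simp [h0', smul_smul]
  have heq : (Submodule.span (wittSubring p A K) (L : Set X) : Set X) = M := by
    apply subset_antisymm
    · intro y hy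
      induction hy using Submodule.span_induction with
      | mem y hy =>
        rw [SetLike.mem_coe, hmem]
        classical
        refine ⟨Pi.single 1 y, fun x => ?_, ?_⟩
        · by_cases h : x = 1
          · subst h; simpa using hy
          · simp [h, L.zero_mem]
        · change ∑ z : K, const p A (z : F) • (Pi.single 1 y : K → X) z = y
          rw [Finset.sum_eq_single 1]
          · simp
          · intro z _ hz; simp [hz]
          · simp
      | zero => exact M.zero_mem
      | add y z _ _ h1 h2 => exact M.add_mem h1 h2
      | smul r y _ h => exact hφ.smul_mem_of_const hMc.isClosed hst r.2 h
    · intro y hy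
      rw [SetLike.mem_coe, hmem] at hy
      obtain ⟨g, hg, rfl⟩ := hy
      refine Submodule.sum_mem _ fun x _ => ?_
      exact Submodule.smul_mem _ (⟨_, const_mem_wittSubring x.2⟩ : wittSubring p A K)
        (Submodule.subset_span (hg x))
  rw [heq]
  exact hMc

end lie

open Filter Topology Pointwise

/-! ### Decomposition of stable Lie algebras -/

namespace GMA

variable {A : Type uA} {B : Type uB} {C : Type uC} [CommRing A] [AddCommGroup B]
    [Module A B] [AddCommGroup C] [Module A C]

/-- The diagonal matrices of trace zero. -/
@[simps] def diagZero (D : GMAData A B C) : A →ₗ[A] GMA D where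
  toFun i := ⟨i, 0, 0, -i⟩
  map_add' i j := by ext <;> simp [add_comm]
  map_smul' r i := by ext <;> simp

/-- The strictly upper triangular matrices. -/
@[simps] def upper (D : GMAData A B C) : B →ₗ[A] GMA D where
  toFun b := ⟨0, b, 0, 0⟩
  map_add' i j := by ext <;> simp
  map_smul' r i := by ext <;> simp

/-- The strictly lower triangular matrices. -/
@[simps] def lower (D : GMAData A B C) : C →ₗ[A] GMA D where
  toFun c := ⟨0, 0, c, 0⟩
  map_add' i j := by ext <;> simp
  map_smul' r i := by ext <;> simp

variable {D : GMAData A B C}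

lemma eq_diagZero_add_upper_add_lower {u : GMA D} (hu : u.trace = 0) :
    u = diagZero D u.a + upper D u.b + lower D u.c := by
  have : u.d = -u.a := (neg_eq_of_add_eq_zero_right hu).symm
  ext <;> simp [this]

end GMA

open GMA

section stable

variable {p : ℕ} [Fact p.Prime] {F : Type uF} [Field F] [CharP F p]
  {A : Type uA} {B : Type uB} {C : Type uC} [CommRing A] [AddCommGroup B]
  [Module A B] [AddCommGroup C] [Module A C] {D : GMAData A B C}
  [Algebra (WittVector p F) A] [IsLocalRing A] {φ : A →+* F}

lemma IsPinkStable.m_mem {M : AddSubgroup (GMA D)} (hM : IsPinkStable M) {b : B} {c : C}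
    (hb : upper D b ∈ M) (hc : lower D c ∈ M) : diagZero D (D.m b c) ∈ M := by
  convert hM.bracket_mem _ hb _ hc using 1
  ext <;> simp

section closed

variable [TopologicalSpace A] [TopologicalSpace B] [TopologicalSpace C]
  [IsTopologicalRing A] [ContinuousAdd B] [ContinuousAdd C]
  [ContinuousSMul A B] [ContinuousSMul A C] [CompactSpace A] [T2Space A]
  (hφ : IsResidueMap p φ) (hp : p ≠ 2) {M : AddSubgroup (GMA D)} (hM : IsPinkStable M)
  (hcl : IsClosed (M : Set (GMA D)))
include hφ hp hM hcl

/-- The bracket of diag(i, −i) with the upper matrix b is the upper matrix 2ib; closedness removes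
the 2. -/
lemma IsPinkStable.smul_upper_mem {i : A} {b : B}
    (hi : diagZero D i ∈ M) (hb : upper D b ∈ M) : upper D (i • b) ∈ M := by
  convert hφ.inverse_two_smul_mem hp hcl (hM.bracket_mem _ hi _ hb) using 1
  have h2 := hφ.inverse_two_mul_two hp
  ext
  · simp
  · simp only [upper_apply_b, smul_b, sub_b, mul_b, diagZero_apply_a, diagZero_apply_b,
      diagZero_apply_d, upper_apply_a, upper_apply_d]
    rw [show (i • b + (0 : A) • (0 : B) - ((0 : A) • (0 : B) + (-i) • b)) = (2 * i) • b by module,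
      smul_smul, ← mul_assoc, h2, one_mul]
  · simp
  · simp

lemma IsPinkStable.smul_lower_mem {i : A} {c : C}
    (hi : diagZero D i ∈ M) (hc : lower D c ∈ M) : lower D (i • c) ∈ M := by
  convert hφ.inverse_two_smul_mem hp hcl (hM.bracket_mem _ hc _ hi) using 1
  have h2 := hφ.inverse_two_mul_two hp
  ext
  · simp
  · simp
  · simp only [lower_apply_c, smul_c, sub_c, mul_c, diagZero_apply_a, diagZero_apply_c,
      diagZero_apply_d, lower_apply_a, lower_apply_d]
    rw [show (i • c + (0 : A) • (0 : C) - ((0 : A) • (0 : C) + (-i) • c)) = (2 * i) • c by module,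
      smul_smul, ← mul_assoc, h2, one_mul]
  · simp

/-- Since tr(diag(i, −i) diag(j, −j)) = 2ij, the relation tr(LL)L ⊆ L becomes I³ ⊆ I. -/
lemma IsPinkStable.mul_mul_mem {i j k : A}
    (hi : diagZero D i ∈ M) (hj : diagZero D j ∈ M) (hk : diagZero D k ∈ M) :
    diagZero D (i * j * k) ∈ M := by
  convert hφ.inverse_two_smul_mem hp hcl (hM.trace_smul_mem _ hi _ hj _ hk) using 1
  have h2 := hφ.inverse_two_mul_two hp
  have h : (diagZero D i * diagZero D j).trace = 2 * (i * j) := by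
    simp only [trace, mul_a, mul_d, diagZero_apply_a, diagZero_apply_b, diagZero_apply_c,
      diagZero_apply_d, map_zero]
    ring
  rw [h, smul_smul, ← mul_assoc, h2, one_mul, ← map_smul, smul_eq_mul]

end closed

/-- A `W(K)`-module of matrices of trace zero which is stable under a conjugation by diagonal
constants with eigenvalues `1`, `z`, `z⁻¹` distinct in `K` contains the components of its
elements. -/
lemma mem_components (hφ : IsResidueMap p φ) {K : Subfield F}
    {M : Submodule (wittSubring p A K) (GMA D)} (hM : ∀ u ∈ M, u.trace = 0) {z : F} (hz : z ∈ K)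
    (hz0 : z ≠ 0) (hz2 : z ^ 2 ≠ 1)
    (hst : ∀ u ∈ M, (⟨u.a, const p A z • u.b, const p A z⁻¹ • u.c, u.d⟩ : GMA D) ∈ M)
    {u : GMA D} (hu : u ∈ M) :
    diagZero D u.a ∈ M ∧ upper D u.b ∈ M ∧ lower D u.c ∈ M := by
  set s := const p A z with hs
  set s' := const p A z⁻¹ with hs'
  have hss' : s * s' = 1 := by rw [hs, hs', ← map_mul, mul_inv_cancel₀ hz0, map_one]
  have hsW : s ∈ wittSubring p A K := const_mem_wittSubring hz
  have hsW' : s' ∈ wittSubring p A K := const_mem_wittSubring (K.inv_mem hz)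
  have hsmul : ∀ r ∈ wittSubring p A K, ∀ v ∈ M, r • v ∈ M := fun r hr v hv =>
    M.smul_mem (⟨r, hr⟩ : wittSubring p A K) hv
  have hz1 : z ≠ 1 := fun h => hz2 (by rw [h, one_pow])
  -- The diagonal has eigenvalue 1, so subtracting u removes it. Conjugating once more and
  -- subtracting s' times this element removes the lower entry and leaves (s − s')(s − 1) • u.b
  -- above.
  have h1 : (⟨0, (s - 1) • u.b, (s' - 1) • u.c, 0⟩ : GMA D) ∈ M := by
    convert M.sub_mem (hst u hu) hu using 1
    ext <;> simp [sub_smul]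
  have h2 : (⟨0, (s * (s - 1)) • u.b, (s' * (s' - 1)) • u.c, 0⟩ : GMA D) ∈ M := by
    simpa only [smul_smul] using hst _ h1
  have hup : upper D u.b ∈ M := by
    -- z² ≠ 1 gives both z ≠ z⁻¹ and z ≠ 1, so this factor is invertible in W(K).
    obtain ⟨r, hr, hr1⟩ := hφ.exists_mul_eq_one (a := (s - s') * (s - 1))
      (mul_mem (sub_mem hsW hsW') (sub_mem hsW (one_mem _))) (by
        rw [map_mul, map_sub, map_sub, map_one, hφ.const_eq, hφ.const_eq]
        refine mul_ne_zero (fun h => hz2 ?_) (sub_ne_zero.mpr hz1)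
        rw [sub_eq_zero] at h
        rw [sq]; nth_rewrite 2 [h]; exact mul_inv_cancel₀ hz0)
    convert hsmul r hr _ (M.sub_mem h2 (hsmul s' hsW' _ h1)) using 1
    ext
    · simp
    · simp only [upper_apply_b, smul_b, sub_b, smul_smul, ← sub_smul]
      rw [show r * (s * (s - 1) - s' * (s - 1)) = r * ((s - s') * (s - 1)) by ring, hr1, one_smul]
    · simp [smul_smul]
    · simp
  have hlow : lower D u.c ∈ M := by
    obtain ⟨r, hr, hr1⟩ := hφ.exists_mul_eq_one (a := s' - 1) (sub_mem hsW' (one_mem _)) (by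
        rw [map_sub, map_one, hφ.const_eq, sub_ne_zero]
        exact fun h => hz1 (inv_eq_one.mp h))
    convert hsmul r hr _ (M.sub_mem h1 (hsmul (s - 1) (sub_mem hsW (one_mem _)) _ hup)) using 1
    ext <;> simp [smul_smul, hr1]
  refine ⟨?_, hup, hlow⟩
  convert M.sub_mem (M.sub_mem hu hup) hlow using 1
  rw [sub_sub, eq_sub_iff_add_eq, ← add_assoc]
  exact (eq_diagZero_add_upper_add_lower (hM u hu)).symm

end stable

section wittCompact

variable {p : ℕ} [Fact p.Prime] {F : Type uF} [Field F] [Finite F] [CharP F p]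
  {A : Type uA} [CommRing A] [Algebra (WittVector p F) A] [IsLocalRing A] {φ : A →+* F}
  [TopologicalSpace A] [IsTopologicalRing A] [CompactSpace A] [T2Space A]

/-- The image of `W(F)` in `A` is compact. -/
lemma IsResidueMap.isCompact_range_algebraMap (hφ : IsResidueMap p φ) :
    IsCompact (Set.range (algebraMap (WittVector p F) A)) := by
  let _ : TopologicalSpace F := ⊥
  have : DiscreteTopology F := ⟨rfl⟩
  -- The product F^ℕ is compact. Witt vectors with the same first n coefficients differ by a
  -- multiple of p^n, and the ideals p^n A shrink to 0.
  have hc : Continuous fun f : ℕ → F => algebraMap (WittVector p F) A (WittVector.mk p f) := by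
    rw [continuous_iff_continuousAt]
    intro f
    refine fun U hU => ?_
    set y := algebraMap _ A (WittVector.mk p f) with hy
    have hcont : Continuous fun x : A => y + x := by fun_prop
    obtain ⟨n, hn⟩ := topNil_span_singleton hφ.natCast_mem _
      (hcont.continuousAt.preimage_mem_nhds (x := 0) (by simpa using hU))
    have hev : ∀ᶠ g in 𝓝 f, ∀ i ∈ Finset.range n, g i = f i :=
      (Filter.eventually_all_finset _).mpr fun i _ =>
        ((continuous_apply i).continuousAt (x := f)).preimage_mem_nhds
          ((isOpen_discrete {f i}).mem_nhds rfl)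
    rw [Filter.mem_map]
    filter_upwards [hev] with g hg
    have hd : WittVector.mk p g - WittVector.mk p f ∈ Ideal.span {(p ^ n : WittVector p F)} := by
      rw [WittVector.mem_span_p_pow_iff_le_coeff_eq_zero,
        ← WittVector.le_coeff_eq_iff_le_sub_coeff_eq_zero]
      exact fun i hi => hg i (Finset.mem_range.mpr hi)
    have := hn (show algebraMap _ A (WittVector.mk p g - WittVector.mk p f) ∈ _ by
      rw [SetLike.mem_coe, Ideal.span_singleton_pow, Ideal.mem_span_singleton]
      simpa using map_dvd (algebraMap _ A) (Ideal.mem_span_singleton.mp hd))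
    simpa [hy] using this
  have : Set.range (algebraMap (WittVector p F) A) =
      Set.range fun f : ℕ → F => algebraMap (WittVector p F) A (WittVector.mk p f) := by
    ext a
    constructor
    · rintro ⟨w, rfl⟩; exact ⟨w.coeff, rfl⟩
    · rintro ⟨f, rfl⟩; exact ⟨_, rfl⟩
  rw [this]
  exact isCompact_range hc

/-- An element of `1 + 𝔪` is a limit of powers of its square. -/
lemma IsResidueMap.mem_of_sq_mem (hφ : IsResidueMap p φ) (hp : p ≠ 2) {T : Set A}
    (hT : IsClosed T) {y : A} (hy : φ y = 1) (h : ∀ n, (y ^ 2) ^ n ∈ T) : y ∈ T := by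
  by_contra hc
  have hcont : Continuous fun x : A => y + x * y := by fun_prop
  have hU : (fun x : A => y + x * y) ⁻¹' Tᶜ ∈ 𝓝 0 :=
    (hT.isOpen_compl.preimage hcont).mem_nhds (by simpa using hc)
  have hJ : Ideal.span {(p : A), y - 1} ≤ IsLocalRing.maximalIdeal A := by
    rw [Ideal.span_le]
    rintro x (rfl | rfl)
    · exact hφ.natCast_mem
    · exact (hφ.mem_maximalIdeal_iff _).mpr (by simp [hy])
  obtain ⟨n, hn⟩ := topNil_of_fg (Submodule.fg_span (Set.toFinite _)) hJ _ hU
  have h1 := pow_prime_pow_sub_one_mem (J := Ideal.span {(p : A), y - 1}) (p := p) (u := y)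
    (Ideal.subset_span (by simp)) (Ideal.subset_span (by simp)) n
  -- y · y^(p^n) = (y²)^((p^n+1)/2) lies in T, and y^(p^n) tends to 1 because the powers of (p, y −
  -- 1) tend to 0.
  obtain ⟨k, hk⟩ : Odd (p ^ n) := ((Fact.out : p.Prime).odd_of_ne_two hp).pow
  refine hn (Ideal.pow_le_pow_right (Nat.le_succ n) h1) ?_
  have := h (k + 1)
  rw [← pow_mul, show 2 * (k + 1) = p ^ n + 1 by omega, pow_succ] at this
  convert this using 1
  ring

end wittCompact

open Filter Topology Pointwise GMA

/-! ### Closed products -/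

section closedProd

variable {A : Type uA} [CommRing A] [TopologicalSpace A]

lemma closedProd_subset {X Y : Type*} {f : X → Y → A} {S : Set X} {T : Set Y} {N : AddSubgroup A}
    (hN : IsClosed (N : Set A)) (h : ∀ s ∈ S, ∀ t ∈ T, f s t ∈ N) : closedProd f S T ⊆ N := by
  refine closure_minimal ?_ hN
  rw [SetLike.coe_subset_coe, AddSubgroup.closure_le]
  rintro _ ⟨s, hs, t, ht, rfl⟩
  exact h s hs t ht

lemma mem_closedProd {X Y : Type*} {f : X → Y → A} {S : Set X} {T : Set Y} {s : X} {t : Y}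
    (hs : s ∈ S) (ht : t ∈ T) : f s t ∈ closedProd f S T :=
  subset_closure (AddSubgroup.subset_closure ⟨s, hs, t, ht, rfl⟩)

lemma smul_mem_of_mem_closedProd [IsTopologicalRing A] {X : Type*} [AddCommGroup X] [Module A X]
    [TopologicalSpace X] [ContinuousSMul A X] {N : AddSubgroup X} (hN : IsClosed (N : Set X))
    {S T : Set A} {y : X} (h : ∀ s ∈ S, ∀ t ∈ T, (s * t) • y ∈ N) {a : A}
    (ha : a ∈ closedProd (· * ·) S T) : a • y ∈ N := by
  let N' : AddSubgroup A := N.comap ((LinearMap.toSpanSingleton A X y).toAddMonoidHom)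
  have hN' : IsClosed (N' : Set A) :=
    hN.preimage (show Continuous fun a : A => a • y by fun_prop)
  exact closedProd_subset hN' h ha

/-- `closedProd` as a subgroup. -/
def closedProdSubgroup [IsTopologicalRing A] (S T : Set A) : AddSubgroup A :=
  (AddSubgroup.closure (Set.image2 (· * ·) S T)).topologicalClosure

lemma forall_mem_of_dense {W : Type*} [CommRing W] [Algebra W A] {s T : Set A}
    (hd : Dense (Algebra.adjoin W s : Set A)) (hT : IsClosed T) (hs : s ⊆ T)
    (hW : ∀ w, algebraMap W A w ∈ T) (hadd : ∀ x ∈ T, ∀ y ∈ T, x + y ∈ T)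
    (hmul : ∀ x ∈ T, ∀ y ∈ T, x * y ∈ T) (a : A) : a ∈ T := by
  refine closure_minimal (fun x hx => ?_) hT (hd a)
  induction hx using Algebra.adjoin_induction with
  | mem x hx => exact hs hx
  | algebraMap w => exact hW w
  | add x y _ _ h1 h2 => exact hadd _ h1 _ h2
  | mul x y _ _ h1 h2 => exact hmul _ h1 _ h2

/-- `W + W I + W I²` is closed under products when `I³ ⊆ I`. -/
lemma span_mul_span_le [IsTopologicalRing A] (S : Subring A) {I : AddSubgroup A}
    (hcl : IsClosed (I : Set A)) (h3 : ∀ i ∈ I, ∀ j ∈ I, ∀ k ∈ I, i * j * k ∈ I) {x y : A}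
    (hx : x ∈ Submodule.span S ({1} : Set A) ⊔ Submodule.span S (I : Set A) ⊔
      Submodule.span S (closedProd (· * ·) (I : Set A) (I : Set A)))
    (hy : y ∈ Submodule.span S ({1} : Set A) ⊔ Submodule.span S (I : Set A) ⊔
      Submodule.span S (closedProd (· * ·) (I : Set A) (I : Set A))) :
    x * y ∈ Submodule.span S ({1} : Set A) ⊔ Submodule.span S (I : Set A) ⊔
      Submodule.span S (closedProd (· * ·) (I : Set A) (I : Set A)) := by
  set J := closedProd (· * ·) (I : Set A) (I : Set A) with hJ
  have hII : Submodule.span S (I : Set A) * Submodule.span S (I : Set A) ≤ Submodule.span S J := by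
    rw [Submodule.span_mul_span]
    refine Submodule.span_mono ?_
    rintro _ ⟨i, hi, j, hj, rfl⟩
    exact mem_closedProd hi hj
  -- I²I ⊆ I; then I²I² ⊆ I(I²I) ⊆ I², which closes the multiplication table.
  have hJI' : ∀ i ∈ I, ∀ j ∈ J, j * i ∈ I := fun i hi j hj =>
    smul_mem_of_mem_closedProd (X := A) hcl (fun s hs t ht => h3 s hs t ht i hi) hj
  have hJI : Submodule.span S J * Submodule.span S (I : Set A) ≤ Submodule.span S (I : Set A) := by
    rw [Submodule.span_mul_span]
    refine Submodule.span_mono ?_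
    rintro _ ⟨j, hj, i, hi, rfl⟩
    exact hJI' i hi j hj
  have hJJ : Submodule.span S J * Submodule.span S J ≤ Submodule.span S J := by
    rw [Submodule.span_mul_span]
    refine Submodule.span_mono ?_
    rintro _ ⟨j, hj, k, hk, rfl⟩
    refine smul_mem_of_mem_closedProd (X := A) (N := closedProdSubgroup (I : Set A) I)
      isClosed_closure (fun s hs t ht => ?_) hj
    rw [smul_eq_mul, mul_assoc, mul_comm t]
    exact mem_closedProd hs (hJI' t ht k hk)
  have h1 : Submodule.span S ({1} : Set A) = 1 := Submodule.one_eq_span.symm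
  rw [h1] at hx hy ⊢
  set Z := (1 : Submodule S A) ⊔ Submodule.span S (I : Set A) ⊔ Submodule.span S J with hZ
  have z1 : (1 : Submodule S A) ≤ Z := le_sup_left.trans le_sup_left
  have z2 : Submodule.span S (I : Set A) ≤ Z := le_sup_right.trans le_sup_left
  have z3 : Submodule.span S J ≤ Z := le_sup_right
  have z4 := hII.trans z3
  have z5 := hJI.trans z2
  have z6 := hJJ.trans z3
  have z7 := (mul_comm (Submodule.span S J) (Submodule.span S (I : Set A))) ▸ z5
  have key : Z * Z ≤ Z := by
    conv_lhs => rw [hZ]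
    simp only [Submodule.sup_mul, Submodule.mul_sup, one_mul, mul_one, sup_le_iff]
    refine ⟨⟨⟨⟨?_, ?_⟩, ?_⟩, ⟨?_, ?_⟩, ?_⟩, ⟨?_, ?_⟩, ?_⟩ <;> assumption
  exact key (Submodule.mul_mem_mul hx hy)

end closedProd

open Filter Topology Pointwise GMA

/-! ### The structure of Pink's Lie algebra of a well adapted representation -/

section structure_theorem

variable {p : ℕ} [Fact p.Prime] {F : Type uF} [Field F] [Finite F] [CharP F p]
  {A : Type uA} {B : Type uB} {C : Type uC} [CommRing A] [AddCommGroup B]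
  [Module A B] [AddCommGroup C] [Module A C] {D : GMAData A B C}
  [Algebra (WittVector p F) A] [IsLocalRing A] {φ : A →+* F}

/-- Conjugation by a diagonal matrix. -/
@[simps] def GMA.conjLin (D : GMAData A B C) (s s' : A) : GMA D →ₗ[A] GMA D where
  toFun u := ⟨u.a, s • u.b, s' • u.c, u.d⟩
  map_add' u v := by ext <;> simp
  map_smul' r u := by ext <;> simp [smul_smul, mul_comm]

lemma GMA.diag_mul_mul_diag {a a' d d' : A} (ha : a * a' = 1) (hd : d * d' = 1) (u : GMA D) :
    diag D a d * u * diag D a' d' = conjLin D (a * d') (a' * d) u := by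
  ext
  · simp only [mul_a, diag_a, diag_b, diag_c, map_zero, LinearMap.zero_apply, add_zero,
      conjLin_apply_a]
    linear_combination u.a * ha
  · simp [smul_smul, mul_comm]
  · simp [smul_smul]
  · simp only [mul_d, diag_d, diag_b, diag_c, map_zero, LinearMap.zero_apply, add_zero,
      conjLin_apply_d]
    linear_combination u.d * hd

lemma GMA.theta_conjLin (s s' : A) (u : GMA D) :
    theta (conjLin D s s' u) = conjLin D s s' (theta u) := by
  ext <;> simp [theta, trace]

variable [TopologicalSpace A] [TopologicalSpace B] [TopologicalSpace C]
  [IsTopologicalRing A] [ContinuousAdd B] [ContinuousAdd C]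
  [ContinuousSMul A B] [ContinuousSMul A C] [CompactSpace A] [T2Space A]

lemma trace_smul_mem_span {G : Set (GMA D)} (hG : IsSpecialGroup G) {x : GMA D} (hx : x ∈ G)
    (S : Subring A) {v : GMA D}
    (hv : v ∈ Submodule.span S
      (((AddSubgroup.closure (GMA.theta '' G)).topologicalClosure : Set (GMA D)))) :
    x.trace • v ∈ Submodule.span S
      (((AddSubgroup.closure (GMA.theta '' G)).topologicalClosure : Set (GMA D))) := by
  induction hv using Submodule.span_induction with
  | mem v hv =>
    exact Submodule.subset_span (map_mem_closure (f := fun v : GMA D => x.trace • v)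
      (by fun_prop) hv fun v hv => trace_smul_mem_closure hG hx hv)
  | zero => simp
  | add v w _ _ h1 h2 => rw [smul_add]; exact add_mem h1 h2
  | smul r v _ h =>
    convert Submodule.smul_mem _ r h using 1
    simp only [Subring.smul_def, smul_smul, mul_comm]

lemma conjLin_mem_topologicalClosure {G : Set (GMA D)} {s s' : A}
    (hG : ∀ x ∈ G, conjLin D s s' x ∈ G) {v : GMA D}
    (hv : v ∈ (AddSubgroup.closure (GMA.theta '' G)).topologicalClosure) :
    conjLin D s s' v ∈ (AddSubgroup.closure (GMA.theta '' G)).topologicalClosure := by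
  have hc : Continuous (conjLin D s s') := by
    apply continuous_of_entries <;> simp only [conjLin_apply_a, conjLin_apply_b, conjLin_apply_c,
      conjLin_apply_d] <;> fun_prop
  refine map_mem_closure hc hv fun v hv => ?_
  induction hv using AddSubgroup.closure_induction with
  | mem v hv =>
    obtain ⟨y, hy, rfl⟩ := hv
    rw [← theta_conjLin]
    exact AddSubgroup.subset_closure ⟨_, hG y hy, rfl⟩
  | zero => simp
  | add v w _ _ h1 h2 => rw [map_add]; exact add_mem h1 h2
  | neg v _ h => rw [map_neg]; exact neg_mem h

lemma conjLin_mem_span {G : Set (GMA D)} {s s' : A} (hG : ∀ x ∈ G, conjLin D s s' x ∈ G)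
    (S : Subring A) {v : GMA D}
    (hv : v ∈ Submodule.span S
      (((AddSubgroup.closure (GMA.theta '' G)).topologicalClosure : Set (GMA D)))) :
    conjLin D s s' v ∈ Submodule.span S
      (((AddSubgroup.closure (GMA.theta '' G)).topologicalClosure : Set (GMA D))) := by
  induction hv using Submodule.span_induction with
  | mem v hv => exact Submodule.subset_span (conjLin_mem_topologicalClosure hG hv)
  | zero => simp
  | add v w _ _ h1 h2 => rw [map_add]; exact add_mem h1 h2
  | smul r v _ h =>
    convert Submodule.smul_mem _ r h using 1
    simp only [Subring.smul_def, map_smul]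

/-- A criterion for `W(F) X₁` to be stable under `A`. -/
lemma smul_mem_span_of_stable (hφ : IsResidueMap p φ) {P : Type*} {t : P → A}
    (hd : Dense (Algebra.adjoin (WittVector p F) (Set.range t) : Set A))
    {X : Type*} [AddCommGroup X] [Module A X] [TopologicalSpace X] [ContinuousAdd X]
    [ContinuousSMul A X] [T2Space X] [CompactSpace X] {S : Subring A} {X₁ : Submodule S X}
    (hX₁ : IsClosed (X₁ : Set X)) {R : Set A} (hR : ∀ r ∈ R, ∀ x ∈ X₁, r • x ∈ X₁)
    (ht : ∀ g, ∃ x y : F, ∃ r ∈ R, ∃ r' ∈ R, t g = const p A x * r + const p A y * r') (a : A)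
    {n : X} (hn : n ∈ Submodule.span (wittSubring p A (⊤ : Subfield F)) (X₁ : Set X)) :
    a • n ∈ Submodule.span (wittSubring p A (⊤ : Subfield F)) (X₁ : Set X) := by
  set N := Submodule.span (wittSubring p A (⊤ : Subfield F)) (X₁ : Set X) with hN
  have hNcl : IsClosed (N : Set X) :=
    (hφ.isCompact_span ⊤ (L := X₁.toAddSubgroup) hX₁.isCompact).isClosed
  have hW : ∀ r ∈ wittSubring p A (⊤ : Subfield F), ∀ n ∈ N, r • n ∈ N := fun r hr n hn =>
    N.smul_mem (⟨r, hr⟩ : wittSubring p A (⊤ : Subfield F)) hn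
  have hRN : ∀ r ∈ R, ∀ n ∈ N, r • n ∈ N := by
    intro r hr n hn
    induction hn using Submodule.span_induction with
    | mem x hx => exact Submodule.subset_span (hR r hr x hx)
    | zero => simp
    | add x y _ _ h1 h2 => rw [smul_add]; exact add_mem h1 h2
    | smul c x _ h =>
      convert Submodule.smul_mem _ c h using 1
      simp only [Subring.smul_def, smul_smul, mul_comm]
  -- The stabilizer of the closed module N is a closed subring containing W(F) and the values of t,
  -- hence all of A.
  have hT : IsClosed {a : A | ∀ n ∈ N, a • n ∈ N} := by
    simp only [Set.ofPred_forall]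
    exact isClosed_iInter fun n => isClosed_iInter fun _ =>
      hNcl.preimage (show Continuous fun a : A => a • n by fun_prop)
  refine forall_mem_of_dense hd hT ?_ (fun w n hn => hW _ (algebraMap_mem_wittSubring_top w) n hn)
    (fun x hx y hy n hn => ?_) (fun x hx y hy n hn => ?_) a n hn
  · rintro _ ⟨g, rfl⟩ n hn
    obtain ⟨x, y, r, hr, r', hr', h⟩ := ht g
    rw [h, add_smul, mul_smul, mul_smul]
    exact N.add_mem (hW _ (const_mem_wittSubring trivial) _ (hRN r hr n hn))
      (hW _ (const_mem_wittSubring trivial) _ (hRN r' hr' n hn))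
  · rw [add_smul]; exact N.add_mem (hx n hn) (hy n hn)
  · rw [mul_smul]; exact hx _ (hy n hn)

variable [T2Space B] [T2Space C] [CompactSpace B] [CompactSpace C] [ContinuousMul (GMA D)]

/-- I₁, B₁, C₁ are the inverse images of M = W(K)L under the three coordinate embeddings, and
`mem_components` says that M is their sum. Relations (1) and (2) are stability of M under brackets
and traces; (3) and (4) come from the decomposition of ρ(g) into a constant diagonal matrix and an
element of Γ, together with the density of the algebra generated by traces. -/
theorem exists_isPinkDatum (hφ : IsResidueMap p φ) (hp : p ≠ 2) {P : Type*} [Group P] {t : P → A}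
    {rho : P →* (GMA D)ˣ} (htr : ∀ g, (rho g : GMA D).trace = t g)
    (hspan : Submodule.span A (Set.range fun g => (rho g : GMA D)) = ⊤)
    (hd : Dense (Algebra.adjoin (WittVector p F) (Set.range t) : Set A))
    (hG : IsSpecialGroup (pinkGroup rho))
    (hG1 : ∀ x ∈ pinkGroup rho, φ x.a = 1 ∧ φ x.d = 1)
    (hdec : ∀ g, ∃ x y : F, ∃ r ∈ pinkGroup rho,
      (rho g : GMA D) = diag D (const p A x) (const p A y) * r)
    {K : Subfield F} {z : F} (hz : z ∈ K) (hz0 : z ≠ 0) (hz2 : z ^ 2 ≠ 1)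
    (hconj : ∀ x ∈ pinkGroup rho, conjLin D (const p A z) (const p A z⁻¹) x ∈ pinkGroup rho) :
    ∃ (I₁ : Submodule (wittSubring p A K) A) (B₁ : Submodule (wittSubring p A K) B)
      (C₁ : Submodule (wittSubring p A K) C), IsPinkDatum p D K I₁ B₁ C₁ ∧
        (Submodule.span (wittSubring p A K) (pinkLie rho) : Set (GMA D)) =
          matZero D I₁ B₁ C₁ := by
  set S := wittSubring p A K with hS
  have h2 := hφ.inverse_two_mul_two hp
  set G := pinkGroup rho with hGdef
  set L := (AddSubgroup.closure (GMA.theta '' G)).topologicalClosure with hL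
  have hLcl : IsClosed (L : Set (GMA D)) := isClosed_closure
  have hLM : pinkLie rho = (L : Set (GMA D)) := rfl
  rw [hLM]
  set M := Submodule.span S (L : Set (GMA D)) with hM
  have hMst : IsPinkStable M.toAddSubgroup :=
    (isPinkStable_topologicalClosure hφ hp hG).span S
  have hMcl : IsClosed (M.toAddSubgroup : Set (GMA D)) :=
    (hφ.isCompact_span K hLcl.isCompact).isClosed
  have hcomp : ∀ u ∈ M, diagZero D u.a ∈ M ∧ upper D u.b ∈ M ∧ lower D u.c ∈ M := fun u hu =>
    mem_components hφ hMst.trace_eq hz hz0 hz2 (fun u hu => conjLin_mem_span hconj S hu) hu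
  let I₁ := M.comap ((diagZero D).restrictScalars S)
  let B₁ := M.comap ((upper D).restrictScalars S)
  let C₁ := M.comap ((lower D).restrictScalars S)
  have memI : ∀ i, i ∈ I₁ ↔ diagZero D i ∈ M := fun i => Iff.rfl
  have hdc : Continuous (diagZero D) := by
    apply continuous_of_entries <;> simp only [diagZero_apply_a, diagZero_apply_b,
      diagZero_apply_c, diagZero_apply_d] <;> fun_prop
  have huc : Continuous (upper D) := by
    apply continuous_of_entries <;> simp only [upper_apply_a, upper_apply_b,
      upper_apply_c, upper_apply_d] <;> fun_prop
  have hlc : Continuous (lower D) := by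
    apply continuous_of_entries <;> simp only [lower_apply_a, lower_apply_b,
      lower_apply_c, lower_apply_d] <;> fun_prop
  have hIcl : IsClosed (I₁ : Set A) := hMcl.preimage hdc
  have hBcl : IsClosed (B₁ : Set B) := hMcl.preimage huc
  have hCcl : IsClosed (C₁ : Set C) := hMcl.preimage hlc
  have hθ : ∀ x ∈ G, theta x ∈ M := fun x hx =>
    Submodule.subset_span (subset_closure (AddSubgroup.subset_closure ⟨x, hx, rfl⟩))
  have hGI : ∀ x ∈ G, Ring.inverse 2 * (x.a - x.d) ∈ I₁ := fun x hx => by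
    have := (hcomp _ (hθ x hx)).1
    rwa [theta_a h2] at this
  have hGB : ∀ x ∈ G, x.b ∈ B₁ := fun x hx => by
    have := (hcomp _ (hθ x hx)).2.1
    rwa [theta_b] at this
  have hGC : ∀ x ∈ G, x.c ∈ C₁ := fun x hx => by
    have := (hcomp _ (hθ x hx)).2.2
    rwa [theta_c] at this
  have hIII : ∀ i ∈ I₁, ∀ j ∈ I₁, ∀ k ∈ I₁, i * j * k ∈ I₁ := fun i hi j hj k hk =>
    hMst.mul_mul_mem hφ hp hMcl hi hj hk
  have hBC : ∀ b ∈ B₁, ∀ c ∈ C₁, D.m b c ∈ I₁ := fun b hb c hc => hMst.m_mem hb hc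
  have hMm : ∀ u ∈ M, φ u.a = 0 := by
    let N : Submodule A (GMA D) := Submodule.comap (aLin D) (IsLocalRing.maximalIdeal A)
    have hN : IsClosed (N : Set (GMA D)) := isClosed_maximalIdeal.preimage continuous_a
    have hLN : L ≤ N.toAddSubgroup := by
      refine AddSubgroup.topologicalClosure_minimal _ ((AddSubgroup.closure_le _).mpr ?_) hN
      rintro _ ⟨x, hx, rfl⟩
      change (theta x).a ∈ IsLocalRing.maximalIdeal A
      rw [hφ.mem_maximalIdeal_iff, theta_a h2, map_mul, map_sub, (hG1 x hx).1, (hG1 x hx).2,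
        sub_self, mul_zero]
    have : M ≤ N.restrictScalars S := Submodule.span_le.mpr hLN
    exact fun u hu => (hφ.mem_maximalIdeal_iff _).mp (this hu)
  -- With τ = ½ tr r and k = ½(r.a − r.d), the diagonal entries of r are τ + k and τ − k.
  have htrace : ∀ g, ∃ x y : F, ∃ r ∈ G, t g = const p A x *
      (Ring.inverse 2 * r.trace + Ring.inverse 2 * (r.a - r.d)) + const p A y *
      (Ring.inverse 2 * r.trace + -(Ring.inverse 2 * (r.a - r.d))) := by
    intro g
    obtain ⟨x, y, r, hr, h⟩ := hdec g
    refine ⟨x, y, r, hr, ?_⟩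
    rw [← htr, h]
    simp only [trace, mul_a, mul_d, diag_a, diag_b, diag_c, diag_d, map_zero,
      LinearMap.zero_apply, add_zero]
    linear_combination -(const p A x * r.a + const p A y * r.d) * h2
  set R : Set A := {c | ∃ r ∈ G, ∃ i ∈ I₁, c = Ring.inverse 2 * r.trace + i} with hR
  have htR : ∀ g, ∃ x y : F, ∃ r ∈ R, ∃ r' ∈ R, t g = const p A x * r + const p A y * r' := by
    intro g
    obtain ⟨x, y, r, hr, h⟩ := htrace g
    exact ⟨x, y, _, ⟨r, hr, _, hGI r hr, rfl⟩, _, ⟨r, hr, _, I₁.neg_mem (hGI r hr), rfl⟩, h⟩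
  have hRM : ∀ x ∈ G, ∀ v ∈ M, (Ring.inverse 2 * x.trace) • v ∈ M := fun x hx v hv => by
    rw [mul_smul]
    exact hφ.inverse_two_smul_mem hp hMcl (trace_smul_mem_span hG hx S hv)
  have hRB : ∀ r ∈ R, ∀ b ∈ B₁, r • b ∈ B₁ := by
    rintro _ ⟨x, hx, i, hi, rfl⟩ b hb
    rw [add_smul]
    refine B₁.add_mem ?_ (hMst.smul_upper_mem hφ hp hMcl hi hb)
    change upper D _ ∈ M
    rw [map_smul]
    exact hRM x hx _ hb
  have hRC : ∀ r ∈ R, ∀ c ∈ C₁, r • c ∈ C₁ := by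
    rintro _ ⟨x, hx, i, hi, rfl⟩ b hb
    rw [add_smul]
    refine C₁.add_mem ?_ (hMst.smul_lower_mem hφ hp hMcl hi hb)
    change lower D _ ∈ M
    rw [map_smul]
    exact hRM x hx _ hb
  refine ⟨I₁, B₁, C₁, ⟨hIcl, hBcl, hCcl, ?_, ?_, ?_, ?_, ?_, ?_⟩, ?_⟩
  · exact fun i hi => (hφ.mem_maximalIdeal_iff _).mpr (hMm _ hi)
  · exact closedProd_subset (N := I₁.toAddSubgroup) hIcl hBC
  · refine closedProd_subset (N := I₁.toAddSubgroup) hIcl fun j hj k hk => ?_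
    exact smul_mem_of_mem_closedProd (X := A) (N := I₁.toAddSubgroup) hIcl
      (fun s hs t ht => hIII s hs t ht k hk) hj
  · set J := closedProd (· * ·) (I₁ : Set A) (I₁ : Set A) with hJ
    set S' := wittSubring p A (⊤ : Subfield F) with hS'
    set Z := Submodule.span S' ({1} : Set A) ⊔ Submodule.span S' (I₁ : Set A) ⊔
      Submodule.span S' J with hZ
    have hmul : ∀ x ∈ Z, ∀ y ∈ Z, x * y ∈ Z := fun x hx y hy =>
      span_mul_span_le S' (I := I₁.toAddSubgroup) hIcl hIII hx hy
    have hone : Submodule.span S' ({1} : Set A) ≤ Z := le_sup_left.trans le_sup_left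
    have hWZ : ∀ w, algebraMap (WittVector p F) A w ∈ Z := fun w => hone <|
      Submodule.mem_span_singleton.mpr ⟨⟨_, algebraMap_mem_wittSubring_top w⟩, mul_one _⟩
    have hIZ : ∀ i ∈ I₁, i ∈ Z := fun i hi =>
      (le_sup_right.trans le_sup_left : Submodule.span S' (I₁ : Set A) ≤ Z)
        (Submodule.subset_span hi)
    have hJZ : ∀ i ∈ J, i ∈ Z := fun i hi =>
      (le_sup_right : Submodule.span S' J ≤ Z) (Submodule.subset_span hi)
    have hZcl : IsClosed (Z : Set A) := by
      have c1 : IsCompact (Submodule.span S' ({1} : Set A) : Set A) := by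
        convert hφ.isCompact_range_algebraMap using 1
        ext a
        rw [SetLike.mem_coe, Submodule.mem_span_singleton]
        constructor
        · rintro ⟨⟨_, w, rfl⟩, rfl⟩
          exact ⟨_, (mul_one _).symm⟩
        · rintro ⟨w, rfl⟩
          exact ⟨⟨_, algebraMap_mem_wittSubring_top w⟩, mul_one _⟩
      have c2 : IsCompact (Submodule.span S' (I₁ : Set A) : Set A) :=
        hφ.isCompact_span ⊤ (L := I₁.toAddSubgroup) hIcl.isCompact
      have c3 : IsCompact (Submodule.span S' J : Set A) :=
        hφ.isCompact_span ⊤ (L := closedProdSubgroup (I₁ : Set A) I₁)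
          isClosed_closure.isCompact
      rw [hZ, Submodule.coe_sup, Submodule.coe_sup]
      exact ((c1.add c2).add c3).isClosed
    have hpow : ∀ y ∈ Z, ∀ n, y ^ n ∈ Z := fun y hy n => by
      induction n with
      | zero => rw [pow_zero]; simpa using hWZ 1
      | succ n ih => rw [pow_succ]; exact hmul _ ih _ hy
    -- det r = 1 gives τ² = 1 + k² + bc ∈ Z. As τ reduces to 1, it is a limit of powers of τ², and Z
    -- is a closed ring.
    have hτ : ∀ r ∈ G, Ring.inverse 2 * r.trace ∈ Z := by
      intro r hr
      refine hφ.mem_of_sq_mem hp hZcl ?_ (hpow _ ?_)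
      · rw [map_mul, trace, map_add, (hG1 r hr).1, (hG1 r hr).2, one_add_one_eq_two,
          ← map_ofNat φ 2, ← map_mul, h2, map_one]
      · have hsq : (Ring.inverse 2 * r.trace) ^ 2 = 1 + (Ring.inverse 2 * (r.a - r.d)) *
            (Ring.inverse 2 * (r.a - r.d)) + D.m r.b r.c := by
          have hdet := hG.det_eq r hr
          simp only [det] at hdet
          simp only [trace]
          linear_combination (Ring.inverse (2 : A) * 2 + 1) * r.a * r.d * h2 + hdet
        rw [hsq]
        refine Z.add_mem (Z.add_mem (by simpa using hWZ 1) (hJZ _ ?_)) (hIZ _ ?_)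
        · exact mem_closedProd (hGI r hr) (hGI r hr)
        · exact hBC _ (hGB r hr) _ (hGC r hr)
    rw [eq_top_iff]
    intro a _
    refine forall_mem_of_dense (T := (Z : Set A)) hd hZcl ?_ hWZ (fun x hx y hy => Z.add_mem hx hy)
      hmul a
    rintro _ ⟨g, rfl⟩
    obtain ⟨x, y, r, hr, h⟩ := htrace g
    rw [h]
    exact Z.add_mem (hmul _ (hWZ _) _ (Z.add_mem (hτ r hr) (hIZ _ (hGI r hr))))
      (hmul _ (hWZ _) _ (Z.add_mem (hτ r hr) (Z.neg_mem (hIZ _ (hGI r hr)))))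
  · set N := Submodule.span (wittSubring p A (⊤ : Subfield F)) (B₁ : Set B) with hN
    have hst := fun a n hn => smul_mem_span_of_stable (n := n) hφ hd hBcl hRB htR a hn
    -- W(F)B₁ is thus an A-module; it contains the upper entries of ρ(P), which span B over A.
    let N' : Submodule A B :=
      { carrier := N, add_mem' := N.add_mem, zero_mem' := N.zero_mem,
        smul_mem' := fun a n hn => hst a n hn }
    have h1 : (⊤ : Submodule A (GMA D)) ≤ N'.comap (bLin D) := by
      rw [← hspan, Submodule.span_le]
      rintro _ ⟨g, rfl⟩
      obtain ⟨x, y, r, hr, h⟩ := hdec g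
      change (rho g : GMA D).b ∈ N
      rw [h]
      simpa using hst (const p A x) _ (Submodule.subset_span (hGB r hr))
    exact eq_top_iff.mpr fun b _ => h1 (x := upper D b) trivial
  · set N := Submodule.span (wittSubring p A (⊤ : Subfield F)) (C₁ : Set C) with hN
    have hst := fun a n hn => smul_mem_span_of_stable (n := n) hφ hd hCcl hRC htR a hn
    let N' : Submodule A C :=
      { carrier := N, add_mem' := N.add_mem, zero_mem' := N.zero_mem,
        smul_mem' := fun a n hn => hst a n hn }
    have h1 : (⊤ : Submodule A (GMA D)) ≤ N'.comap (cLin D) := by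
      rw [← hspan, Submodule.span_le]
      rintro _ ⟨g, rfl⟩
      obtain ⟨x, y, r, hr, h⟩ := hdec g
      change (rho g : GMA D).c ∈ N
      rw [h]
      simpa using hst (const p A y) _ (Submodule.subset_span (hGC r hr))
    exact eq_top_iff.mpr fun c _ => h1 (x := lower D c) trivial
  · ext u
    constructor
    · intro hu
      have htu : u.trace = 0 := hMst.trace_eq u hu
      obtain ⟨h1, h2, h3⟩ := hcomp u hu
      have hda : u.d = -u.a := (neg_eq_of_add_eq_zero_right htu).symm
      exact ⟨h1, h2, h3, hda ▸ I₁.neg_mem h1, htu⟩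
    · rintro ⟨h1, h2, h3, -, h5⟩
      rw [eq_diagZero_add_upper_add_lower h5]
      exact M.add_mem (M.add_mem h1 h2) h3

end structure_theorem

open Filter Topology Pointwise GMA

/-! ### Finite generation -/

section profinite

variable {N : Type*} [Group N] [TopologicalSpace N] [IsTopologicalGroup N] [CompactSpace N]
  [TotallyDisconnectedSpace N] {p : ℕ} [Fact p.Prime]

/-- If `n ^ (p ^ k)` tends to `1` in `N / K` for all `n`, then the kernel of `N → N(p)` lies
in `K`. -/
lemma proPKernel_le {K : Subgroup N} [K.Normal] {Y : Type*} [TopologicalSpace Y] [T2Space Y]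
    {f : N → Y} (hf : Continuous f) (hK : ∀ n, f n = f 1 ↔ n ∈ K)
    (hpow : ∀ n, Tendsto (fun k : ℕ => f (n ^ p ^ k)) atTop (𝓝 (f 1))) : proPKernel p N ≤ K := by
  intro g hg
  by_contra hgK
  have hKcl : IsClosed (K : Set N) := by
    convert isClosed_singleton.preimage hf (t := {f 1}) using 1
    ext n; simp [hK]
  -- V is small enough that VK misses g; it remains to see that N/VK is a p-group.
  obtain ⟨V, hV⟩ := ProfiniteGrp.exist_openNormalSubgroup_sub_open_nhds_of_one
    (U := (fun v : N => v⁻¹ * g) ⁻¹' (K : Set N)ᶜ)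
    (hKcl.isOpen_compl.preimage (by fun_prop)) (by simpa using hgK)
  set U : Subgroup N := V.toSubgroup ⊔ K with hU
  have hVn : V.toSubgroup.Normal := V.isNormal'
  have hUo : IsOpen (U : Set N) := Subgroup.isOpen_mono le_sup_left V.isOpen'
  have hgU : g ∉ U := by
    intro h
    obtain ⟨v, hv, k, hk, rfl⟩ := Subgroup.mem_sup_of_normal_right.mp h
    exact hV hv (by simpa using hk)
  have hUn : U.Normal := inferInstance
  refine hgU ((Subgroup.mem_sInf.mp hg) U ⟨hUn, hUo, ?_⟩)
  have : Finite (N ⧸ U) := U.quotient_finite_of_isOpen hUo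
  refine IsPGroup.iff_card.mp fun q => ?_
  obtain ⟨n, rfl⟩ := QuotientGroup.mk_surjective q
  -- f is merely a continuous map with fibre K over f 1. The compact image of the complement of U
  -- misses f 1, so n^(p^k) enters U for some k.
  have hc : IsClosed (f '' (U : Set N)ᶜ) := (hUo.isClosed_compl.isCompact.image hf).isClosed
  have h1 : f 1 ∉ f '' (U : Set N)ᶜ := by
    rintro ⟨u, hu, h⟩
    exact hu ((le_sup_right : K ≤ U) ((hK u).mp h))
  obtain ⟨k, hk⟩ := ((hpow n).eventually (hc.isOpen_compl.mem_nhds h1)).exists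
  refine ⟨k, ?_⟩
  rw [← QuotientGroup.mk_pow, QuotientGroup.eq_one_iff]
  by_contra h
  exact hk ⟨_, h, rfl⟩

variable {A : Type*} [CommRing A] [TopologicalSpace A] [IsTopologicalRing A] [CompactSpace A]
  [T2Space A]

/-- The module generated by the values of a cocycle on a group with a finitely generated
pro-`p` quotient is finitely generated. -/
lemma exists_fg_of_cocycle
    (hfin : ∃ S : Set (N ⧸ proPKernel p N), S.Finite ∧
      Dense (Subgroup.closure S : Set (N ⧸ proPKernel p N)))
    {X : Type*} [AddCommGroup X] [Module A X] {β : N → X} {α δ : N → A}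
    (hβ : ∀ g h, β (g * h) = α g • β h + δ h • β g) (h1 : β 1 = 0) (hα : ∀ g, IsUnit (α g))
    (hker : ∀ n ∈ proPKernel p N, β n = 0) {ι : Type*} (ℓ : ι → X →ₗ[A] A)
    (hinj : ∀ x, (∀ i, ℓ i x = 0) → x = 0) (hcont : ∀ i, Continuous fun n => ℓ i (β n)) :
    ∃ X' : Submodule A X, X'.FG ∧ ∀ n, β n ∈ X' := by
  obtain ⟨S, hS, hd⟩ := hfin
  set X' := Submodule.span A (β '' (Quotient.out '' S)) with hX'
  have hfg : X'.FG := Submodule.fg_span ((hS.image _).image _)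
  -- The cocycle relation makes β⁻¹(X') a subgroup. It is closed, contains the pro-p kernel and
  -- contains lifts of topological generators of the quotient, hence is everything.
  let H : Subgroup N :=
    { carrier := {n | β n ∈ X'}
      mul_mem' := fun {g h} hg hh => by
        change β (g * h) ∈ X'
        rw [hβ]; exact X'.add_mem (X'.smul_mem _ hh) (X'.smul_mem _ hg)
      one_mem' := by simp [h1]
      inv_mem' := fun {g} hg => by
        change β g⁻¹ ∈ X'
        have := hβ g g⁻¹
        rw [mul_inv_cancel, h1, eq_comm, add_eq_zero_iff_eq_neg] at this
        obtain ⟨u, hu⟩ := hα g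
        have h3 : α g • β g⁻¹ ∈ X' := this ▸ X'.neg_mem (X'.smul_mem _ hg)
        have h4 := X'.smul_mem (↑u⁻¹ : A) h3
        rwa [smul_smul, ← hu, Units.inv_mul, one_smul] at h4 }
  refine ⟨X', hfg, fun n => ?_⟩
  suffices hH : (H : Set N) = Set.univ by
    exact (hH ▸ Set.mem_univ n : n ∈ (H : Set N))
  -- X has no topology here; the functionals ℓ embed it in A^ι, where the image of X' is that of
  -- some A^k, hence compact.
  have hHcl : IsClosed (H : Set N) := by
    have : Module.Finite A X' := Module.Finite.iff_fg.mpr hfg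
    obtain ⟨k, q, hq⟩ := Module.Finite.exists_fin' A X'
    let F : (Fin k → A) → ι → A := fun r i => (ℓ i ∘ₗ X'.subtype ∘ₗ q) r
    have hF : Continuous F := continuous_pi fun i => LinearMap.continuous_on_pi _
    have hG : Continuous fun n : N => fun i => ℓ i (β n) := continuous_pi hcont
    convert (isCompact_range hF).isClosed.preimage hG using 1
    ext n
    constructor
    · intro hn
      obtain ⟨r, hr⟩ := hq ⟨β n, hn⟩
      exact ⟨r, by ext i; simp [F, hr]⟩
    · rintro ⟨r, hr⟩
      have : β n - (q r : X) = 0 := by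
        refine hinj _ fun i => ?_
        have := congrFun hr i
        simp only [F, LinearMap.comp_apply, Submodule.subtype_apply] at this
        rw [map_sub, this, sub_self]
      change β n ∈ X'
      rw [sub_eq_zero.mp this]
      exact (q r).2
  have hkH : proPKernel p N ≤ H := fun n hn => by
    change β n ∈ X'
    rw [hker n hn]; exact X'.zero_mem
  set H' := H.map (QuotientGroup.mk' (proPKernel p N)) with hH'
  have hpre : (QuotientGroup.mk : N → N ⧸ proPKernel p N) ⁻¹' (H' : Set (N ⧸ proPKernel p N)) =
      H := by
    have := Subgroup.comap_map_eq_self (f := QuotientGroup.mk' (proPKernel p N)) (H := H)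
      (by rwa [QuotientGroup.ker_mk'])
    exact congrArg (fun K : Subgroup N => (K : Set N)) this
  have hH'cl : IsClosed (H' : Set (N ⧸ proPKernel p N)) := by
    rw [← (QuotientGroup.isQuotientMap_mk _).isClosed_preimage, hpre]
    exact hHcl
  have hle : Subgroup.closure S ≤ H' := by
    rw [Subgroup.closure_le]
    intro s hs
    exact ⟨Quotient.out s, Submodule.subset_span ⟨_, ⟨s, hs, rfl⟩, rfl⟩, Quotient.out_eq' s⟩
  have hu : (H' : Set (N ⧸ proPKernel p N)) = Set.univ :=
    Set.eq_univ_of_univ_subset (hd.closure_eq ▸ closure_minimal hle hH'cl)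
  rw [← hpre, hu, Set.preimage_univ]

end profinite

/-! ### Iterated p-th powers of unipotent matrices -/

section pow

variable {A : Type uA} {B : Type uB} {C : Type uC} [CommRing A] [AddCommGroup B]
  [Module A B] [AddCommGroup C] [Module A C] {D : GMAData A B C}

/-- The algebra structure of a generalized matrix algebra. -/
abbrev GMA.algebra (D : GMAData A B C) : Algebra A (GMA D) :=
  Algebra.ofModule smul_mul_assoc mul_smul_comm

open Polynomial in
/-- The powers `x ^ (p ^ n)` of a unipotent matrix `x` are close to the identity. -/
lemma linearMap_pow_sub_one_mem {p : ℕ} {x : GMA D} (hx : x.det = 1) {J : Ideal A}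
    (hp : (p : A) ∈ J) (ht : x.trace - 2 ∈ J) (f : GMA D →ₗ[A] A) {n k : ℕ} (hk : 2 * n + 1 ≤ k) :
    f (x ^ p ^ k - 1) ∈ J ^ n := by
  let _ := GMA.algebra D
  -- The computation is made in A[X], with X specializing to x and χ its characteristic polynomial.
  -- X^(p^k) − 1 lies in Q^(k+1), and (X − 1)² = X(tr x − 2) + χ gives Q² ⊆ J A[X] + (χ): two powers
  -- of Q are worth one of J.
  set Q : Ideal A[X] := Ideal.span {(p : A[X]), X - 1} with hQ
  set χ : A[X] := X ^ 2 - Polynomial.C x.trace * X + 1 with hχ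
  have h1 : (X : A[X]) ^ p ^ k - 1 ∈ Q ^ (k + 1) :=
    pow_prime_pow_sub_one_mem (Ideal.subset_span (by simp)) (Ideal.subset_span (by simp)) _
  have hpC : (p : A[X]) ∈ Ideal.map Polynomial.C J := by
    have := Ideal.mem_map_of_mem (Polynomial.C : A →+* A[X]) hp
    simpa using this
  have htC : Polynomial.C x.trace - 2 ∈ Ideal.map Polynomial.C J := by
    have := Ideal.mem_map_of_mem (Polynomial.C : A →+* A[X]) ht
    rwa [map_sub, map_ofNat] at this
  have h2 : Q ^ 2 ≤ Ideal.map Polynomial.C J ⊔ Ideal.span {χ} := by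
    rw [sq, hQ, Ideal.span_mul_span, Ideal.span_le]
    rintro _ ⟨u, rfl | hu, v, rfl | hv, rfl⟩
    · exact Ideal.mul_mem_left _ _ (Ideal.mem_sup_left hpC)
    · exact Ideal.mul_mem_right _ _ (Ideal.mem_sup_left hpC)
    · exact Ideal.mul_mem_left _ _ (Ideal.mem_sup_left hpC)
    · rw [Set.mem_singleton_iff.mp hu, Set.mem_singleton_iff.mp hv]
      simp only [SetLike.mem_coe]
      rw [show (X - 1 : A[X]) * (X - 1) = X * (Polynomial.C x.trace - 2) + χ by rw [hχ]; ring]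
      exact Ideal.add_mem _ (Ideal.mul_mem_left _ _ (Ideal.mem_sup_left htC))
        (Ideal.mem_sup_right (Ideal.subset_span rfl))
  have h3 : (X : A[X]) ^ p ^ k - 1 ∈ Ideal.map Polynomial.C (J ^ n) ⊔ Ideal.span {χ} := by
    rw [Ideal.map_pow]
    -- Exponent n + 1 rather than n: one factor is spent on (χ), since (J A[X] + (χ))^(n+1) ⊆ J^n
    -- A[X] + (χ).
    have h4 : Q ^ (k + 1) ≤ (Ideal.map Polynomial.C J ⊔ Ideal.span {χ}) ^ (n + 1) :=
      (Ideal.pow_le_pow_right (by omega : 2 * (n + 1) ≤ k + 1)).trans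
        ((pow_mul Q 2 (n + 1)).trans_le (Ideal.pow_right_mono h2 _))
    have h5 := Ideal.sup_pow_add_le_pow_sup_pow (n := n) (m := 1) (h4 h1)
    rwa [pow_one] at h5
  obtain ⟨u, hu, v, hv, huv⟩ := Submodule.mem_sup.mp h3
  have hχ0 : aeval x χ = 0 := by
    rw [hχ]
    simp only [map_add, map_sub, map_mul, map_pow, aeval_X, aeval_C, map_one]
    rw [sq, mul_self_eq, hx, ← Algebra.smul_def]
    module
  have hv0 : aeval x v = 0 := by
    obtain ⟨w, rfl⟩ := Ideal.mem_span_singleton.mp hv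
    rw [map_mul, hχ0, zero_mul]
  have hval : x ^ p ^ k - 1 = aeval x u := by
    have := congrArg (aeval x) huv
    simpa [hv0] using this.symm
  rw [hval, aeval_eq_sum_range, map_sum]
  refine Ideal.sum_mem _ fun i _ => ?_
  rw [map_smul, smul_eq_mul]
  exact Ideal.mul_mem_right _ _ ((Ideal.mem_map_C_iff.mp hu) i)

end pow

/-! ### Compactness and separation for module topologies -/

section compact

variable {A : Type*} [CommRing A] [TopologicalSpace A] [IsTopologicalRing A] [CompactSpace A]
  [T2Space A]

lemma compactSpace_of_finite {X : Type*} [AddCommGroup X] [Module A X] [TopologicalSpace X]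
    [IsModuleTopology A X] [Module.Finite A X] : CompactSpace X := by
  have := IsModuleTopology.toContinuousAdd A X
  obtain ⟨k, q, hq⟩ := Module.Finite.exists_fin' A X
  exact hq.compactSpace (LinearMap.continuous_on_pi q)

/-- For B and C the functionals are the pairings with the other module, which separate points by
faithfulness. -/
lemma t2Space_of_separating {X : Type*} [AddCommGroup X] [Module A X] [TopologicalSpace X]
    [IsModuleTopology A X] {ι : Type*} (ℓ : ι → X →ₗ[A] A)
    (hinj : ∀ x, (∀ i, ℓ i x = 0) → x = 0) : T2Space X := by
  refine T2Space.of_injective_continuous (f := fun x => fun i => ℓ i x) (fun x y h => ?_)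
    (continuous_pi fun i => IsModuleTopology.continuous_of_linearMap _)
  refine sub_eq_zero.mp (hinj _ fun i => ?_)
  rw [map_sub, sub_eq_zero]
  exact congrFun h i

end compact

open Filter Topology Pointwise GMA

/-! ### Residual representations with cyclic projective image -/

section residual

variable {F : Type uF} [Field F]

/-- A singular 2 × 2 matrix has rank at most one, so it is a column times a row. -/
lemma mul_mul_eq_trace_smul {e : Matrix (Fin 2) (Fin 2) F} (he : e.det = 0)
    (Y : Matrix (Fin 2) (Fin 2) F) : e * Y * e = (Y * e).trace • e := by
  rw [Matrix.det_fin_two] at he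
  ext i j
  fin_cases i <;> fin_cases j <;>
    simp only [Matrix.mul_apply, Fin.sum_univ_two, Matrix.trace_fin_two, Matrix.smul_apply,
      smul_eq_mul, Fin.zero_eta, Fin.mk_one]
  · linear_combination -Y 1 1 * he
  · linear_combination Y 0 1 * he
  · linear_combination Y 1 0 * he
  · linear_combination -Y 0 0 * he

lemma trace_det_of_charpoly {M : Matrix (Fin 2) (Fin 2) F} {l m : F}
    (h : M.charpoly = (Polynomial.X - Polynomial.C l) * (Polynomial.X - Polynomial.C m)) :
    M.trace = l + m ∧ M.det = l * m := by
  have h1 : (Polynomial.X - Polynomial.C l) * (Polynomial.X - Polynomial.C m) =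
      Polynomial.X ^ 2 - Polynomial.C (l + m) * Polynomial.X + Polynomial.C (l * m) := by
    simp only [Polynomial.C_add, Polynomial.C_mul]; ring
  rw [Matrix.charpoly_fin_two, h1] at h
  constructor
  · have := congrArg (fun q => Polynomial.coeff q 1) h
    simp [Polynomial.coeff_C, Polynomial.coeff_X_pow] at this
    linear_combination -this
  · have := congrArg (fun q => Polynomial.coeff q 0) h
    simpa [Polynomial.coeff_X, Polynomial.coeff_C, Polynomial.coeff_X_pow] using this

/-- By Cayley–Hamilton; for l ≠ m, the matrix M − m is l − m times the projector onto the
l-eigenline. -/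
lemma sq_eq_of_trace_det {M : Matrix (Fin 2) (Fin 2) F} {l m : F} (ht : M.trace = l + m)
    (hd : M.det = l * m) : (M - m • 1) * (M - m • 1) = (l - m) • (M - m • 1) ∧
      (M - m • (1 : Matrix (Fin 2) (Fin 2) F)).det = 0 := by
  rw [Matrix.trace_fin_two] at ht
  rw [Matrix.det_fin_two] at hd
  constructor
  · ext i j
    fin_cases i <;> fin_cases j <;>
      simp [Matrix.mul_apply, Fin.sum_univ_two]
    · linear_combination M 0 0 * ht - hd
    · linear_combination M 0 1 * ht
    · linear_combination M 1 0 * ht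
    · linear_combination M 1 1 * ht - hd
  · rw [Matrix.det_fin_two]
    simp
    linear_combination hd - m * ht

lemma smul_pow_eq {M : Matrix (Fin 2) (Fin 2) F} {l m : F}
    (h : (M - m • 1) * (M - m • 1) = (l - m) • (M - m • 1)) (k : ℕ) :
    (l - m) • M ^ k = ((l - m) * m ^ k) • 1 + (l ^ k - m ^ k) • (M - m • 1) := by
  induction k with
  | zero => simp
  | succ k ih =>
    set E := M - m • (1 : Matrix (Fin 2) (Fin 2) F) with hE
    have hM : M = m • 1 + E := by rw [hE]; abel
    rw [pow_succ, ← smul_mul_assoc, ih]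
    conv_lhs => rw [hM]
    simp only [add_mul, mul_add, smul_mul_assoc, mul_smul_comm, one_mul, mul_one, h, smul_smul]
    module

lemma mem_center_of_pow_eq {M : GL (Fin 2) F} {l m : F} (hlm : l ≠ m)
    (h : ((M : Matrix (Fin 2) (Fin 2) F) - m • 1) * (M - m • 1) = (l - m) • (M - m • 1)) {k : ℕ}
    (hk : l ^ k = m ^ k) : M ^ k ∈ Subgroup.center (GL (Fin 2) F) := by
  have h1 := smul_pow_eq h k
  rw [hk, sub_self, zero_smul, add_zero, mul_smul] at h1
  have h2 : (M : Matrix (Fin 2) (Fin 2) F) ^ k = m ^ k • 1 :=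
    smul_right_injective _ (sub_ne_zero.mpr hlm) h1
  rw [Subgroup.mem_center_iff]
  intro g
  apply Units.ext
  simp [h2]

/-- The polynomial X^|K| − X has at most |K| roots, and K already supplies them. -/
lemma mem_of_pow_card_sub_one [Finite F] (K : Subfield F) {z : F}
    (hz : z ^ (Nat.card K - 1) = 1) : z ∈ K := by
  have := Fintype.ofFinite K
  have := Fintype.ofFinite F
  classical
  have hK1 : 1 < Nat.card K := Finite.one_lt_card
  have hpow : ∀ x : F, x ^ (Nat.card K - 1) = 1 → x ^ Nat.card K = x := fun x hx => by
    rw [← Nat.sub_add_cancel hK1.le, pow_succ, hx, one_mul]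
  by_contra hc
  set q : Polynomial F := Polynomial.X ^ Nat.card K - Polynomial.X with hq
  have hq0 : q ≠ 0 := FiniteField.X_pow_card_sub_X_ne_zero F hK1
  have hsub : insert z ((Finset.univ : Finset K).map ⟨Subtype.val, Subtype.val_injective⟩) ⊆
      q.roots.toFinset := by
    intro x hx
    rw [Multiset.mem_toFinset, Polynomial.mem_roots hq0]
    have : x ^ Nat.card K = x := by
      rcases Finset.mem_insert.mp hx with rfl | hx
      · exact hpow _ hz
      · obtain ⟨y, -, rfl⟩ := Finset.mem_map.mp hx
        have := FiniteField.pow_card y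
        rw [Nat.card_eq_fintype_card]
        exact congrArg Subtype.val this
    rw [Polynomial.IsRoot.def, hq, Polynomial.eval_sub, Polynomial.eval_pow, Polynomial.eval_X, this,
      sub_self]
  have h1 := Finset.card_le_card hsub
  rw [Finset.card_insert_of_notMem (by simpa using hc), Finset.card_map, Finset.card_univ] at h1
  have h2 := (Multiset.toFinset_card_le q.roots).trans (Polynomial.card_roots' q)
  rw [FiniteField.X_pow_card_sub_X_natDegree_eq F hK1, Nat.card_eq_fintype_card] at h2
  omega

variable {P : Type*} [Group P] {rhobar : P →* GL (Fin 2) F}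

/-- Modulo scalars the image is generated by ρ̄(g₀), and ρ̄(g₀)^k is scalar as soon as its two
distinct eigenvalues have equal k-th powers. -/
lemma card_projImage_dvd {g₀ : P} {l m : F} (hlm : l ≠ m)
    (hch : (rhobar g₀ : Matrix (Fin 2) (Fin 2) F).charpoly =
      (Polynomial.X - Polynomial.C l) * (Polynomial.X - Polynomial.C m))
    (hgen : Subgroup.zpowers (rhobar g₀) ⊔
      (rhobar.range ⊓ Subgroup.center (GL (Fin 2) F)) = rhobar.range) {k : ℕ}
    (hk : l ^ k = m ^ k) : Nat.card (projImage rhobar) ∣ k := by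
  have h1 : projImage rhobar =
      Subgroup.zpowers (Matrix.ProjGenLinGroup.mk (rhobar g₀)) := by
    have h0 : (rhobar.range ⊓ Subgroup.center (GL (Fin 2) F)).map Matrix.ProjGenLinGroup.mk = ⊥ := by
      rw [eq_bot_iff]
      rintro _ ⟨x, hx, rfl⟩
      exact Matrix.ProjGenLinGroup.mk_eq_one.mpr hx.2
    rw [projImage, ← hgen, Subgroup.map_sup, h0, sup_bot_eq, MonoidHom.map_zpowers]
  rw [h1, Nat.card_zpowers]
  obtain ⟨h2, h3⟩ := trace_det_of_charpoly hch
  apply orderOf_dvd_of_pow_eq_one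
  rw [← map_pow, Matrix.ProjGenLinGroup.mk_eq_one]
  exact mem_center_of_pow_eq hlm (sq_eq_of_trace_det h2 h3).1 hk

lemma commute_of_generate {g₀ : P} (hgen : Subgroup.zpowers (rhobar g₀) ⊔
      (rhobar.range ⊓ Subgroup.center (GL (Fin 2) F)) = rhobar.range) (g : P) :
    rhobar g * rhobar g₀ = rhobar g₀ * rhobar g := by
  have hle : Subgroup.zpowers (rhobar g₀) ⊔ (rhobar.range ⊓ Subgroup.center (GL (Fin 2) F)) ≤
      Subgroup.centralizer {rhobar g₀} := by
    refine sup_le ?_ (inf_le_right.trans (Subgroup.center_le_centralizer _))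
    rw [Subgroup.zpowers_le, Subgroup.mem_centralizer_singleton_iff]
  rw [hgen] at hle
  have := hle (⟨g, rfl⟩ : rhobar g ∈ rhobar.range)
  rw [Subgroup.mem_centralizer_singleton_iff] at this
  exact this

end residual

/-! ### Residual multiplicativity and continuity of the matrix entries -/

section direct

variable {p : ℕ} [Fact p.Prime] {F : Type uF} [Field F] [Finite F] [CharP F p]
  {A : Type uA} {B : Type uB} {C : Type uC} [CommRing A] [AddCommGroup B]
  [Module A B] [AddCommGroup C] [Module A C] {D : GMAData A B C}
  [Algebra (WittVector p F) A] [IsLocalRing A] {φ : A →+* F} [TopologicalSpace A]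

/-- Let E = ρ̄(g₀) − m. As ρ(g₀) is diagonal, comparing traces at g and gg₀ gives tr(ρ̄(g)E) = (l −
m)φ(a(g)). Moreover E has rank one and commutes with ρ̄(h), so tr(ρ̄(g)ρ̄(h)E²) = tr(ρ̄(g)E)
tr(ρ̄(h)E), while E² = (l − m)E. -/
lemma map_a_mul (hφ : IsResidueMap p φ) {P : ProfiniteGrp.{uP}} {rhobar : P →* GL (Fin 2) F}
    {t : P → A} {d : P →* Aˣ} {rho : P →* (GMA D)ˣ} (hadm : IsAdmissible p P rhobar t d)
    (hrep : IsTDRep rho t d) {g₀ : P} {l m : F} (had : IsAdapted p rhobar rho g₀ l m)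
    (hgen : Subgroup.zpowers (rhobar g₀) ⊔
      (rhobar.range ⊓ Subgroup.center (GL (Fin 2) F)) = rhobar.range) (g h : P) :
    φ (rho (g * h) : GMA D).a = φ (rho g : GMA D).a * φ (rho h : GMA D).a := by
  have hlm : l - m ≠ 0 := sub_ne_zero.mpr had.ne
  obtain ⟨h1, h2⟩ := trace_det_of_charpoly had.charpoly_eq
  obtain ⟨h3, h4⟩ := sq_eq_of_trace_det h1 h2
  set E := (rhobar g₀ : Matrix (Fin 2) (Fin 2) F) - m • (1 : Matrix (Fin 2) (Fin 2) F) with hE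
  have htr : ∀ g, (rhobar g : Matrix (Fin 2) (Fin 2) F).trace =
      φ (rho g : GMA D).a + φ (rho g : GMA D).d := fun g => by
    rw [← hφ.sub_const_mem_iff.mp (hadm.trace_congr g), ← hrep.trace_eq, trace, map_add]
  have htrE : ∀ g, ((rhobar g : Matrix (Fin 2) (Fin 2) F) * E).trace =
      (l - m) * φ (rho g : GMA D).a := by
    intro g
    have h5 := htr (g * g₀)
    have h6 := htr g
    rw [map_mul, map_mul, Units.val_mul, Units.val_mul, mul_a, mul_d, had.b_eq, had.c_eq,
      map_zero, map_zero, LinearMap.zero_apply, add_zero, add_zero, map_mul, map_mul,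
      hφ.sub_const_mem_iff.mp had.a_congr, hφ.sub_const_mem_iff.mp had.d_congr] at h5
    rw [hE, mul_sub, Matrix.trace_sub, mul_smul_comm, mul_one, Matrix.trace_smul, h5, h6,
      smul_eq_mul]
    ring
  have hcomm : (rhobar h : Matrix (Fin 2) (Fin 2) F) * E = E * rhobar h := by
    have := congrArg (Units.val) (commute_of_generate hgen h)
    rw [Units.val_mul, Units.val_mul] at this
    rw [hE, mul_sub, sub_mul, this]
    simp
  have key : (l - m) * ((rhobar (g * h) : Matrix (Fin 2) (Fin 2) F) * E).trace =
      ((rhobar g : Matrix (Fin 2) (Fin 2) F) * E).trace *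
        ((rhobar h : Matrix (Fin 2) (Fin 2) F) * E).trace := by
    rw [← smul_eq_mul, ← Matrix.trace_smul, ← mul_smul_comm, ← h3, map_mul, Units.val_mul]
    have h5 : (rhobar g : Matrix (Fin 2) (Fin 2) F) * rhobar h * (E * E) =
        ((rhobar h : Matrix (Fin 2) (Fin 2) F) * E).trace •
          ((rhobar g : Matrix (Fin 2) (Fin 2) F) * E) := by
      rw [← mul_smul_comm, ← mul_mul_eq_trace_smul h4, ← hcomm]
      simp only [mul_assoc]
    rw [h5, Matrix.trace_smul, smul_eq_mul, mul_comm]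
  rw [htrE, htrE, htrE] at key
  have h7 : (l - m) * (l - m) ≠ 0 := mul_ne_zero hlm hlm
  refine mul_left_cancel₀ h7 ?_
  linear_combination key

lemma exists_span_induction {P : Type*} [Group P] {rho : P →* (GMA D)ˣ}
    (hspan : Submodule.span A (Set.range fun g => (rho g : GMA D)) = ⊤) {X : Type*}
    [AddCommGroup X] [Module A X] {f : GMA D →ₗ[A] X} (hf : Function.Surjective f)
    {N : Submodule A X} (h : ∀ g, f (rho g : GMA D) ∈ N) (x : X) : x ∈ N := by
  obtain ⟨u, rfl⟩ := hf x
  have : (⊤ : Submodule A (GMA D)) ≤ N.comap f := by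
    rw [← hspan, Submodule.span_le]
    rintro _ ⟨g, rfl⟩
    exact h g
  exact this trivial

lemma bLin_surjective : Function.Surjective (bLin D) := fun b => ⟨upper D b, rfl⟩

lemma cLin_surjective : Function.Surjective (cLin D) := fun c => ⟨lower D c, rfl⟩

/-- b(g)c(h) = a(gh) − a(g)a(h) reduces to 0, and the entries b(g), c(h) span B and C. -/
lemma map_m_eq_zero {P : Type*} [Group P] {rho : P →* (GMA D)ˣ}
    (hspan : Submodule.span A (Set.range fun g => (rho g : GMA D)) = ⊤)
    (ha : ∀ g h, φ (rho (g * h) : GMA D).a = φ (rho g : GMA D).a * φ (rho h : GMA D).a)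
    (b : B) (c : C) : φ (D.m b c) = 0 := by
  have h1 : ∀ g h, φ (D.m (rho g : GMA D).b (rho h : GMA D).c) = 0 := fun g h => by
    have := ha g h
    rw [map_mul, Units.val_mul, mul_a, map_add, map_mul] at this
    simpa using this
  have h2 : ∀ h b, φ (D.m b (rho h : GMA D).c) = 0 := fun h b =>
    exists_span_induction hspan (bLin_surjective (D := D))
      (N := Submodule.comap (D.m.flip (rho h : GMA D).c) (RingHom.ker φ)) (fun g => h1 g h) b
  exact exists_span_induction hspan (cLin_surjective (D := D))
    (N := Submodule.comap (D.m b) (RingHom.ker φ)) (fun h => h2 h b) c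

lemma map_d_mul {P : Type*} [Group P] {rho : P →* (GMA D)ˣ}
    (hBC : ∀ b c, φ (D.m b c) = 0) (g h : P) :
    φ (rho (g * h) : GMA D).d = φ (rho g : GMA D).d * φ (rho h : GMA D).d := by
  rw [map_mul, Units.val_mul, mul_d, map_add, hBC, map_mul, add_zero]

lemma faithful_left (hD : D.Faithful) {b : B} (h : ∀ c, D.m b c = 0) : b = 0 := by
  have := hD (upper D b) (by simp [det]) (fun x => by simp [trace, h])
  exact congrArg GMA.b this

lemma faithful_right (hD : D.Faithful) {c : C} (h : ∀ b, D.m b c = 0) : c = 0 := by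
  have := hD (lower D c) (by simp [det]) (fun x => by simp [trace, h])
  exact congrArg GMA.c this

section continuity

variable [IsTopologicalRing A] {P : Type*} [Group P] [TopologicalSpace P] [IsTopologicalGroup P]
  {rho : P →* (GMA D)ˣ}

/-- ρ is not assumed continuous. The traces at g and gg₀ form a linear system for a(g), d(g),
invertible because the diagonal entries at g₀ are distinct modulo 𝔪. -/
lemma continuous_a_d_of_trace (hφ : IsResidueMap p φ) (ht : Continuous fun g => (rho g : GMA D).trace)
    {g₀ : P} (hb : (rho g₀ : GMA D).b = 0) (hc : (rho g₀ : GMA D).c = 0)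
    (hne : φ (rho g₀ : GMA D).a ≠ φ (rho g₀ : GMA D).d) :
    Continuous (fun g => (rho g : GMA D).a) ∧ Continuous (fun g => (rho g : GMA D).d) := by
  obtain ⟨u, hu⟩ := (hφ.isUnit_iff (a := (rho g₀ : GMA D).a - (rho g₀ : GMA D).d)).mpr
    (by rwa [map_sub, sub_ne_zero])
  have hinv : (↑u⁻¹ : A) * ((rho g₀ : GMA D).a - (rho g₀ : GMA D).d) = 1 := by
    rw [← hu, Units.inv_mul]
  have h1 : ∀ g, (rho (g * g₀) : GMA D).trace = (rho g : GMA D).a * (rho g₀ : GMA D).a +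
      (rho g : GMA D).d * (rho g₀ : GMA D).d := fun g => by
    rw [map_mul, Units.val_mul, trace, mul_a, mul_d, hb, hc]; simp
  have ht' : Continuous fun g => (rho (g * g₀) : GMA D).trace := ht.comp (by fun_prop)
  have ha : Continuous (fun g => (rho g : GMA D).a) := by
    have : (fun g => (rho g : GMA D).a) = fun g => (↑u⁻¹ : A) * ((rho (g * g₀) : GMA D).trace -
        (rho g₀ : GMA D).d * (rho g : GMA D).trace) := by
      ext1 g
      rw [h1, trace]
      linear_combination -(rho g : GMA D).a * hinv
    rw [this]; fun_prop
  refine ⟨ha, ?_⟩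
  have : (fun g => (rho g : GMA D).d) = fun g => (rho g : GMA D).trace - (rho g : GMA D).a := by
    ext1 g; rw [trace]; ring
  rw [this]; fun_prop

/-- b(g)c(h) = a(gh) − a(g)a(h) is continuous in g and the c(h) span C. This weak continuity
replaces continuity of the entry b(g) itself. -/
lemma continuous_m_left (ha : Continuous fun g => (rho g : GMA D).a)
    (hspan : Submodule.span A (Set.range fun g => (rho g : GMA D)) = ⊤) (c : C) :
    Continuous fun g => D.m (rho g : GMA D).b c := by
  let N : Submodule A C :=
    { carrier := {c | Continuous fun g => D.m (rho g : GMA D).b c}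
      add_mem' := fun h1 h2 => by
        simp only [Set.mem_ofPred_eq, map_add] at h1 h2 ⊢; exact h1.add h2
      zero_mem' := by simpa using continuous_const
      smul_mem' := fun r c h => by
        simp only [Set.mem_ofPred_eq, map_smul, smul_eq_mul] at h ⊢; exact continuous_const.mul h }
  refine exists_span_induction hspan (cLin_surjective (D := D)) (N := N) (fun h => ?_) c
  change Continuous fun g => D.m (rho g : GMA D).b (rho h : GMA D).c
  have : (fun g => D.m (rho g : GMA D).b (rho h : GMA D).c) = fun g =>
      (rho (g * h) : GMA D).a - (rho g : GMA D).a * (rho h : GMA D).a := by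
    ext1 g; rw [map_mul, Units.val_mul, mul_a]; ring
  rw [this]
  exact (ha.comp (continuous_mul_const h)).sub (ha.mul continuous_const)

lemma continuous_m_right (ha : Continuous fun g => (rho g : GMA D).a)
    (hspan : Submodule.span A (Set.range fun g => (rho g : GMA D)) = ⊤) (b : B) :
    Continuous fun g => D.m b (rho g : GMA D).c := by
  let N : Submodule A B :=
    { carrier := {b | Continuous fun g => D.m b (rho g : GMA D).c}
      add_mem' := fun h1 h2 => by
        simp only [Set.mem_ofPred_eq, map_add, LinearMap.add_apply] at h1 h2 ⊢; exact h1.add h2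
      zero_mem' := by simpa using continuous_const
      smul_mem' := fun r c h => by
        simp only [Set.mem_ofPred_eq, map_smul, LinearMap.smul_apply, smul_eq_mul] at h ⊢
        exact continuous_const.mul h }
  refine exists_span_induction hspan (bLin_surjective (D := D)) (N := N) (fun h => ?_) b
  change Continuous fun g => D.m (rho h : GMA D).b (rho g : GMA D).c
  have : (fun g => D.m (rho h : GMA D).b (rho g : GMA D).c) = fun g =>
      (rho (h * g) : GMA D).a - (rho h : GMA D).a * (rho g : GMA D).a := by
    ext1 g; rw [map_mul, Units.val_mul, mul_a]; ring
  rw [this]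
  exact (ha.comp (continuous_const_mul h)).sub (continuous_const.mul ha)

end continuity

end direct

open Filter Topology Pointwise GMA

/-! ### Finiteness of B and C, and proof of the direct part -/

section direct

variable {p : ℕ} [Fact p.Prime] {F : Type uF} [Field F] [Finite F] [CharP F p]
  {A : Type uA} {B : Type uB} {C : Type uC} [CommRing A] [AddCommGroup B]
  [Module A B] [AddCommGroup C] [Module A C] {D : GMAData A B C}
  [Algebra (WittVector p F) A] [IsLocalRing A] {φ : A →+* F} [TopologicalSpace A]
  [IsTopologicalRing A] [CompactSpace A] [T2Space A]

/-- The ideal (p, tr x − 2) is finitely generated and contained in 𝔪, so its powers tend to 0 even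
if A is not noetherian. -/
lemma tendsto_linearMap_pow (hφ : IsResidueMap p φ) {x : GMA D} (hx : x.det = 1)
    (ht : φ x.trace = 2) (f : GMA D →ₗ[A] A) :
    Tendsto (fun k : ℕ => f (x ^ p ^ k)) atTop (𝓝 (f 1)) := by
  set J := Ideal.span {(p : A), x.trace - 2} with hJdef
  have hJ : J ≤ IsLocalRing.maximalIdeal A := by
    rw [Ideal.span_le]
    rintro x (rfl | rfl)
    · exact hφ.natCast_mem
    · exact (hφ.mem_maximalIdeal_iff _).mpr (by rw [map_sub, ht, map_ofNat, sub_self])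
  rw [← tendsto_sub_nhds_zero_iff]
  intro U hU
  obtain ⟨n, hn⟩ := topNil_of_fg (Submodule.fg_span (Set.toFinite _)) hJ U hU
  rw [mem_map]
  filter_upwards [eventually_ge_atTop (2 * n + 1)] with k hk
  rw [Set.mem_preimage, ← map_sub]
  exact hn (linearMap_pow_sub_one_mem hx (Ideal.subset_span (by simp))
    (Ideal.subset_span (by simp)) f hk)

/-- The elements of the group which reduce to the identity. -/
def residualKernel {P : Type*} [Group P] (rho : P →* (GMA D)ˣ) (φ : A →+* F)
    (ha : ∀ g h, φ (rho (g * h) : GMA D).a = φ (rho g : GMA D).a * φ (rho h : GMA D).a)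
    (hd : ∀ g h, φ (rho (g * h) : GMA D).d = φ (rho g : GMA D).d * φ (rho h : GMA D).d) :
    Subgroup P where
  carrier := {g | φ (rho g : GMA D).a = 1 ∧ φ (rho g : GMA D).d = 1}
  mul_mem' := fun {g h} hg hh => by
    simp only [Set.mem_ofPred_eq] at hg hh ⊢
    rw [ha, hd, hg.1, hg.2, hh.1, hh.2, one_mul]; simp
  one_mem' := by simp
  inv_mem' := fun {g} hg => by
    simp only [Set.mem_ofPred_eq] at hg ⊢
    have h1 := ha g g⁻¹
    have h2 := hd g g⁻¹
    rw [hg.1, one_mul] at h1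
    rw [hg.2, one_mul] at h2
    rw [← h1, ← h2]; simp

lemma mem_residualKernel {P : Type*} [Group P] {rho : P →* (GMA D)ˣ} {φ : A →+* F}
    {ha : ∀ g h, φ (rho (g * h) : GMA D).a = φ (rho g : GMA D).a * φ (rho h : GMA D).a}
    {hd : ∀ g h, φ (rho (g * h) : GMA D).d = φ (rho g : GMA D).d * φ (rho h : GMA D).d} {g : P} :
    g ∈ residualKernel rho φ ha hd ↔ φ (rho g : GMA D).a = 1 ∧ φ (rho g : GMA D).d = 1 := Iff.rfl

lemma IsResidueMap.isOpen_fiber (hφ : IsResidueMap p φ) (x : F) :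
    IsOpen {a : A | φ a = x} := by
  have : {a : A | φ a = x} = (fun a => a - const p A x) ⁻¹' (IsLocalRing.maximalIdeal A) := by
    ext a
    exact hφ.sub_const_mem_iff.symm
  rw [this]
  exact isOpen_maximalIdeal.preimage (by fun_prop)

/-- On the open subgroup N of elements reducing to 1, iterated p-th powers tend weakly to 1, so ρ
kills the kernel of N → N(p). There b and c are cocycles, and finite generation of N(p) bounds their
A-spans; the constant diagonal factors carry this over to all of ρ(P). -/
theorem finite_of_pFinite (hφ : IsResidueMap p φ) {P : ProfiniteGrp.{uP}} (hP : PFinite p P)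
    {rho : P →* (GMA D)ˣ} (hD : D.Faithful)
    (hspan : Submodule.span A (Set.range fun g => (rho g : GMA D)) = ⊤)
    (ha : ∀ g h, φ (rho (g * h) : GMA D).a = φ (rho g : GMA D).a * φ (rho h : GMA D).a)
    (hd : ∀ g h, φ (rho (g * h) : GMA D).d = φ (rho g : GMA D).d * φ (rho h : GMA D).d)
    (hac : Continuous fun g => (rho g : GMA D).a) (hdc : Continuous fun g => (rho g : GMA D).d)
    (hdet : ∀ g ∈ residualKernel rho φ ha hd, (rho g : GMA D).det = 1)
    (hdec : ∀ g, ∃ x y : F, ∃ h ∈ residualKernel rho φ ha hd,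
      (rho g : GMA D) = diag D (const p A x) (const p A y) * rho h) :
    Module.Finite A B ∧ Module.Finite A C := by
  set N := residualKernel rho φ ha hd with hN
  have hNo : IsOpen (N : Set P) :=
    ((hφ.isOpen_fiber 1).preimage hac).inter ((hφ.isOpen_fiber 1).preimage hdc)
  have : CompactSpace N := isCompact_iff_compactSpace.mp (N.isClosed_of_isOpen hNo).isCompact
  have hmB : ∀ c, Continuous fun n : N => D.m (rho n : GMA D).b c := fun c =>
    (continuous_m_left hac hspan c).comp continuous_subtype_val
  have hmC : ∀ b, Continuous fun n : N => D.m b (rho n : GMA D).c := fun b =>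
    (continuous_m_right hac hspan b).comp continuous_subtype_val
  have hac' : Continuous fun n : N => (rho n : GMA D).a := hac.comp continuous_subtype_val
  have hdc' : Continuous fun n : N => (rho n : GMA D).d := hdc.comp continuous_subtype_val
  -- Coordinates in A that separate matrices by faithfulness; they stand in for a topology on B and
  -- C.
  let w : GMA D → A × A × (C → A) × (B → A) := fun u => (u.a, u.d, fun c => D.m u.b c,
    fun b => D.m b u.c)
  have hw : ∀ u v, w u = w v → u = v := by
    intro u v h
    simp only [w, Prod.mk.injEq] at h
    obtain ⟨h1, h2, h3, h4⟩ := h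
    ext
    · exact h1
    · refine sub_eq_zero.mp (faithful_left hD fun c => ?_)
      rw [map_sub, LinearMap.sub_apply, sub_eq_zero]; exact congrFun h3 c
    · refine sub_eq_zero.mp (faithful_right hD fun b => ?_)
      rw [map_sub, sub_eq_zero]; exact congrFun h4 b
    · exact h2
  let ρN : N →* (GMA D)ˣ := rho.comp N.subtype
  have hker : proPKernel p N ≤ ρN.ker := by
    refine proPKernel_le (f := fun n : N => w (rho n : GMA D)) ?_ (fun n => ?_) fun n => ?_
    · exact hac'.prodMk (hdc'.prodMk ((continuous_pi hmB).prodMk (continuous_pi hmC)))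
    · rw [MonoidHom.mem_ker]
      constructor
      · intro h
        have := hw _ _ h
        rw [OneMemClass.coe_one, map_one] at this
        exact Units.ext this
      · intro h
        have : rho n = 1 := h
        simp [this]
    · have key : ∀ f : GMA D →ₗ[A] A,
          Tendsto (fun k : ℕ => f (rho ((n ^ p ^ k : N) : P) : GMA D)) atTop
            (𝓝 (f (rho ((1 : N) : P) : GMA D))) := by
        intro f
        have := tendsto_linearMap_pow hφ (hdet n n.2) (by
          rw [trace, map_add, n.2.1, n.2.2, one_add_one_eq_two]) f
        simpa using this
      refine (key (aLin D)).prodMk_nhds ((key (dLin D)).prodMk_nhds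
        ((tendsto_pi_nhds.mpr fun c => ?_).prodMk_nhds (tendsto_pi_nhds.mpr fun b => ?_)))
      · exact key (D.m.flip c ∘ₗ bLin D)
      · exact key (D.m b ∘ₗ cLin D)
  have hρk : ∀ n ∈ proPKernel p N, (rho n : GMA D) = 1 := fun n hn => by
    have : rho n = 1 := hker hn
    rw [this, Units.val_one]
  have hua : ∀ n : N, IsUnit (rho n : GMA D).a := fun n =>
    hφ.isUnit_iff.mpr (by rw [n.2.1]; exact one_ne_zero)
  have hud : ∀ n : N, IsUnit (rho n : GMA D).d := fun n =>
    hφ.isUnit_iff.mpr (by rw [n.2.2]; exact one_ne_zero)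
  constructor
  · obtain ⟨X', hX', h⟩ := exists_fg_of_cocycle (hP N hNo) (X := B)
      (β := fun n : N => (rho n : GMA D).b) (α := fun n => (rho n : GMA D).a)
      (δ := fun n => (rho n : GMA D).d) (fun g h => by simp) (by simp) hua
      (fun n hn => by simp [hρk n hn]) (fun c : C => D.m.flip c)
      (fun b hb => faithful_left hD hb) hmB
    refine Module.finite_def.mpr ((eq_top_iff.mpr fun b _ => ?_ : X' = ⊤) ▸ hX')
    refine exists_span_induction hspan bLin_surjective (fun g => ?_) b
    obtain ⟨x, y, k, hk, hg⟩ := hdec g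
    rw [hg, bLin_apply, mul_b, diag_a, diag_b, smul_zero, add_zero]
    exact X'.smul_mem _ (h ⟨k, hk⟩)
  · obtain ⟨X', hX', h⟩ := exists_fg_of_cocycle (hP N hNo) (X := C)
      (β := fun n : N => (rho n : GMA D).c) (α := fun n => (rho n : GMA D).d)
      (δ := fun n => (rho n : GMA D).a) (fun g h => by simp [add_comm]) (by simp) hud
      (fun n hn => by simp [hρk n hn]) (fun b : B => D.m b)
      (fun c hc => faithful_right hD hc) hmC
    refine Module.finite_def.mpr ((eq_top_iff.mpr fun b _ => ?_ : X' = ⊤) ▸ hX')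
    refine exists_span_induction hspan cLin_surjective (fun g => ?_) b
    obtain ⟨x, y, k, hk, hg⟩ := hdec g
    rw [hg, cLin_apply, mul_c, diag_c, diag_d, smul_zero, zero_add]
    exact X'.smul_mem _ (h ⟨k, hk⟩)

lemma isSpecialGroup_pinkGroup (hφ : IsResidueMap p φ) (hBC : ∀ b c, φ (D.m b c) = 0) {P : Type*}
    [Group P] (rho : P →* (GMA D)ˣ) : IsSpecialGroup (pinkGroup rho) := by
  have hmem : ∀ x : GMA D, x - 1 ∈ Ring.jacobson (GMA D) ↔ φ x.a = 1 ∧ φ x.d = 1 := fun x => by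
    rw [mem_jacobson_iff hφ hBC, sub_a, sub_d, map_sub, map_sub, one_a, one_d, map_one,
      sub_eq_zero, sub_eq_zero]
  refine ⟨?_, ?_, fun x hx => hx.2.1⟩
  · rintro x ⟨⟨g, hg⟩, hx1, hx2⟩ y ⟨⟨h, hh⟩, hy1, hy2⟩
    rw [hmem] at hx2 hy2
    refine ⟨⟨g * h, by rw [map_mul, Units.val_mul, hg, hh]⟩, by rw [det_mul, hx1, hy1, one_mul],
      (hmem _).mpr ?_⟩
    simp [hx2, hy2, hBC]
  · rintro x ⟨⟨g, hg⟩, hx1, hx2⟩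
    rw [hmem] at hx2
    refine ⟨⟨g⁻¹, ?_⟩, by rw [← hx1]; simp [det, adj, mul_comm], (hmem _).mpr hx2.symm⟩
    rw [map_inv, coe_inv_eq_adj (by rw [hg, hx1]), hg]

theorem direct_part (hφ : IsResidueMap p φ) (hp : p ≠ 2) [TopologicalSpace B]
    [IsModuleTopology A B] [TopologicalSpace C] [IsModuleTopology A C]
    {P : ProfiniteGrp.{uP}} {rhobar : P →* GL (Fin 2) F} {t : P → A} {d : P →* Aˣ}
    {rho : P →* (GMA D)ˣ} (hadm : IsAdmissible p P rhobar t d)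
    (hm : 2 < Nat.card (projImage rhobar)) (hrep : IsTDRep rho t d)
    (hwell : IsWellAdaptedCyclic p rhobar rho) :
    2 < Nat.gcd (Nat.card (projImage rhobar)) (Nat.card F - 1) ∧
    ∀ K : Subfield F, 2 < Nat.gcd (Nat.card (projImage rhobar)) (Nat.card K - 1) →
      ∃ (I₁ : Submodule (wittSubring p A K) A) (B₁ : Submodule (wittSubring p A K) B)
        (C₁ : Submodule (wittSubring p A K) C), IsPinkDatum p D K I₁ B₁ C₁ ∧
        (Submodule.span (wittSubring p A K) (pinkLie rho) : Set (GMA D)) =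
          matZero D I₁ B₁ C₁ := by
  obtain ⟨g₀, l, m, had, hgen⟩ := hwell.adapted
  have ha := map_a_mul hφ hadm hrep had hgen
  have hBC := map_m_eq_zero hrep.span_eq ha
  have hd := map_d_mul (rho := rho) hBC
  have hla : φ (rho g₀ : GMA D).a = l := hφ.sub_const_mem_iff.mp had.a_congr
  have hmd : φ (rho g₀ : GMA D).d = m := hφ.sub_const_mem_iff.mp had.d_congr
  have hdetu : ∀ g, φ (rho g : GMA D).a ≠ 0 ∧ φ (rho g : GMA D).d ≠ 0 := fun g => by
    have := hφ.isUnit_iff.mp (isUnit_det (rho g))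
    rw [det, map_sub, hBC, sub_zero, map_mul] at this
    exact ⟨left_ne_zero_of_mul this, right_ne_zero_of_mul this⟩
  have hl0 : l ≠ 0 := hla ▸ (hdetu g₀).1
  have hm0 : m ≠ 0 := hmd ▸ (hdetu g₀).2
  have ht : Continuous fun g => (rho g : GMA D).trace := by
    simpa only [hrep.trace_eq] using hadm.t_continuous
  obtain ⟨hac, hdc⟩ := continuous_a_d_of_trace hφ ht had.b_eq had.c_eq
    (by rw [hla, hmd]; exact had.ne)
  have hdet : ∀ g ∈ residualKernel rho φ ha hd, (rho g : GMA D).det = 1 := by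
    intro g hg
    -- The determinant is a Teichmüller constant reducing to 1, hence equal to 1.
    obtain ⟨x, hx⟩ := hadm.det_const g
    have h1 : (rho g : GMA D).det = const p A x := by rw [hrep.det_eq, hx]
    have h2 := congrArg φ h1
    rw [hφ.const_eq, det, map_sub, hBC, sub_zero, map_mul, hg.1, hg.2, one_mul] at h2
    rw [h1, ← h2, map_one]
  have hconst : ∀ g, ∃ h, (rho h : GMA D) =
      ⟨const p A (φ (rho g : GMA D).a), 0, 0, const p A (φ (rho g : GMA D).d)⟩ := fun g =>
    hwell.const_mem g _ _ (hφ.sub_const_mem_iff.mpr rfl) (hφ.sub_const_mem_iff.mpr rfl)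
  have hdec : ∀ g, ∃ x y : F, ∃ h ∈ residualKernel rho φ ha hd,
      (rho g : GMA D) = diag D (const p A x) (const p A y) * rho h := by
    intro g
    obtain ⟨h, hh⟩ := hconst g
    have h1 := ha h (h⁻¹ * g)
    have h2 := hd h (h⁻¹ * g)
    rw [mul_inv_cancel_left, hh, hφ.const_eq] at h1 h2
    refine ⟨φ (rho g : GMA D).a, φ (rho g : GMA D).d, h⁻¹ * g,
      mem_residualKernel.mpr ⟨?_, ?_⟩, ?_⟩
    · exact (mul_eq_left₀ (hdetu g).1).mp h1.symm
    · exact (mul_eq_left₀ (hdetu g).2).mp h2.symm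
    · rw [GMA.diag, ← hh, ← Units.val_mul, ← map_mul, mul_inv_cancel_left]
  obtain ⟨hBf, hCf⟩ := finite_of_pFinite hφ hadm.pFinite hrep.faithful hrep.span_eq ha hd hac hdc
    hdet hdec
  have := IsModuleTopology.toContinuousAdd A B
  have := IsModuleTopology.toContinuousAdd A C
  have := compactSpace_of_finite (A := A) (X := B)
  have := compactSpace_of_finite (A := A) (X := C)
  have : T2Space B := t2Space_of_separating (fun c : C => D.m.flip c)
    (fun b hb => faithful_left hrep.faithful hb)
  have : T2Space C := t2Space_of_separating (fun b : B => D.m b)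
    (fun b hb => faithful_right hrep.faithful hb)
  have : ContinuousMul (GMA D) := continuousMul
    (IsModuleTopology.continuous_bilinear_of_finite_left D.m)
  have hlm1 : (l / m) ^ (Nat.card F - 1) = 1 := by
    have := Fintype.ofFinite F
    rw [Nat.card_eq_fintype_card]
    exact FiniteField.pow_card_sub_one_eq_one _ (div_ne_zero hl0 hm0)
  have hdvd : Nat.card (projImage rhobar) ∣ orderOf (l / m) := by
    refine card_projImage_dvd had.ne had.charpoly_eq hgen ?_
    have := pow_orderOf_eq_one (l / m)
    rwa [div_pow, div_eq_one_iff_eq (pow_ne_zero _ hm0)] at this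
  refine ⟨?_, fun K hK => ?_⟩
  -- The order of the projective image divides that of l/m, hence |F| − 1, so the gcd is that order
  -- itself.
  · rwa [Nat.gcd_eq_left (hdvd.trans (orderOf_dvd_of_pow_eq_one hlm1))]
  set k := Nat.gcd (Nat.card (projImage rhobar)) (Nat.card K - 1) with hk
  have hkd : k ∣ orderOf (l / m) := (Nat.gcd_dvd_left _ _).trans hdvd
  have ho0 : orderOf (l / m) ≠ 0 := by
    have h1 : 1 < Nat.card F := Finite.one_lt_card
    exact fun h0 => by
      have := orderOf_dvd_of_pow_eq_one hlm1
      rw [h0, zero_dvd_iff] at this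
      omega
  -- j is chosen so that z has order exactly k: then k ∣ |K| − 1 puts z in K, and k > 2 gives z² ≠
  -- 1.
  set j := orderOf (l / m) / k with hj
  set z := (l / m) ^ j with hz
  have hoz : orderOf z = k := orderOf_pow_orderOf_div ho0 hkd
  have hz0 : z ≠ 0 := pow_ne_zero _ (div_ne_zero hl0 hm0)
  have hzK : z ∈ K := mem_of_pow_card_sub_one K
    (orderOf_dvd_iff_pow_eq_one.mp (hoz ▸ Nat.gcd_dvd_right _ _))
  have hz2 : z ^ 2 ≠ 1 := fun h => by
    have := Nat.le_of_dvd two_pos (orderOf_dvd_of_pow_eq_one h)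
    omega
  have haj : ∀ j : ℕ, φ (rho (g₀ ^ j) : GMA D).a = l ^ j ∧ φ (rho (g₀ ^ j) : GMA D).d = m ^ j := by
    intro j
    induction j with
    | zero => simp
    | succ j ih => rw [pow_succ, ha, hd, ih.1, ih.2, hla, hmd, pow_succ, pow_succ]; simp
  refine exists_isPinkDatum hφ hp hrep.trace_eq hrep.span_eq hadm.generate
    (isSpecialGroup_pinkGroup hφ hBC rho) (fun x hx => ?_) (fun g => ?_) hzK hz0 hz2 (fun x hx => ?_)
  · have := (mem_jacobson_iff hφ hBC _).mp hx.2.2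
    simpa [sub_eq_zero] using this
  · obtain ⟨x, y, h, hh, hg⟩ := hdec g
    refine ⟨x, y, _, ⟨⟨h, rfl⟩, hdet h hh, ?_⟩, hg⟩
    rw [mem_jacobson_iff hφ hBC]
    simp [hh.1, hh.2]
  · obtain ⟨⟨g, rfl⟩, hx1, hx2⟩ := hx
    -- By well-adaptedness diag(s(l^j), s(m^j)) lies in ρ(P); conjugation by it scales b by s(z) and
    -- c by s(z⁻¹).
    obtain ⟨h, hh⟩ := hconst (g₀ ^ j)
    rw [(haj j).1, (haj j).2] at hh
    have hlj := pow_ne_zero j hl0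
    have hmj := pow_ne_zero j hm0
    have hone : ∀ x : F, x ≠ 0 → const p A x * const p A x⁻¹ = 1 := fun x hx => by
      rw [← map_mul, mul_inv_cancel₀ hx, map_one]
    have hinv : ((rho h)⁻¹ : (GMA D)ˣ) =
        diag D (const p A (l ^ j)⁻¹) (const p A (m ^ j)⁻¹) := by
      refine (Units.eq_inv_of_mul_eq_one_left ?_).symm
      rw [hh, ← GMA.diag, diag_mul_diag, hone _ hlj, hone _ hmj, diag_one]
    have hz' : z = l ^ j * (m ^ j)⁻¹ := by rw [hz, div_pow, div_eq_mul_inv]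
    have hzi : z⁻¹ = (l ^ j)⁻¹ * m ^ j := by rw [hz', mul_inv, inv_inv]
    have hconj : (rho (h * g * h⁻¹) : GMA D) =
        conjLin D (const p A z) (const p A z⁻¹) (rho g : GMA D) := by
      rw [map_mul, map_mul, map_inv, Units.val_mul, Units.val_mul, hinv, hh, ← GMA.diag,
        diag_mul_mul_diag (hone _ hlj) (hone _ hmj), ← map_mul, ← map_mul, ← hz', ← hzi]
    refine ⟨⟨_, hconj⟩, ?_, ?_⟩
    · have hzz := hone z hz0
      rw [det] at hx1 ⊢
      simp only [conjLin_apply_a, conjLin_apply_b, conjLin_apply_c, conjLin_apply_d, map_smul,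
        LinearMap.smul_apply, smul_eq_mul]
      linear_combination hx1 - D.m (rho g : GMA D).b (rho g : GMA D).c * hzz
    · rw [mem_jacobson_iff hφ hBC] at hx2 ⊢
      simpa using hx2

end direct

/-! ### The theorem of Eakin and Nagata -/

section eakinNagata

variable {E A : Type*} [CommRing E] [CommRing A] [Algebra E A]

/-- `M / N` is noetherian. -/
def NoethMod {M : Type*} [AddCommGroup M] [Module E M] (N : Submodule E M) : Prop :=
  ∀ N', N ≤ N' → ∃ T : Submodule E M, T.FG ∧ N' = N ⊔ T

lemma NoethMod.mono {M : Type*} [AddCommGroup M] [Module E M] {N N' : Submodule E M}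
    (h : NoethMod N) (hN : N ≤ N') : NoethMod N' := fun Q hQ => by
  obtain ⟨T, hT, h'⟩ := h Q (hN.trans hQ)
  exact ⟨T, hT, le_antisymm (h'.le.trans (sup_le_sup_right hN T))
    (sup_le hQ (le_sup_right.trans h'.ge))⟩

lemma noethMod_iff {M : Type*} [AddCommGroup M] [Module E M] {N : Submodule E M} :
    NoethMod N ↔ IsNoetherian E (M ⧸ N) := by
  constructor
  · refine fun h => ⟨fun Q => ?_⟩
    obtain ⟨T, hT, hQ⟩ := h (Q.comap N.mkQ) (by
      intro x hx
      rw [Submodule.mem_comap, Submodule.mkQ_apply, (Submodule.Quotient.mk_eq_zero N).mpr hx]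
      exact Q.zero_mem)
    have := Submodule.map_comap_eq_of_surjective N.mkQ_surjective Q
    rw [← this, hQ, Submodule.map_sup, Submodule.mkQ_map_self, bot_sup_eq]
    exact hT.map _
  · intro h N' hN
    obtain ⟨n, s, hs⟩ := Submodule.fg_iff_exists_fin_generating_family.mp
      (IsNoetherian.noetherian (N'.map N.mkQ))
    have : ∀ i, ∃ y ∈ N', N.mkQ y = s i := fun i => by
      have : s i ∈ N'.map N.mkQ := hs ▸ Submodule.subset_span ⟨i, rfl⟩
      simpa using this
    choose y hy hys using this
    refine ⟨Submodule.span E (Set.range y), Submodule.fg_span (Set.finite_range y), ?_⟩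
    have h1 : (Submodule.span E (Set.range y)).map N.mkQ = N'.map N.mkQ := by
      rw [Submodule.map_span, ← Set.range_comp, ← hs]
      congr 1
      ext z
      simp [hys]
    have h2 := congrArg (Submodule.comap N.mkQ) h1
    rw [Submodule.comap_map_eq, Submodule.comap_map_eq, Submodule.ker_mkQ,
      sup_eq_left.mpr hN] at h2
    rw [← h2, sup_comm]

/-- If a noetherian ring is finite over a ring, it is a noetherian module over it. -/
theorem isNoetherian_of_isNoetherianRing [IsNoetherianRing A] [Module.Finite E A] :
    IsNoetherian E A := by
  classical
  by_contra hcon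
  let f : Ideal E → Ideal A := Ideal.map (algebraMap E A)
  -- Noetherian induction in A: J is maximal among the extended ideals IA with A/IA not noetherian
  -- over E.
  let S : Set (Ideal A) := {J | (∃ I, f I = J) ∧ ¬ NoethMod (J.restrictScalars E)}
  have hbot : (⊥ : Ideal A) ∈ S := by
    refine ⟨⟨⊥, Ideal.map_bot⟩, fun h => hcon ?_⟩
    have := noethMod_iff.mp h
    exact isNoetherian_of_linearEquiv
      (Submodule.quotEquivOfEqBot ((⊥ : Ideal A).restrictScalars E) (by simp))
  obtain ⟨J, ⟨⟨I, hI⟩, hJ⟩, hmax⟩ := set_has_maximal_iff_noetherian.mpr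
    (inferInstance : IsNoetherian A A) S ⟨_, hbot⟩
  have hmax' : ∀ I', J < f I' → NoethMod ((f I').restrictScalars E) := fun I' h => by
    by_contra hn
    exact hmax _ ⟨⟨I', rfl⟩, hn⟩ h
  obtain ⟨n, x, hx⟩ := Submodule.fg_iff_exists_fin_generating_family.mp
    (Module.Finite.fg_top (R := E) (M := A))
  have hgen : ∀ (N : Submodule E A) (e : E), (∀ i, e • x i ∈ N) → ∀ a, e • a ∈ N := by
    intro N e h a
    have ha : a ∈ Submodule.span E (Set.range x) := hx ▸ Submodule.mem_top
    induction ha using Submodule.span_induction with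
    | mem y hy => obtain ⟨i, rfl⟩ := hy; exact h i
    | zero => simp
    | add a b _ _ h1 h2 => rw [smul_add]; exact N.add_mem h1 h2
    | smul r a _ h => rw [smul_comm]; exact N.smul_mem _ h
  -- N is a maximal E-submodule above J such that eA ⊆ N forces e into J. Finite generation of A
  -- lets this condition pass to unions of chains.
  let Q : Set (Submodule E A) :=
    {N | J.restrictScalars E ≤ N ∧ ∀ e : E, (∀ a, e • a ∈ N) → algebraMap E A e ∈ J}
  obtain ⟨N, hJN, hN⟩ := zorn_le_nonempty₀ Q (by
    intro c hc hch y hy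
    have hne : c.Nonempty := ⟨y, hy⟩
    refine ⟨sSup c, ⟨(hc hy).1.trans (le_sSup hy), fun e he => ?_⟩, fun z hz => le_sSup hz⟩
    have hdir : DirectedOn (· ≤ ·) c := hch.directedOn
    have : ∀ i, ∃ M ∈ c, e • x i ∈ M := fun i =>
      (Submodule.mem_sSup_of_directed hne hdir).mp (he (x i))
    choose M hM hMx using this
    obtain ⟨M', hM', hle⟩ : ∃ M' ∈ c, ∀ i ∈ (Finset.univ : Finset (Fin n)), M i ≤ M' := by
      refine Finset.induction_on (Finset.univ : Finset (Fin n)) ⟨y, hy, by simp⟩ ?_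
      rintro i s - ⟨M', hM', h⟩
      obtain ⟨M'', hM'', h1, h2⟩ := hdir M' hM' (M i) (hM i)
      refine ⟨M'', hM'', fun j hj => ?_⟩
      rcases Finset.mem_insert.mp hj with rfl | hj
      · exact h2
      · exact (h j hj).trans h1
    exact (hc hM').2 e (hgen M' e fun i => hle i (Finset.mem_univ i) (hMx i)))
    (J.restrictScalars E) ⟨le_rfl, fun e he => by simpa [Algebra.smul_def] using he 1⟩
  have hNQ : ∀ e : E, (∀ a, e • a ∈ N) → algebraMap E A e ∈ J := hN.prop.2
  -- By maximality N' contains eA for some e outside J, hence the extended ideal J + eA, which is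
  -- strictly larger than J.
  have hNbig : ∀ N', N < N' → NoethMod N' := by
    intro N' hlt
    have hnot : N' ∉ Q := fun h => hlt.not_ge (hN.le_of_ge h hlt.le)
    have : ∃ e : E, (∀ a, e • a ∈ N') ∧ algebraMap E A e ∉ J := by
      by_contra! h
      exact hnot ⟨hJN.trans hlt.le, h⟩
    obtain ⟨e, he, heJ⟩ := this
    have hf : f (I ⊔ Ideal.span {e}) = J ⊔ Ideal.span {algebraMap E A e} := by
      simp only [f, Ideal.map_sup, Ideal.map_span, Set.image_singleton]
      exact congrArg (· ⊔ _) hI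
    refine (hmax' (I ⊔ Ideal.span {e}) ?_).mono ?_
    · rw [hf]
      refine lt_of_le_of_ne le_sup_left fun h => heJ ?_
      rw [h]
      exact Ideal.mem_sup_right (Ideal.mem_span_singleton_self _)
    · rw [hf]
      intro a ha
      obtain ⟨j, hj, k, hk, rfl⟩ := Submodule.mem_sup.mp ha
      obtain ⟨r, rfl⟩ := Ideal.mem_span_singleton'.mp hk
      refine N'.add_mem (hlt.le (hJN hj)) ?_
      rw [mul_comm, ← Algebra.smul_def]
      exact he r
  have hNn : NoethMod N := by
    intro N' hN'
    rcases eq_or_lt_of_le hN' with rfl | hlt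
    · exact ⟨⊥, Submodule.fg_bot, by simp⟩
    obtain ⟨y, hy, hyN⟩ := Set.exists_of_ssubset hlt
    have hlt1 : N < N ⊔ Submodule.span E {y} := by
      refine lt_of_le_of_ne le_sup_left fun h => hyN ?_
      rw [h]
      exact Submodule.mem_sup_right (Submodule.mem_span_singleton_self y)
    obtain ⟨T, hT, h⟩ := hNbig _ hlt1 N'
      (sup_le hN' ((Submodule.span_singleton_le_iff_mem _ _).mpr hy))
    exact ⟨Submodule.span E {y} ⊔ T, (Submodule.fg_span_singleton y).sup hT, by
      rw [h, sup_assoc]⟩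
  have hAN : IsNoetherian E (A ⧸ N) := noethMod_iff.mp hNn
  -- E/ker ψ embeds in (A/N)^n, so it is noetherian. Since ker ψ maps into J, the module A/J is a
  -- quotient of (E/ker ψ)^n, which contradicts the choice of J.
  let ψ : E →ₗ[E] (Fin n → A ⧸ N) :=
    LinearMap.pi fun i => N.mkQ.comp (LinearMap.toSpanSingleton E A (x i))
  have hker : ∀ e, ψ e = 0 → algebraMap E A e ∈ J := fun e he =>
    hNQ e (hgen N e fun i => by
      have := congrFun he i
      exact (Submodule.Quotient.mk_eq_zero N).mp (by simpa [ψ] using this))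
  have hE : IsNoetherian E (E ⧸ LinearMap.ker ψ) :=
    isNoetherian_of_linearEquiv ψ.quotKerEquivRange.symm
  apply hJ
  rw [noethMod_iff]
  let JE : Submodule E A := J.restrictScalars E
  let g (i : Fin n) : (E ⧸ LinearMap.ker ψ) →ₗ[E] (A ⧸ JE) :=
    (LinearMap.ker ψ).liftQ (JE.mkQ.comp (LinearMap.toSpanSingleton E A (x i))) (by
      intro e he
      have : algebraMap E A e ∈ J := hker e he
      simp only [LinearMap.mem_ker, LinearMap.coe_comp, Function.comp_apply,
        LinearMap.toSpanSingleton_apply, Submodule.mkQ_apply, Submodule.Quotient.mk_eq_zero,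
        Algebra.smul_def]
      exact Ideal.mul_mem_right _ J this)
  let G : (Fin n → E ⧸ LinearMap.ker ψ) →ₗ[E] (A ⧸ JE) :=
    ∑ i, (g i).comp (LinearMap.proj i)
  refine isNoetherian_of_surjective (f := G) ?_
  rw [LinearMap.range_eq_top]
  intro z
  obtain ⟨a, rfl⟩ := JE.mkQ_surjective z
  have ha : a ∈ Submodule.span E (Set.range x) := hx ▸ Submodule.mem_top
  obtain ⟨c, rfl⟩ := (Submodule.mem_span_range_iff_exists_fun E).mp ha
  refine ⟨fun i => (LinearMap.ker ψ).mkQ (c i), ?_⟩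
  simp only [G, LinearMap.sum_apply, LinearMap.comp_apply, LinearMap.proj_apply, map_sum, map_smul]
  exact Finset.sum_congr rfl fun i _ => by
    simp only [g, Submodule.mkQ_apply, Submodule.liftQ_apply, LinearMap.comp_apply,
      LinearMap.toSpanSingleton_apply, Submodule.Quotient.mk_smul]

end eakinNagata

open Filter Topology Pointwise GMA

/-! ### Finite generation of Pink data -/

lemma isClosed_of_fg {R X : Type*} [CommRing R] [TopologicalSpace R] [CompactSpace R]
    [AddCommGroup X] [Module R X] [TopologicalSpace X] [ContinuousSMul R X] [ContinuousAdd X]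
    [T2Space X] {N : Submodule R X} (hN : N.FG) : IsClosed (N : Set X) := by
  obtain ⟨n, s, rfl⟩ := Submodule.fg_iff_exists_fin_generating_family.mp hN
  have hc : Continuous fun c : Fin n → R => ∑ i, c i • s i := by fun_prop
  convert (isCompact_range hc).isClosed
  ext x
  simp [Submodule.mem_span_range_iff_exists_fun]

section

variable {p : ℕ} [Fact p.Prime] {F : Type uF} [Field F] [Finite F] [CharP F p]
  {A : Type uA} [CommRing A] [TopologicalSpace A] [IsTopologicalRing A] [CompactSpace A]
  [T2Space A] [IsLocalRing A] [Algebra (WittVector p F) A] {φ : A →+* F}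

/-- The finiteness statement behind the converse: `I` is generated, as a closed subgroup stable
under constants, by finitely many elements and multiplications by products of two of them. -/
lemma exists_finite_generating [IsNoetherianRing A] (hφ : IsResidueMap p φ) {I : AddSubgroup A}
    (hcl : IsClosed (I : Set A)) (hI : ∀ i ∈ I, φ i = 0)
    (h3 : ∀ i ∈ I, ∀ j ∈ I, ∀ k ∈ I, i * j * k ∈ I)
    (hW : ∀ w ∈ wittSubring p A (⊤ : Subfield F), ∀ i ∈ I, w * i ∈ I)
    (hA : ∀ a : A, ∃ w ∈ wittSubring p A (⊤ : Subfield F), ∃ i ∈ I,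
      ∃ j ∈ closedProd (· * ·) (I : Set A) (I : Set A), a = w + i + j) :
    ∃ S : Set A, S.Finite ∧ S ⊆ I ∧ ∀ M : AddSubgroup A, IsClosed (M : Set A) →
      (∀ x : F, ∀ y ∈ M, const p A x * y ∈ M) → S ⊆ M →
      (∀ s ∈ S, ∀ s' ∈ S, ∀ y ∈ M, s * s' * y ∈ M) → I ≤ M := by
  set W := wittSubring p A (⊤ : Subfield F) with hWdef
  -- Write an element of 𝔪 as w + i + j with j ∈ I²; then w reduces to 0 and is a multiple of p.
  have hmax : IsLocalRing.maximalIdeal A = Ideal.span ({(p : A)} ∪ (I : Set A)) := by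
    refine le_antisymm (fun a ha => ?_) (Ideal.span_le.mpr ?_)
    · obtain ⟨w, hw, i, hi, j, hj, rfl⟩ := hA a
      set J := Ideal.span ({(p : A)} ∪ (I : Set A)) with hJ
      have hiJ : ∀ i ∈ I, i ∈ J := fun i hi => Ideal.subset_span (Or.inr hi)
      have hjJ : j ∈ J := closedProd_subset (N := J.toAddSubgroup)
        (isClosed_of_fg (R := A) (IsNoetherian.noetherian J))
        (fun s hs t _ => Ideal.mul_mem_right _ _ (hiJ s hs)) hj
      have hφj : φ j = 0 := by
        refine (hφ.mem_maximalIdeal_iff j).mp (closedProd_subset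
          (N := (IsLocalRing.maximalIdeal A).toAddSubgroup) isClosed_maximalIdeal
          (fun s hs t _ => Ideal.mul_mem_right _ _ ((hφ.mem_maximalIdeal_iff s).mpr (hI s hs))) hj)
      rw [hφ.mem_maximalIdeal_iff, map_add, map_add, hI i hi, hφj, add_zero, add_zero] at ha
      obtain ⟨x, -, w', -, rfl⟩ := exists_eq_const_add hw
      rw [map_add, hφ.const_eq, map_mul, map_natCast, CharP.cast_eq_zero, zero_mul, add_zero] at ha
      refine J.add_mem (J.add_mem ?_ (hiJ i hi)) hjJ
      rw [ha, const_zero, zero_add]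
      exact J.mul_mem_right _ (Ideal.subset_span (Or.inl rfl))
    · rintro x (rfl | hx)
      · exact hφ.natCast_mem
      · exact (hφ.mem_maximalIdeal_iff x).mpr (hI x hx)
  obtain ⟨s, hs, hspan⟩ := Submodule.fg_span_iff_fg_span_finset_subset _ |>.mp
    (IsNoetherian.noetherian (Submodule.span A ({(p : A)} ∪ (I : Set A))))
  set S₀ : Set A := (s : Set A) ∩ I with hS₀
  have hS₀f : S₀.Finite := s.finite_toSet.inter_of_left _
  -- I³ ⊆ I makes I stable under E, and N = E + E S₀ is a ring because S₀S₀ ⊆ E.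
  set E : Subring A := (Subring.closure ((W : Set A) ∪ S₀ * S₀)).topologicalClosure with hE
  have hEcl : IsClosed (E : Set A) := Subring.isClosed_topologicalClosure _
  have hWE : ∀ w ∈ W, w ∈ E := fun w hw =>
    Subring.le_topologicalClosure _ (Subring.subset_closure (Or.inl hw))
  have hSE : ∀ s ∈ S₀, ∀ s' ∈ S₀, s * s' ∈ E := fun s hs s' hs' =>
    Subring.le_topologicalClosure _ (Subring.subset_closure (Or.inr ⟨s, hs, s', hs', rfl⟩))
  have hEmul : ∀ M : AddSubgroup A, IsClosed (M : Set A) → (∀ w ∈ W, ∀ y ∈ M, w * y ∈ M) →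
      (∀ s ∈ S₀, ∀ s' ∈ S₀, ∀ y ∈ M, s * s' * y ∈ M) → ∀ e ∈ E, ∀ y ∈ M, e * y ∈ M := by
    intro M hM h1 h2
    let Q : Subring A :=
      { carrier := {e | ∀ y ∈ M, e * y ∈ M}
        mul_mem' := fun {a b} ha hb y hy => by rw [mul_assoc]; exact ha _ (hb _ hy)
        one_mem' := fun y hy => by rwa [one_mul]
        add_mem' := fun {a b} ha hb y hy => by rw [add_mul]; exact M.add_mem (ha _ hy) (hb _ hy)
        zero_mem' := fun y hy => by rw [zero_mul]; exact M.zero_mem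
        neg_mem' := fun {a} ha y hy => by rw [neg_mul]; exact M.neg_mem (ha _ hy) }
    have hQ : IsClosed (Q : Set A) := by
      have : (Q : Set A) = ⋂ y ∈ M, (fun e => e * y) ⁻¹' (M : Set A) := by
        ext e; simp [Q]
      rw [this]
      exact isClosed_biInter fun y _ => hM.preimage (by fun_prop)
    have hle : E ≤ Q := Subring.topologicalClosure_minimal _ (Subring.closure_le.mpr (by
      rintro _ (hw | ⟨s, hs, s', hs', rfl⟩)
      · exact h1 _ hw
      · exact h2 s hs s' hs')) hQ
    exact fun e he => hle he
  have hEI : ∀ e ∈ E, ∀ y ∈ I, e * y ∈ I :=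
    hEmul I hcl hW fun s hs s' hs' y hy => h3 s hs.2 s' hs'.2 y hy
  have : CompactSpace E := isCompact_iff_compactSpace.mp hEcl.isCompact
  set X : Set A := {1} ∪ S₀ with hX
  have hXf : X.Finite := (Set.finite_singleton _).union hS₀f
  set N : Submodule E A := Submodule.span E X with hN
  have hNfg : N.FG := Submodule.fg_span hXf
  have hNcl : IsClosed (N : Set A) := isClosed_of_fg hNfg
  have hEN : ∀ e ∈ E, e ∈ N := fun e he => by
    have : (⟨e, he⟩ : E) • (1 : A) ∈ N := N.smul_mem _ (Submodule.subset_span (Or.inl rfl))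
    rwa [Subring.smul_def, smul_eq_mul, mul_one] at this
  have hNN : ∀ a ∈ N, ∀ b ∈ N, a * b ∈ N := by
    have : N * N ≤ N := by
      rw [hN, Submodule.span_mul_span, Submodule.span_le]
      rintro _ ⟨a, ha, b, hb, rfl⟩
      rcases ha with rfl | ha
      · simp only [one_mul]; exact Submodule.subset_span hb
      · rcases hb with rfl | hb
        · simp only [mul_one]; exact Submodule.subset_span (Or.inr ha)
        · exact hEN _ (hSE a ha b hb)
    exact fun a ha b hb => this (Submodule.mul_mem_mul ha hb)
  have hsN : ∀ g ∈ s, g ∈ N := fun g hg => by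
    rcases hs hg with hgp | hgI
    · rw [Set.mem_singleton_iff.mp hgp]
      exact hEN _ (natCast_mem E p)
    · exact Submodule.subset_span (Or.inr ⟨hg, hgI⟩)
  set 𝔪 := IsLocalRing.maximalIdeal A with h𝔪
  have hms : 𝔪 = Ideal.span (s : Set A) := hmax.trans hspan
  -- N contains the constants and generators of 𝔪, so it is 𝔪-adically dense; being closed, it
  -- equals A.
  have hdense : ∀ n : ℕ, ∀ a : A, ∃ b ∈ N, a - b ∈ 𝔪 ^ n := by
    intro n
    induction n with
    | zero => exact fun a => ⟨0, N.zero_mem, by simp⟩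
    | succ n ih =>
      have hm : ∀ a ∈ 𝔪, ∃ b ∈ N, a - b ∈ 𝔪 ^ (n + 1) := by
        intro a ha
        rw [hms] at ha
        refine Submodule.span_induction (p := fun a _ => ∃ b ∈ N, a - b ∈ 𝔪 ^ (n + 1))
          (fun g hg => ⟨g, hsN g hg, by simp⟩) ⟨0, N.zero_mem, by simp⟩ ?_ ?_ ha
        · rintro a a' - - ⟨b, hb, h⟩ ⟨b', hb', h'⟩
          exact ⟨b + b', N.add_mem hb hb', by
            rw [add_sub_add_comm]; exact Ideal.add_mem _ h h'⟩
        · rintro r a ha ⟨b, hb, h⟩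
          obtain ⟨c, hc, h'⟩ := ih r
          have hbm : b ∈ 𝔪 := by
            have ha' : a ∈ 𝔪 := hms.symm.le ha
            have := 𝔪.sub_mem ha' (Ideal.pow_le_self (Nat.succ_ne_zero n) h)
            rwa [sub_sub_cancel] at this
          refine ⟨c * b, hNN c hc b hb, ?_⟩
          rw [smul_eq_mul, show r * a - c * b = r * (a - b) + (r - c) * b by ring]
          exact Ideal.add_mem _ (Ideal.mul_mem_left _ _ h)
            (pow_succ 𝔪 n ▸ Ideal.mul_mem_mul h' hbm)
      intro a
      obtain ⟨b, hb, h⟩ := hm (a - const p A (φ a)) (hφ.sub_const_mem_iff.mpr rfl)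
      refine ⟨const p A (φ a) + b, N.add_mem (hEN _ (hWE _ (const_mem_wittSubring trivial))) hb, ?_⟩
      rwa [← sub_sub]
  have hNtop : N = ⊤ := by
    refine eq_top_iff.mpr fun a _ => ?_
    by_contra ha
    have hU : (fun z => a - z) ⁻¹' (N : Set A)ᶜ ∈ 𝓝 0 :=
      (hNcl.isOpen_compl.preimage (by fun_prop)).mem_nhds (by simpa using ha)
    obtain ⟨n, hn⟩ := topNil_of_fg (IsNoetherian.noetherian 𝔪) le_rfl _ hU
    obtain ⟨b, hb, h⟩ := hdense n a
    exact hn h (by simpa using hb)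
  -- A = N is finite over E, so by Eakin–Nagata the E-submodule I is finitely generated; its
  -- generators Y are added to S₀.
  have : Module.Finite E A := ⟨hNtop ▸ hNfg⟩
  have : IsNoetherian E A := isNoetherian_of_isNoetherianRing
  let IE : Submodule E A :=
    { I with smul_mem' := fun e y hy => hEI e e.2 y hy }
  obtain ⟨Y, hY⟩ := (IsNoetherian.noetherian IE)
  have hYI : (Y : Set A) ⊆ I := fun y hy => by
    have : y ∈ IE := hY ▸ Submodule.subset_span hy
    exact this
  refine ⟨S₀ ∪ Y, hS₀f.union Y.finite_toSet, Set.union_subset Set.inter_subset_right hYI, ?_⟩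
  intro M hM h1 h2 h3'
  have hME := hEmul M hM
    (fun w hw y hy => hφ.smul_mem_of_const hM (fun x _ => h1 x) hw hy)
    (fun s hs s' hs' => h3' s (Or.inl hs) s' (Or.inl hs'))
  let ME : Submodule E A :=
    { M with smul_mem' := fun e y hy => hME e e.2 y hy }
  have : IE ≤ ME := hY ▸ Submodule.span_le.mpr fun y hy => h2 (Or.inr hy)
  exact fun i hi => this hi

end

open Filter Topology Pointwise GMA

/-! ### The group attached to a Pink datum over `W(F)` -/

section converse

variable {p : ℕ} [Fact p.Prime] {F : Type uF} [Field F] [Finite F] [CharP F p]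
  {A : Type uA} {B : Type uB} {C : Type uC} [CommRing A] [AddCommGroup B]
  [Module A B] [AddCommGroup C] [Module A C] {D : GMAData A B C}
  [Algebra (WittVector p F) A] [IsLocalRing A] {φ : A →+* F}

variable (p F) in
/-- The diagonal matrices with Teichmüller entries. -/
noncomputable def torus (D : GMAData A B C) : Fˣ × Fˣ →* (GMA D)ˣ :=
  MonoidHom.toHomUnits
    { toFun := fun q => diag D (const p A (q.1 : F)) (const p A (q.2 : F))
      map_one' := by simp [diag_one]
      map_mul' := fun q r => by simp [diag_mul_diag] }

@[simp] lemma coe_torus (q : Fˣ × Fˣ) :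
    (torus p F D q : GMA D) = diag D (const p A (q.1 : F)) (const p A (q.2 : F)) := rfl

variable [TopologicalSpace A] [IsTopologicalRing A] [CompactSpace A] [T2Space A]

lemma IsResidueMap.isClosed_fiber (hφ : IsResidueMap p φ) (x : F) :
    IsClosed {a : A | φ a = x} := by
  have : {a : A | φ a = x} = (fun a => a - const p A x) ⁻¹' (IsLocalRing.maximalIdeal A) := by
    ext a
    exact hφ.sub_const_mem_iff.symm
  rw [this]
  exact isClosed_maximalIdeal.preimage (by fun_prop)

/-- Square roots exist in `1 + 𝔪`. -/
lemma IsResidueMap.exists_sq_eq (hφ : IsResidueMap p φ) (hp : p ≠ 2) {v : A} (hv : φ v = 1) :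
    ∃ α, φ α = 1 ∧ α ^ 2 = v := by
  have hcl := hφ.isClosed_fiber 1
  -- The squares of 1 + 𝔪 form a compact set containing (v²)^n = (v^n)² for all n, hence also v.
  have hT : IsClosed ((fun α : A => α ^ 2) '' {α : A | φ α = 1}) :=
    (hcl.isCompact.image (by fun_prop)).isClosed
  obtain ⟨α, h1, h2⟩ := hφ.mem_of_sq_mem hp hT hv fun n =>
    ⟨v ^ n, by simp [hv], by simp only [← pow_mul, mul_comm]⟩
  exact ⟨α, h1, h2⟩

variable (p D φ) in
/-- The conditions on `I` when `B₁ = B` and `C₁ = C`. -/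
structure IsFullDatum (I : AddSubgroup A) : Prop where
  isClosed : IsClosed (I : Set A)
  map_eq_zero : ∀ i ∈ I, φ i = 0
  cube_mem : ∀ i ∈ I, ∀ j ∈ I, ∀ k ∈ I, i * j * k ∈ I
  m_mem : ∀ b c, D.m b c ∈ I
  witt_mul_mem : ∀ w ∈ wittSubring p A (⊤ : Subfield F), ∀ i ∈ I, w * i ∈ I
  exists_eq : ∀ a : A, ∃ w ∈ wittSubring p A (⊤ : Subfield F), ∃ i ∈ I,
    ∃ j ∈ closedProd (· * ·) (I : Set A) (I : Set A), a = w + i + j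

lemma mul_mem_closedProd {S T : Set A} {w : A} (hw : ∀ s ∈ S, w * s ∈ S) {j : A}
    (hj : j ∈ closedProd (· * ·) S T) : w * j ∈ closedProd (· * ·) S T := by
  refine map_mem_closure (continuous_const_mul w) hj fun j hj => ?_
  induction hj using AddSubgroup.closure_induction with
  | mem x hx =>
    obtain ⟨s, hs, t, ht, rfl⟩ := hx
    rw [← mul_assoc]
    exact AddSubgroup.subset_closure ⟨_, hw s hs, t, ht, rfl⟩
  | zero => simp
  | add x y _ _ h1 h2 => rw [mul_add]; exact add_mem h1 h2
  | neg x _ h => rw [mul_neg]; exact neg_mem h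

/-- For K = F the modules are already stable under W(F), so the spans in (3) and (4) add nothing. -/
lemma IsPinkDatum.isFullDatum [TopologicalSpace B] [TopologicalSpace C] (hφ : IsResidueMap p φ)
    {I₁ : Submodule (wittSubring p A (⊤ : Subfield F)) A}
    {B₁ : Submodule (wittSubring p A (⊤ : Subfield F)) B}
    {C₁ : Submodule (wittSubring p A (⊤ : Subfield F)) C} (h : IsPinkDatum p D ⊤ I₁ B₁ C₁) :
    B₁ = ⊤ ∧ C₁ = ⊤ ∧ IsFullDatum p D φ I₁.toAddSubgroup := by
  have hB : B₁ = ⊤ := by rw [← h.span_B, Submodule.span_eq]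
  have hC : C₁ = ⊤ := by rw [← h.span_C, Submodule.span_eq]
  refine ⟨hB, hC, h.isClosed_I,
    fun i hi => (hφ.mem_maximalIdeal_iff i).mp (h.subset_maximalIdeal hi),
    fun i hi j hj k hk => h.cube_subset (mem_closedProd (mem_closedProd hi hj) hk),
    fun b c => h.prod_subset (mem_closedProd (f := fun b c => D.m b c)
      (hB ▸ Submodule.mem_top) (hC ▸ Submodule.mem_top)),
    fun w hw i hi => I₁.smul_mem (⟨w, hw⟩ : wittSubring p A (⊤ : Subfield F)) hi, fun a => ?_⟩
  have ha : a ∈ (⊤ : Submodule (wittSubring p A (⊤ : Subfield F)) A) := Submodule.mem_top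
  rw [← h.span_A] at ha
  obtain ⟨x, hx, j, hj, rfl⟩ := Submodule.mem_sup.mp ha
  obtain ⟨y, hy, i, hi, rfl⟩ := Submodule.mem_sup.mp hx
  obtain ⟨w, rfl⟩ := Submodule.mem_span_singleton.mp hy
  refine ⟨w, w.2, i, ?_, j, ?_, by rw [Subring.smul_def, smul_eq_mul, mul_one]⟩
  · rwa [Submodule.span_eq] at hi
  · clear hx ha
    induction hj using Submodule.span_induction with
    | mem j hj => exact hj
    | zero => exact (closedProdSubgroup (I₁ : Set A) I₁).zero_mem
    | add j k _ _ h1 h2 => exact (closedProdSubgroup (I₁ : Set A) I₁).add_mem h1 h2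
    | smul w j _ hj =>
      exact mul_mem_closedProd (fun s hs => I₁.smul_mem w hs) hj

variable {I : AddSubgroup A}

/-- The matrices of determinant `1`, congruent to `1` modulo the radical, whose part of trace zero
has its diagonal entries in `I`. -/
def unipotentSet (D : GMAData A B C) (φ : A →+* F) (I : AddSubgroup A) : Set (GMA D) :=
  {x | x.det = 1 ∧ φ x.a = 1 ∧ φ x.d = 1 ∧ Ring.inverse 2 * (x.a - x.d) ∈ I}

/-- With α the half-trace and k half the difference of the diagonal entries, the k of a product is
αk' + α'k + ½(bc' − b'c). So it suffices that αI ⊆ I. Now α² = 1 + k² + bc preserves I, using I³ ⊆ I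
and (bc)i = b(ic), and α is a limit of powers of α². -/
lemma isSpecialGroup_unipotentSet (hφ : IsResidueMap p φ) (hp : p ≠ 2)
    (hI : IsFullDatum p D φ I) : IsSpecialGroup (unipotentSet D φ I) := by
  have h2 := hφ.inverse_two_mul_two hp
  have hF2 : (2 : F) ≠ 0 := by
    have := hφ.isUnit_iff.mp (hφ.isUnit_two hp); rwa [map_ofNat] at this
  have hhalf : ∀ y ∈ I, Ring.inverse 2 * y ∈ I := fun y hy =>
    hφ.inverse_two_smul_mem (X := A) hp hI.isClosed hy
  have hαI : ∀ x ∈ unipotentSet D φ I, ∀ i ∈ I, Ring.inverse 2 * (x.a + x.d) * i ∈ I := by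
    rintro x ⟨h1, ha, hd, hx⟩ i hi
    set α := Ring.inverse 2 * (x.a + x.d) with hα
    set k := Ring.inverse 2 * (x.a - x.d) with hk
    have hα2 : α ^ 2 = 1 + k * k + D.m x.b x.c := by
      rw [det] at h1
      linear_combination (-(Ring.inverse 2 * 2 + 1) * x.a * x.d) * (-h2) + h1
    have hφα : φ α = 1 := by
      have h := congrArg φ h2
      rw [map_mul, map_ofNat, map_one] at h
      rw [hα, map_mul, map_add, ha, hd, one_add_one_eq_two, h]
    refine hφ.mem_of_sq_mem hp (T := {α | ∀ i ∈ I, α * i ∈ I}) ?_ hφα ?_ i hi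
    · have : {α | ∀ i ∈ I, α * i ∈ I} = ⋂ i ∈ I, (fun α => α * i) ⁻¹' (I : Set A) := by
        ext; simp
      rw [this]
      exact isClosed_biInter fun i _ => hI.isClosed.preimage (by fun_prop)
    · intro n
      induction n with
      | zero => intro i hi; simpa using hi
      | succ n ih =>
        intro i hi
        have : (α ^ 2) ^ (n + 1) * i = (α ^ 2) ^ n * (i + k * k * i + D.m x.b (i • x.c)) := by
          rw [pow_succ, map_smul, smul_eq_mul, hα2]; ring
        rw [this]
        exact ih _ (I.add_mem (I.add_mem hi (hI.cube_mem k hx k hx i hi)) (hI.m_mem _ _))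
  refine ⟨?_, ?_, fun x hx => hx.1⟩
  · intro x hx y hy
    refine ⟨by rw [det_mul, hx.1, hy.1, one_mul], ?_, ?_, ?_⟩
    · simp [hx.2.1, hy.2.1, hI.map_eq_zero _ (hI.m_mem _ _)]
    · simp [hx.2.2.1, hy.2.2.1, hI.map_eq_zero _ (hI.m_mem _ _)]
    · have h3 := hαI x hx _ hy.2.2.2
      have h4 := hαI y hy _ hx.2.2.2
      have h5 := hhalf _ (I.sub_mem (hI.m_mem x.b y.c) (hI.m_mem y.b x.c))
      convert I.add_mem (I.add_mem h3 h4) h5 using 1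
      rw [mul_a, mul_d]
      linear_combination (-Ring.inverse 2 * (x.a * y.a - x.d * y.d)) * h2
  · rintro x ⟨h1, ha, hd, hx⟩
    refine ⟨by rw [← h1]; simp [det, adj, mul_comm], hd, ha, ?_⟩
    convert I.neg_mem hx using 1
    simp only [adj]; ring

end converse

open Filter Topology Pointwise GMA

/-! ### The ambient matrix group and the Lie algebras of its subgroups -/

section converse

variable {p : ℕ} [Fact p.Prime] {F : Type uF} [Field F] [Finite F] [CharP F p]
  {A : Type uA} {B : Type uB} {C : Type uC} [CommRing A] [AddCommGroup B]
  [Module A B] [AddCommGroup C] [Module A C] {D : GMAData A B C}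
  [Algebra (WittVector p F) A] [IsLocalRing A] {φ : A →+* F}
  [TopologicalSpace A] [IsTopologicalRing A] [CompactSpace A] [T2Space A]
  {I : AddSubgroup A}

lemma const_mul_const_inv (x : Fˣ) : const p A (x : F) * const p A ((x⁻¹ : Fˣ) : F) = 1 := by
  rw [← map_mul, ← Units.val_mul, mul_inv_cancel, Units.val_one, map_one]

lemma torus_conj (q : Fˣ × Fˣ) (u : GMA D) :
    (torus p F D q : GMA D) * u * ((torus p F D q)⁻¹ : (GMA D)ˣ) =
      conjLin D (const p A ((q.1 / q.2 : Fˣ) : F)) (const p A ((q.2 / q.1 : Fˣ) : F)) u := by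
  rw [← map_inv, coe_torus, coe_torus, Prod.fst_inv, Prod.snd_inv,
    diag_mul_mul_diag (const_mul_const_inv _) (const_mul_const_inv _), ← map_mul, ← map_mul,
    ← Units.val_mul, ← Units.val_mul, ← div_eq_mul_inv, mul_comm, ← div_eq_mul_inv]

lemma det_conjLin {s s' : A} (h : s * s' = 1) (u : GMA D) : (conjLin D s s' u).det = u.det := by
  simp only [det, conjLin_apply_a, conjLin_apply_b, conjLin_apply_c, conjLin_apply_d, map_smul,
    LinearMap.smul_apply, smul_eq_mul]
  linear_combination -D.m u.b u.c * h

lemma conjLin_mem_unipotentSet {s s' : A} (h : s * s' = 1) {u : GMA D}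
    (hu : u ∈ unipotentSet D φ I) : conjLin D s s' u ∈ unipotentSet D φ I :=
  ⟨(det_conjLin h u).trans hu.1, hu.2⟩

lemma torus_conj_mem (q : Fˣ × Fˣ) {u : GMA D} (hu : u ∈ unipotentSet D φ I) :
    (torus p F D q : GMA D) * u * ((torus p F D q)⁻¹ : (GMA D)ˣ) ∈ unipotentSet D φ I := by
  rw [torus_conj]
  refine conjLin_mem_unipotentSet ?_ hu
  rw [← inv_div q.1 q.2, const_mul_const_inv]

/-- The group of the products of an element of the torus and an element of `unipotentSet`. -/
def fullGroup (hφ : IsResidueMap p φ) (hp : p ≠ 2) (hI : IsFullDatum p D φ I) :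
    Subgroup (GMA D)ˣ where
  carrier := {r | ∃ q : Fˣ × Fˣ, ∃ u ∈ unipotentSet D φ I, (r : GMA D) = torus p F D q * u}
  one_mem' := ⟨1, 1, by
    simp [unipotentSet, det_one, I.zero_mem], by simp⟩
  mul_mem' := by
    rintro r r' ⟨q, u, hu, h⟩ ⟨q', u', hu', h'⟩
    refine ⟨q * q', _, (isSpecialGroup_unipotentSet hφ hp hI).mul_mem _
      (torus_conj_mem q'⁻¹ hu) _ hu', ?_⟩
    rw [Units.val_mul, h, h', map_mul, map_inv, inv_inv, Units.val_mul]
    simp only [mul_assoc, Units.mul_inv_cancel_left]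
  inv_mem' := by
    rintro r ⟨q, u, hu, h⟩
    have hu' := (isSpecialGroup_unipotentSet hφ hp hI).adj_mem u hu
    refine ⟨q⁻¹, _, torus_conj_mem q hu', ?_⟩
    refine (Units.eq_inv_of_mul_eq_one_left ?_).symm
    rw [h, map_inv]
    simp only [mul_assoc, Units.inv_mul_cancel_left]
    rw [← mul_assoc u, mul_adj, hu.1, one_smul, one_mul, Units.mul_inv]

lemma mem_fullGroup {hφ : IsResidueMap p φ} {hp : p ≠ 2} {hI : IsFullDatum p D φ I}
    {r : (GMA D)ˣ} : r ∈ fullGroup hφ hp hI ↔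
      ∃ q : Fˣ × Fˣ, ∃ u ∈ unipotentSet D φ I, (r : GMA D) = torus p F D q * u := Iff.rfl

lemma map_diag_of_mem (hφ : IsResidueMap p φ) {r : GMA D} {q : Fˣ × Fˣ} {u : GMA D}
    (hu : u ∈ unipotentSet D φ I) (h : r = torus p F D q * u) :
    φ r.a = q.1 ∧ φ r.d = q.2 ∧ r.det = const p A ((q.1 * q.2 : Fˣ) : F) := by
  subst h
  refine ⟨by simp [hφ.const_eq, hu.2.1], by simp [hφ.const_eq, hu.2.2.1], ?_⟩
  rw [det_mul, hu.1]
  simp [det]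

lemma mem_unipotentSet_of_map_eq_one {hφ : IsResidueMap p φ} {hp : p ≠ 2}
    {hI : IsFullDatum p D φ I} {r : (GMA D)ˣ} (hr : r ∈ fullGroup hφ hp hI)
    (ha : φ (r : GMA D).a = 1) (hd : φ (r : GMA D).d = 1) :
    (r : GMA D) ∈ unipotentSet D φ I := by
  obtain ⟨q, u, hu, h⟩ := hr
  obtain ⟨h1, h2, -⟩ := map_diag_of_mem hφ hu h
  have : q = 1 := Prod.ext (Units.ext (h1.symm.trans ha)) (Units.ext (h2.symm.trans hd))
  rw [h, this, map_one, Units.val_one, one_mul]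
  exact hu

/-- The matrices of trace zero with diagonal entries in `I`. -/
def traceZero (D : GMAData A B C) (I : AddSubgroup A) : AddSubgroup (GMA D) where
  carrier := {u | u.trace = 0 ∧ u.a ∈ I}
  add_mem' := fun {u v} hu hv => ⟨by rw [trace_add, hu.1, hv.1, add_zero], I.add_mem hu.2 hv.2⟩
  zero_mem' := ⟨trace_zero, I.zero_mem⟩
  neg_mem' := fun {u} hu => ⟨by rw [trace_neg, hu.1, neg_zero], I.neg_mem hu.2⟩

lemma theta_mem_traceZero (hφ : IsResidueMap p φ) (hp : p ≠ 2) {u : GMA D}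
    (hu : u ∈ unipotentSet D φ I) : theta u ∈ traceZero D I := by
  have h2 := hφ.inverse_two_mul_two hp
  exact ⟨trace_theta h2 u, by rw [theta_a h2]; exact hu.2.2.2⟩

lemma coe_traceZero : (traceZero D I : Set (GMA D)) = matZero D I Set.univ Set.univ := by
  ext u
  constructor
  · rintro ⟨h1, h2⟩
    refine ⟨h2, trivial, trivial, ?_, h1⟩
    rw [trace] at h1
    rw [(neg_eq_of_add_eq_zero_right h1).symm]
    exact I.neg_mem h2
  · rintro ⟨h1, -, -, -, h2⟩
    exact ⟨h2, h1⟩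

/-- Every element of `traceZero` is `Θ(γ)` for some `γ` of determinant `1`. -/
lemma exists_theta_eq (hφ : IsResidueMap p φ) (hp : p ≠ 2) (hI : IsFullDatum p D φ I) {u : GMA D}
    (hu : u ∈ traceZero D I) :
    ∃ γ : (GMA D)ˣ, (γ : GMA D) ∈ unipotentSet D φ I ∧ theta (γ : GMA D) = u := by
  have h2 := hφ.inverse_two_mul_two hp
  have hud : u.d = -u.a := (neg_eq_of_add_eq_zero_right hu.1).symm
  have hua := hI.map_eq_zero _ hu.2
  -- α is the scalar for which α + u has determinant α² − u.a² − bc = 1; Θ discards it.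
  obtain ⟨α, hα, hα2⟩ := hφ.exists_sq_eq hp (v := 1 + u.a ^ 2 + D.m u.b u.c) (by
    simp [hua, hI.map_eq_zero _ (hI.m_mem _ _)])
  have hdet : (α • 1 + u : GMA D).det = 1 := by
    simp only [det, add_a, add_b, add_c, add_d, smul_a, smul_b, smul_c, smul_d, one_a, one_b,
      one_c, one_d, smul_zero, zero_add, hud]
    linear_combination hα2
  obtain ⟨γ, hγ⟩ := isUnit_of_isUnit_det (x := α • 1 + u) (by rw [hdet]; exact isUnit_one)
  refine ⟨γ, ⟨by rw [hγ, hdet], ?_, ?_, ?_⟩, ?_⟩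
  · simp [hγ, hα, hua]
  · simp [hγ, hα, hud, hua]
  · rw [hγ]
    convert hu.2 using 1
    simp only [add_a, add_d, smul_a, smul_d, one_a, one_d, hud]
    linear_combination u.a * h2
  · rw [hγ, theta_add, theta_smul, theta_one h2, smul_zero, zero_add, theta, hu.1, mul_zero,
      zero_smul, sub_zero]

/-- A = W + I + I², so stability under constants and under I is enough. -/
lemma IsFullDatum.smul_mem (hφ : IsResidueMap p φ) (hI : IsFullDatum p D φ I) {X : Type*}
    [AddCommGroup X] [Module A X] [TopologicalSpace X] [ContinuousSMul A X] [ContinuousAdd X]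
    (M : AddSubgroup X) (hM : IsClosed (M : Set X)) (h1 : ∀ x : F, ∀ y ∈ M, const p A x • y ∈ M)
    (h2 : ∀ i ∈ I, ∀ y ∈ M, i • y ∈ M) (a : A) (y : X) (hy : y ∈ M) : a • y ∈ M := by
  obtain ⟨w, hw, i, hi, j, hj, rfl⟩ := hI.exists_eq a
  rw [add_smul, add_smul]
  refine M.add_mem (M.add_mem (hφ.smul_mem_of_const hM (fun x _ => h1 x) hw hy) (h2 i hi y hy))
    (smul_mem_of_mem_closedProd hM (fun s hs t ht => ?_) hj)
  rw [mul_smul]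
  exact h2 s hs _ (h2 t ht y hy)

section topology

variable [TopologicalSpace B] [TopologicalSpace C]
  [ContinuousAdd B] [ContinuousAdd C] [ContinuousSMul A B] [ContinuousSMul A C]
  [T2Space B] [T2Space C]

lemma isClosed_traceZero (hI : IsClosed (I : Set A)) :
    IsClosed (traceZero D I : Set (GMA D)) :=
  (isClosed_singleton.preimage continuous_trace).inter (hI.preimage continuous_a)

lemma isClosed_unipotentSet (hφ : IsResidueMap p φ) (hm : Continuous fun q : B × C => D.m q.1 q.2)
    (hI : IsClosed (I : Set A)) : IsClosed (unipotentSet D φ I) := by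
  have hdet : Continuous (det : GMA D → A) := by
    have h1 : Continuous fun x : GMA D => D.m x.b x.c := hm.comp (continuous_b.prodMk continuous_c)
    change Continuous fun x : GMA D => x.a * x.d - D.m x.b x.c
    fun_prop
  have hcl := hφ.isClosed_fiber 1
  exact (isClosed_singleton.preimage hdet).inter ((hcl.preimage continuous_a).inter
    ((hcl.preimage continuous_d).inter (hI.preimage (by fun_prop))))

lemma isClosed_fullGroup [ContinuousMul (GMA D)] (hφ : IsResidueMap p φ) (hp : p ≠ 2)
    (hI : IsFullDatum p D φ I) (hm : Continuous fun q : B × C => D.m q.1 q.2) :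
    IsClosed (fullGroup hφ hp hI : Set (GMA D)ˣ) := by
  have : (fullGroup hφ hp hI : Set (GMA D)ˣ) = ⋃ q : Fˣ × Fˣ,
      (fun r : (GMA D)ˣ => ((torus p F D q)⁻¹ : (GMA D)ˣ) * (r : GMA D)) ⁻¹'
        unipotentSet D φ I := by
    ext r
    simp only [SetLike.mem_coe, mem_fullGroup, Set.mem_iUnion, Set.mem_preimage]
    refine exists_congr fun q => ⟨?_, fun h => ⟨_, h, (Units.mul_inv_cancel_left _ _).symm⟩⟩
    rintro ⟨u, hu, h⟩
    rwa [h, Units.inv_mul_cancel_left]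
  rw [this]
  exact isClosed_iUnion_of_finite fun q => (isClosed_unipotentSet hφ hm hI.isClosed).preimage
    (continuous_const.mul Units.continuous_val)

/-- The Lie algebra of a closed subgroup of `fullGroup` with enough elements. -/
lemma pinkLie_subtype_eq [ContinuousMul (GMA D)] (hφ : IsResidueMap p φ) (hp : p ≠ 2)
    (hI : IsFullDatum p D φ I) {S : Set A}
    (hS : ∀ M : AddSubgroup A, IsClosed (M : Set A) →
      (∀ x : F, ∀ y ∈ M, const p A x * y ∈ M) → S ⊆ M →
      (∀ s ∈ S, ∀ s' ∈ S, ∀ y ∈ M, s * s' * y ∈ M) → I ≤ M)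
    {SB : Set B} (hSB : Submodule.span A SB = ⊤) {SC : Set C} (hSC : Submodule.span A SC = ⊤)
    {G : Subgroup (GMA D)ˣ} (hG : G ≤ fullGroup hφ hp hI) (hT : ∀ q, torus p F D q ∈ G)
    (hGI : ∀ x : F, ∀ s ∈ S, ∃ γ ∈ G, (γ : GMA D) ∈ unipotentSet D φ I ∧
      theta (γ : GMA D) = diagZero D (const p A x * s))
    (hGB : ∀ b ∈ SB, ∃ γ ∈ G, (γ : GMA D) ∈ unipotentSet D φ I ∧ theta (γ : GMA D) = upper D b)
    (hGC : ∀ c ∈ SC, ∃ γ ∈ G, (γ : GMA D) ∈ unipotentSet D φ I ∧ theta (γ : GMA D) = lower D c) :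
    pinkLie G.subtype = traceZero D I := by
  have hBC : ∀ b c, φ (D.m b c) = 0 := fun b c => hI.map_eq_zero _ (hI.m_mem b c)
  have hmem : ∀ x : GMA D, x - 1 ∈ Ring.jacobson (GMA D) ↔ φ x.a = 1 ∧ φ x.d = 1 := fun x => by
    rw [mem_jacobson_iff hφ hBC, sub_a, sub_d, map_sub, map_sub, one_a, one_d, map_one,
      sub_eq_zero, sub_eq_zero]
  have hsub : pinkGroup G.subtype ⊆ unipotentSet D φ I := by
    rintro _ ⟨⟨g, rfl⟩, -, h2⟩
    rw [hmem] at h2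
    exact mem_unipotentSet_of_map_eq_one (hG g.2) h2.1 h2.2
  set L := (AddSubgroup.closure (theta '' pinkGroup G.subtype)).topologicalClosure with hL
  have hLcl : IsClosed (L : Set (GMA D)) := AddSubgroup.isClosed_topologicalClosure _
  have hLP : IsPinkStable L :=
    isPinkStable_topologicalClosure hφ hp (isSpecialGroup_pinkGroup hφ hBC _)
  have hmemL : ∀ u, (∃ γ ∈ G, (γ : GMA D) ∈ unipotentSet D φ I ∧ theta (γ : GMA D) = u) →
      u ∈ L := by
    rintro _ ⟨γ, hγ, h, rfl⟩
    exact subset_closure (AddSubgroup.subset_closure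
      ⟨γ, ⟨⟨⟨γ, hγ⟩, rfl⟩, h.1, (hmem _).mpr ⟨h.2.1, h.2.2.1⟩⟩, rfl⟩)
  -- Torus conjugation scales b by s(x) and c by s(x)⁻¹, which makes the off-diagonal parts of L
  -- stable under constants.
  have hconj : ∀ x : Fˣ, ∀ u ∈ L,
      conjLin D (const p A (x : F)) (const p A ((x⁻¹ : Fˣ) : F)) u ∈ L := by
    intro x u hu
    have hspec : ∀ y ∈ pinkGroup G.subtype,
        conjLin D (const p A (x : F)) (const p A ((x⁻¹ : Fˣ) : F)) y ∈ pinkGroup G.subtype := by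
      rintro y hy
      obtain ⟨h1, h2, h3, -⟩ := conjLin_mem_unipotentSet (const_mul_const_inv x) (hsub hy)
      obtain ⟨⟨g, rfl⟩, -, -⟩ := hy
      refine ⟨⟨⟨_, G.mul_mem (G.mul_mem (hT (x, 1)) g.2) (G.inv_mem (hT (x, 1)))⟩, ?_⟩, h1,
        (hmem _).mpr ⟨h2, h3⟩⟩
      rw [Subgroup.coe_subtype, Units.val_mul, Units.val_mul, torus_conj, div_one, one_div]
    exact conjLin_mem_topologicalClosure hspec hu
  have hI_le : ∀ i ∈ I, diagZero D i ∈ L := by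
    have hc : Continuous (diagZero D) := by
      apply continuous_of_entries <;> simp only [diagZero_apply_a, diagZero_apply_b,
        diagZero_apply_c, diagZero_apply_d] <;> fun_prop
    -- The torus acts trivially on the diagonal, so stability under constants is built into M, at
    -- the price of requiring every s(x)s to be realized by the group.
    let M : AddSubgroup A :=
      { carrier := {y | ∀ x : F, diagZero D (const p A x * y) ∈ L}
        add_mem' := fun {y z} hy hz x => by
          rw [mul_add, map_add]; exact L.add_mem (hy x) (hz x)
        zero_mem' := fun x => by rw [mul_zero, map_zero]; exact L.zero_mem
        neg_mem' := fun {y} hy x => by rw [mul_neg, map_neg]; exact L.neg_mem (hy x) }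
    have hle : I ≤ M := by
      refine hS M ?_ (fun x y hy z => ?_) (fun s hs x => hmemL _ (hGI x s hs))
        (fun s hs s' hs' y hy x => ?_)
      · have : (M : Set A) = ⋂ x : F, (fun y => diagZero D (const p A x * y)) ⁻¹' (L : Set _) := by
          ext y; simp [M]
        rw [this]
        exact isClosed_iInter fun x => hLcl.preimage (hc.comp (by fun_prop))
      · rw [← mul_assoc, ← map_mul]
        exact hy _
      · have h1 := hmemL _ (hGI 1 s hs)
        have h2 := hmemL _ (hGI 1 s' hs')
        rw [map_one, one_mul] at h1 h2
        rw [mul_left_comm]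
        exact hLP.mul_mul_mem hφ hp hLcl h1 h2 (hy x)
    exact fun i hi => by simpa using hle hi 1
  have hup : ∀ b, upper D b ∈ L := by
    have hc : Continuous (upper D) := by
      apply continuous_of_entries <;> simp only [upper_apply_a, upper_apply_b,
        upper_apply_c, upper_apply_d] <;> fun_prop
    let M := L.comap (upper D).toAddMonoidHom
    have := hI.smul_mem hφ M (hLcl.preimage hc) (fun x y hy => ?_)
      (fun i hi y hy => hLP.smul_upper_mem hφ hp hLcl (hI_le i hi) hy)
    · intro b
      have hb : b ∈ Submodule.span A SB := hSB ▸ Submodule.mem_top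
      induction hb using Submodule.span_induction with
      | mem b hb => exact hmemL _ (hGB b hb)
      | zero => exact M.zero_mem
      | add b b' _ _ h1 h2 => exact M.add_mem h1 h2
      | smul a b _ h => exact this a b h
    · rcases eq_or_ne x 0 with rfl | hx
      · rw [const_zero, zero_smul]; exact M.zero_mem
      · change upper D (const p A x • y) ∈ L
        convert hconj (Units.mk0 x hx) _ hy using 1
        ext <;> simp
  have hlow : ∀ c, lower D c ∈ L := by
    have hc : Continuous (lower D) := by
      apply continuous_of_entries <;> simp only [lower_apply_a, lower_apply_b,
        lower_apply_c, lower_apply_d] <;> fun_prop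
    let M := L.comap (lower D).toAddMonoidHom
    have := hI.smul_mem hφ M (hLcl.preimage hc) (fun x y hy => ?_)
      (fun i hi y hy => hLP.smul_lower_mem hφ hp hLcl (hI_le i hi) hy)
    · intro b
      have hb : b ∈ Submodule.span A SC := hSC ▸ Submodule.mem_top
      induction hb using Submodule.span_induction with
      | mem b hb => exact hmemL _ (hGC b hb)
      | zero => exact M.zero_mem
      | add b b' _ _ h1 h2 => exact M.add_mem h1 h2
      | smul a b _ h => exact this a b h
    · rcases eq_or_ne x 0 with rfl | hx
      · rw [const_zero, zero_smul]; exact M.zero_mem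
      · change lower D (const p A x • y) ∈ L
        convert hconj (Units.mk0 x hx)⁻¹ _ hy using 1
        ext <;> simp
  refine Set.Subset.antisymm (closure_minimal ?_ (isClosed_traceZero hI.isClosed)) fun u hu => ?_
  · rw [SetLike.coe_subset_coe, AddSubgroup.closure_le]
    rintro _ ⟨x, hx, rfl⟩
    exact theta_mem_traceZero hφ hp (hsub hx)
  · rw [eq_diagZero_add_upper_add_lower hu.1]
    exact L.add_mem (L.add_mem (hI_le _ hu.2) (hup _)) (hlow _)

end topology

end converse

/-! ### Profiniteness, p-finiteness and the residual representation -/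

open Filter Topology Pointwise GMA

/-- A topologically finitely generated profinite group satisfies the condition of `p`-finiteness. -/
lemma pFinite_of_dense_closure (p : ℕ) {P : Type*} [Group P] [TopologicalSpace P]
    [IsTopologicalGroup P] [CompactSpace P] {S : Set P} (hS : S.Finite)
    (hd : Dense (Subgroup.closure S : Set P)) : PFinite p P := by
  intro H hH
  set Δ := Subgroup.closure S with hΔ
  have := hS.to_subtype
  have hΔfg : Group.FG Δ := Group.closure_finite_fg S
  have hfin : Finite (P ⧸ H) := H.quotient_finite_of_isOpen hH
  have hHfi : H.FiniteIndex := Subgroup.finiteIndex_of_finite_quotient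
  -- Schreier: a finite-index subgroup of a finitely generated group is finitely generated. It is
  -- dense in H because H is open.
  have hfg : Group.FG (H.subgroupOf Δ) := (H.subgroupOf Δ).fg_of_index_ne_zero
  obtain ⟨T, hT, hTf⟩ := Group.fg_iff.mp hfg
  let f : H.subgroupOf Δ →* H :=
    { toFun := fun k => ⟨k, k.2⟩
      map_one' := rfl
      map_mul' := fun _ _ => rfl }
  have hfd : DenseRange f := by
    intro h
    rw [mem_closure_iff]
    intro U hU hhU
    obtain ⟨V, hV, rfl⟩ := isOpen_induced_iff.mp hU
    obtain ⟨g, ⟨hgV, hgH⟩, hgΔ⟩ := hd.inter_open_nonempty (V ∩ H) (hV.inter hH) ⟨h, hhU, h.2⟩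
    exact ⟨⟨g, hgH⟩, hgV, ⟨⟨⟨g, hgΔ⟩, hgH⟩, rfl⟩⟩
  refine ⟨(fun k => (f k : H ⧸ proPKernel p H)) '' T, hTf.image _, ?_⟩
  have hdr : DenseRange fun k => (f k : H ⧸ proPKernel p H) :=
    (QuotientGroup.mk_surjective (s := proPKernel p H)).denseRange.comp hfd
      continuous_quotient_mk'
  refine hdr.mono ?_
  rintro _ ⟨k, rfl⟩
  have hk : k ∈ Subgroup.closure T := hT ▸ Subgroup.mem_top k
  have h := Subgroup.mem_map_of_mem ((QuotientGroup.mk' (proPKernel p H)).comp f) hk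
  rw [MonoidHom.map_closure] at h
  exact h

/-- The powers of J are clopen subgroups with intersection 0, and their cosets separate points. -/
lemma totallyDisconnectedSpace_of_topNil {A : Type*} [CommRing A] [TopologicalSpace A]
    [IsTopologicalRing A] [T1Space A] {J : Ideal A} (hJ : TopNil J)
    (ho : ∀ n, IsOpen ((J ^ n : Ideal A) : Set A)) : TotallyDisconnectedSpace A := by
  suffices TotallySeparatedSpace A from inferInstance
  refine totallySeparatedSpace_iff_exists_isClopen.mpr fun x y hxy => ?_
  obtain ⟨n, hn⟩ := hJ {y - x}ᶜ (isOpen_compl_singleton.mem_nhds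
    (by simpa using (sub_ne_zero.mpr hxy.symm).symm))
  have hclopen : IsClopen ((J ^ n : Ideal A) : Set A) :=
    ⟨AddSubgroup.isClosed_of_isOpen (J ^ n).toAddSubgroup (ho n), ho n⟩
  refine ⟨(fun z => z - x) ⁻¹' ((J ^ n : Ideal A) : Set A), hclopen.preimage (by fun_prop),
    by simp, fun h => hn h rfl⟩

section converse

variable {p : ℕ} [Fact p.Prime] {F : Type uF} [Field F] [Finite F] [CharP F p]
  {A : Type uA} {B : Type uB} {C : Type uC} [CommRing A] [AddCommGroup B]
  [Module A B] [AddCommGroup C] [Module A C] {D : GMAData A B C}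
  [Algebra (WittVector p F) A] [IsLocalRing A] {φ : A →+* F}

/-- The entries of a faithful generalized matrix algebra are determined by elements of `A`. -/
lemma totallyDisconnectedSpace_units [TopologicalSpace A] [TopologicalSpace B] [TopologicalSpace C]
    [TotallyDisconnectedSpace A] (hD : D.Faithful)
    (hmB : ∀ c, Continuous fun b => D.m b c) (hmC : ∀ b, Continuous (D.m b)) :
    TotallyDisconnectedSpace (GMA D)ˣ := by
  let f : (GMA D)ˣ → A × (C → A) × (B → A) × A := fun r =>
    ((r : GMA D).a, fun c => D.m (r : GMA D).b c, fun b => D.m b (r : GMA D).c, (r : GMA D).d)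
  have hf : Continuous f := by
    refine (continuous_a.comp Units.continuous_val).prodMk (Continuous.prodMk ?_
      (Continuous.prodMk ?_ (continuous_d.comp Units.continuous_val)))
    · exact continuous_pi fun c => (hmB c).comp (continuous_b.comp Units.continuous_val)
    · exact continuous_pi fun b => (hmC b).comp (continuous_c.comp Units.continuous_val)
  have hinj : Function.Injective f := by
    intro r s h
    simp only [f, Prod.mk.injEq] at h
    obtain ⟨h1, h2, h3, h4⟩ := h
    refine Units.ext (GMA.ext h1 ?_ ?_ h4)
    · refine sub_eq_zero.mp (faithful_left hD fun c => ?_)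
      rw [map_sub, LinearMap.sub_apply, congrFun h2 c, sub_self]
    · refine sub_eq_zero.mp (faithful_right hD fun b => ?_)
      rw [map_sub, congrFun h3 b, sub_self]
  exact ⟨isTotallyDisconnected_of_image hf.continuousOn hinj
    (isTotallyDisconnected_of_totallyDisconnectedSpace _)⟩

/-! ### The residual representation -/

/-- The diagonal entry `a` modulo the maximal ideal. -/
@[simps] def residueA (D : GMAData A B C) (φ : A →+* F) (hBC : ∀ b c, φ (D.m b c) = 0) :
    GMA D →* F where
  toFun x := φ x.a
  map_one' := by simp
  map_mul' x y := by simp [hBC]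

/-- The diagonal entry `d` modulo the maximal ideal. -/
@[simps] def residueD (D : GMAData A B C) (φ : A →+* F) (hBC : ∀ b c, φ (D.m b c) = 0) :
    GMA D →* F where
  toFun x := φ x.d
  map_one' := by simp
  map_mul' x y := by simp [hBC]

/-- The diagonal matrices of `GL₂(F)`. -/
def diagGL (F : Type*) [Field F] : Fˣ × Fˣ →* GL (Fin 2) F :=
  MonoidHom.toHomUnits
    { toFun := fun q => !![(q.1 : F), 0; 0, (q.2 : F)]
      map_one' := by simp [Matrix.one_fin_two]
      map_mul' := fun q r => by simp }

@[simp] lemma coe_diagGL (q : Fˣ × Fˣ) :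
    (diagGL F q : Matrix (Fin 2) (Fin 2) F) = !![(q.1 : F), 0; 0, (q.2 : F)] := rfl

/-- The pair of the residues of the diagonal entries. -/
def residuePair (D : GMAData A B C) (φ : A →+* F) (hBC : ∀ b c, φ (D.m b c) = 0) :
    (GMA D)ˣ →* Fˣ × Fˣ :=
  (Units.map (residueA D φ hBC)).prod (Units.map (residueD D φ hBC))

lemma residuePair_torus (hφ : IsResidueMap p φ) (hBC : ∀ b c, φ (D.m b c) = 0) (q : Fˣ × Fˣ) :
    residuePair D φ hBC (torus p F D q) = q :=
  Prod.ext (Units.ext (hφ.const_eq _)) (Units.ext (hφ.const_eq _))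

/-- The projective image of the diagonal representation attached to a surjection onto
`Fˣ × Fˣ` is isomorphic to `Fˣ`. -/
lemma exists_projImage_equiv {P : Type*} [Group P] {f : P →* Fˣ × Fˣ}
    (hf : Function.Surjective f) : Nonempty (Fˣ ≃* projImage ((diagGL F).comp f)) := by
  -- x ↦ the class of diag(x, 1) is injective, and diag(a, d) is diag(a/d, 1) times a scalar.
  let g : Fˣ →* PGL(2, F) :=
    (Matrix.ProjGenLinGroup.mk.comp (diagGL F)).comp (MonoidHom.inl Fˣ Fˣ)
  have hone : ∀ q : Fˣ × Fˣ, Matrix.ProjGenLinGroup.mk (diagGL F q) = 1 ↔ q.1 = q.2 := by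
    intro q
    rw [Matrix.ProjGenLinGroup.mk_eq_one, Subgroup.mem_center_iff]
    constructor
    · intro h
      have h1 := h (Matrix.GeneralLinearGroup.mkOfDetNeZero !![1, 1; 0, 1] (by simp))
      have h2 := congrArg (fun g : GL (Fin 2) F => (g : Matrix (Fin 2) (Fin 2) F) 0 1) h1
      simp only [Units.val_mul, coe_diagGL, Matrix.GeneralLinearGroup.mkOfDetNeZero] at h2
      exact Units.ext (by simpa [Matrix.mul_apply] using h2.symm)
    · intro h g
      apply Units.ext
      have : !![(q.1 : F), 0; 0, (q.2 : F)] = (q.1 : F) • (1 : Matrix (Fin 2) (Fin 2) F) := by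
        ext i j; fin_cases i <;> fin_cases j <;> simp [h]
      simp [this]
  have hg : Function.Injective g := by
    rw [injective_iff_map_eq_one]
    intro x hx
    exact (hone (x, 1)).mp hx
  have hr : projImage ((diagGL F).comp f) = g.range := by
    ext z
    constructor
    · rintro ⟨_, ⟨x, rfl⟩, rfl⟩
      refine ⟨(f x).1 / (f x).2, ?_⟩
      have : f x = ((f x).1 / (f x).2, 1) * ((f x).2, (f x).2) := by ext <;> simp
      change _ = Matrix.ProjGenLinGroup.mk (diagGL F (f x))
      rw [this, map_mul, map_mul, (hone ((f x).2, (f x).2)).mpr rfl, mul_one]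
      simp [g]
    · rintro ⟨x, rfl⟩
      obtain ⟨y, hy⟩ := hf (x, 1)
      exact ⟨_, ⟨y, rfl⟩, by simp [g, hy]⟩
  rw [hr]
  exact ⟨MonoidHom.ofInjective hg⟩

end converse

open Filter Topology Pointwise GMA

/-! ### Admissibility of the constructed pseudo-deformation -/

section converse

variable {p : ℕ} [Fact p.Prime] {F : Type uF} [Field F] [Finite F] [CharP F p]
  {A : Type uA} {B : Type uB} {C : Type uC} [CommRing A] [AddCommGroup B]
  [Module A B] [AddCommGroup C] [Module A C] {D : GMAData A B C}
  [Algebra (WittVector p F) A] [IsLocalRing A] {φ : A →+* F}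
  [TopologicalSpace A] [IsTopologicalRing A] [CompactSpace A] [T2Space A]
  {I : AddSubgroup A}

/-- det(y) y⁻¹ = adj y, so the identity is the trace of x(y + adj y) = tr(y) x. -/
lemma isPseudoRep_trace_det (G : Subgroup (GMA D)ˣ) :
    IsPseudoRep (fun g : G => ((g : (GMA D)ˣ) : GMA D).trace)
      ((Units.map (detHom D)).comp G.subtype) := by
  refine ⟨fun x y => trace_mul_comm _ _, trace_one, fun x y => ?_⟩
  have h : ((y : (GMA D)ˣ) : GMA D).det • ((y⁻¹ : (GMA D)ˣ) : GMA D) =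
      adj ((y : (GMA D)ˣ) : GMA D) := by
    have h1 := adj_mul ((y : (GMA D)ˣ) : GMA D)
    have h2 := congrArg (· * ((y⁻¹ : (GMA D)ˣ) : GMA D)) h1
    simp only [mul_assoc, Units.mul_inv, mul_one, smul_mul_assoc, one_mul] at h2
    exact h2.symm
  change ((x : (GMA D)ˣ) * (y : (GMA D)ˣ) : GMA D).trace + ((y : (GMA D)ˣ) : GMA D).det *
    (((x : (GMA D)ˣ) : GMA D) * ((y⁻¹ : (GMA D)ˣ) : GMA D)).trace = _
  rw [← trace_smul, ← mul_smul_comm, h, ← trace_add, ← mul_add, add_adj, mul_smul_comm, mul_one,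
    trace_smul, mul_comm]

/-- The constant `s(x) - 1` is invertible for some `x`. -/
lemma exists_const_sub_one (hφ : IsResidueMap p φ) (hF : 2 < Nat.card F) :
    ∃ x : Fˣ, x ≠ 1 ∧ ∃ w ∈ wittSubring p A (⊤ : Subfield F), w * (const p A (x : F) - 1) = 1 := by
  have : 1 < Nat.card Fˣ := by rw [Nat.card_units]; omega
  have : Nontrivial Fˣ := Finite.one_lt_card_iff_nontrivial.mp this
  obtain ⟨x, hx⟩ := exists_ne (1 : Fˣ)
  refine ⟨x, hx, hφ.exists_mul_eq_one
    (sub_mem (const_mem_wittSubring trivial) (one_mem _)) ?_⟩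
  rw [map_sub, map_one, hφ.const_eq, sub_ne_zero]
  exact fun h => hx (Units.ext h)

/-- diag(s(x), 1) − 1 is an invertible multiple of the idempotent e₁₁, so both diagonal idempotents
lie in the span, and the corners e₁₁γe₂₂ and e₂₂γe₁₁ isolate the off-diagonal entries. -/
lemma span_range_eq_top (hφ : IsResidueMap p φ) (hF : 2 < Nat.card F) {G : Subgroup (GMA D)ˣ}
    (hT : ∀ q, torus p F D q ∈ G) {SB : Set B} (hSB : Submodule.span A SB = ⊤) {SC : Set C}
    (hSC : Submodule.span A SC = ⊤) (hGB : ∀ b ∈ SB, ∃ γ ∈ G, (γ : GMA D).b = b)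
    (hGC : ∀ c ∈ SC, ∃ γ ∈ G, (γ : GMA D).c = c) :
    Submodule.span A (Set.range fun g : G => ((g : (GMA D)ˣ) : GMA D)) = ⊤ := by
  set N := Submodule.span A (Set.range fun g : G => ((g : (GMA D)ˣ) : GMA D)) with hN
  have hmul : ∀ x ∈ N, ∀ y ∈ N, x * y ∈ N := by
    let _ := GMA.algebra D
    have : N * N ≤ N := by
      rw [hN, Submodule.span_mul_span]
      refine Submodule.span_mono ?_
      rintro _ ⟨_, ⟨g, rfl⟩, _, ⟨h, rfl⟩, rfl⟩
      exact ⟨g * h, rfl⟩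
    exact fun x hx y hy => this (Submodule.mul_mem_mul hx hy)
  have hGN : ∀ γ ∈ G, (γ : GMA D) ∈ N := fun γ hγ => Submodule.subset_span ⟨⟨γ, hγ⟩, rfl⟩
  have h1 : (1 : GMA D) ∈ N := hGN 1 G.one_mem
  obtain ⟨x, -, w, -, hw⟩ := exists_const_sub_one (A := A) hφ hF
  have he : diag D (1 : A) 0 ∈ N := by
    convert N.smul_mem w (N.sub_mem (hGN _ (hT (x, 1))) h1) using 1
    ext <;> simp [hw]
  have hf : diag D (0 : A) 1 ∈ N := by
    convert N.sub_mem h1 he using 1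
    ext <;> simp
  have hB : ∀ b, upper D b ∈ N := fun b => by
    have hb : b ∈ Submodule.span A SB := hSB ▸ Submodule.mem_top
    induction hb using Submodule.span_induction with
    | mem b hb =>
      obtain ⟨γ, hγ, rfl⟩ := hGB b hb
      convert hmul _ (hmul _ he _ (hGN γ hγ)) _ hf using 1
      ext <;> simp
    | zero => rw [map_zero]; exact N.zero_mem
    | add b b' _ _ h1 h2 => rw [map_add]; exact N.add_mem h1 h2
    | smul a b _ h => rw [map_smul]; exact N.smul_mem a h
  have hC : ∀ c, lower D c ∈ N := fun c => by
    have hc : c ∈ Submodule.span A SC := hSC ▸ Submodule.mem_top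
    induction hc using Submodule.span_induction with
    | mem b hb =>
      obtain ⟨γ, hγ, rfl⟩ := hGC b hb
      convert hmul _ (hmul _ hf _ (hGN γ hγ)) _ he using 1
      ext <;> simp
    | zero => rw [map_zero]; exact N.zero_mem
    | add b b' _ _ h1 h2 => rw [map_add]; exact N.add_mem h1 h2
    | smul a b _ h => rw [map_smul]; exact N.smul_mem a h
  refine eq_top_iff.mpr fun u _ => ?_
  have : u = u.a • diag D 1 0 + u.d • diag D 0 1 + upper D u.b + lower D u.c := by
    ext <;> simp
  rw [this]
  exact N.add_mem (N.add_mem (N.add_mem (N.smul_mem _ he) (N.smul_mem _ hf)) (hB _)) (hC _)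

section topology

variable [TopologicalSpace B] [TopologicalSpace C]
  [ContinuousAdd B] [ContinuousAdd C] [ContinuousSMul A B] [ContinuousSMul A C]
  [T2Space B] [T2Space C]

/-- The traces of a group whose Lie algebra is `traceZero` generate `A`. -/
lemma dense_adjoin_trace (hφ : IsResidueMap p φ) (hp : p ≠ 2) (hF : 2 < Nat.card F)
    (hI : IsFullDatum p D φ I) {G : Subgroup (GMA D)ˣ} (hT : ∀ q, torus p F D q ∈ G)
    (hL : pinkLie G.subtype = traceZero D I) :
    Dense (Algebra.adjoin (WittVector p F)
      (Set.range fun g : G => ((g : (GMA D)ˣ) : GMA D).trace) : Set A) := by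
  have h2 := hφ.inverse_two_mul_two hp
  set S := Algebra.adjoin (WittVector p F)
      (Set.range fun g : G => ((g : (GMA D)ˣ) : GMA D).trace) with hS
  set T : Subring A := S.toSubring.topologicalClosure with hTdef
  have hTcl : IsClosed (T : Set A) := Subring.isClosed_topologicalClosure _
  have hST : ∀ a ∈ S, a ∈ T := fun a ha => Subring.le_topologicalClosure _ ha
  have hWT : ∀ w ∈ wittSubring p A (⊤ : Subfield F), w ∈ T := by
    rintro _ ⟨w, rfl⟩
    exact hST _ (S.algebraMap_mem _)
  have htr : ∀ γ ∈ G, (γ : GMA D).trace ∈ T := fun γ hγ =>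
    hST _ (Algebra.subset_adjoin ⟨⟨γ, hγ⟩, rfl⟩)
  obtain ⟨x, -, w, hw, hw1⟩ := exists_const_sub_one (A := A) hφ hF
  -- tr(diag(s(x), 1)γ) − tr γ = (s(x) − 1) γ.a, so traces determine the diagonal entries.
  have hent : ∀ γ ∈ G, (γ : GMA D).a ∈ T ∧ (γ : GMA D).d ∈ T := by
    intro γ hγ
    have h1 := htr _ (G.mul_mem (hT (x, 1)) hγ)
    have ha : (γ : GMA D).a ∈ T := by
      convert T.mul_mem (hWT w hw) (T.sub_mem h1 (htr γ hγ)) using 1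
      simp only [Units.val_mul, coe_torus, trace, mul_a, mul_d, diag_a, diag_b, diag_c, diag_d,
        map_zero, LinearMap.zero_apply, Units.val_one, map_one]
      linear_combination -(γ : GMA D).a * hw1
    refine ⟨ha, ?_⟩
    convert T.sub_mem (htr γ hγ) ha using 1
    simp [trace]
  have hLT : ∀ u ∈ pinkLie G.subtype, u.a ∈ T := by
    let M : AddSubgroup (GMA D) := T.toAddSubgroup.comap (aLin D).toAddMonoidHom
    have hM : IsClosed (M : Set (GMA D)) := hTcl.preimage continuous_a
    refine closure_minimal (t := (M : Set (GMA D))) ?_ hM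
    rw [SetLike.coe_subset_coe, AddSubgroup.closure_le]
    rintro _ ⟨_, ⟨⟨g, rfl⟩, -, -⟩, rfl⟩
    change (theta _).a ∈ T
    rw [theta_a h2]
    exact hφ.inverse_two_smul_mem (X := A) hp (M := T.toAddSubgroup) hTcl
      (T.sub_mem (hent g g.2).1 (hent g g.2).2)
  have hIT : ∀ i ∈ I, i ∈ T := fun i hi =>
    hLT (diagZero D i) (hL ▸ (show diagZero D i ∈ traceZero D I from ⟨by simp [trace], hi⟩))
  intro a
  obtain ⟨w, hw, i, hi, j, hj, rfl⟩ := hI.exists_eq a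
  exact T.add_mem (T.add_mem (hWT w hw) (hIT i hi))
    (closedProd_subset (N := T.toAddSubgroup) hTcl
      (fun s hs t ht => T.mul_mem (hIT s hs) (hIT t ht)) hj)

end topology

/-- The pseudo-representation of a group of matrices is admissible. -/
lemma isAdmissible_of [TopologicalSpace B] [TopologicalSpace C] [ContinuousMul (GMA D)]
    (hφ : IsResidueMap p φ) (hp : p ≠ 2) (hF : 2 < Nat.card F)
    (hI : IsFullDatum p D φ I) (hm : Continuous fun q : B × C => D.m q.1 q.2)
    (hBC : ∀ b c, φ (D.m b c) = 0)
    {G : Subgroup (GMA D)ˣ} [CompactSpace G] [TotallyDisconnectedSpace G]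
    (hG : G ≤ fullGroup hφ hp hI) (hT : ∀ q, torus p F D q ∈ G)
    (hfg : PFinite p G)
    (hd : Dense (Algebra.adjoin (WittVector p F)
      (Set.range fun g : G => ((g : (GMA D)ˣ) : GMA D).trace) : Set A)) :
    IsAdmissible p (ProfiniteGrp.of G)
      ((diagGL F).comp ((residuePair D φ hBC).comp G.subtype) : G →* GL (Fin 2) F)
      (fun g : G => ((g : (GMA D)ˣ) : GMA D).trace)
      ((Units.map (detHom D)).comp G.subtype : G →* Aˣ) := by
  have hval : Continuous fun g : G => ((g : (GMA D)ˣ) : GMA D) :=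
    Units.continuous_val.comp continuous_subtype_val
  have hdet : Continuous (detHom D) := by
    have h1 : Continuous fun x : GMA D => D.m x.b x.c := hm.comp (continuous_b.prodMk continuous_c)
    change Continuous fun x : GMA D => x.a * x.d - D.m x.b x.c
    fun_prop
  refine ⟨hfg, ?_, Or.inr ?_, isPseudoRep_trace_det G, ?_, ?_, fun g => ?_, fun g => ?_,
    fun g => ?_, hd⟩
  · have : (((diagGL F).comp ((residuePair D φ hBC).comp G.subtype)).ker : Set G) =
        {g : G | φ ((g : (GMA D)ˣ) : GMA D).a = 1} ∩ {g : G | φ ((g : (GMA D)ˣ) : GMA D).d = 1} := by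
      ext g
      constructor
      · intro hg
        have hg' : !![φ ((g : (GMA D)ˣ) : GMA D).a, 0; 0, φ ((g : (GMA D)ˣ) : GMA D).d] =
            (1 : Matrix (Fin 2) (Fin 2) F) := congrArg Units.val hg
        exact ⟨congrFun (congrFun hg' 0) 0, congrFun (congrFun hg' 1) 1⟩
      · rintro ⟨h1, h2⟩
        have h3 : residuePair D φ hBC g = 1 := Prod.ext (Units.ext h1) (Units.ext h2)
        change diagGL F (residuePair D φ hBC g) = 1
        rw [h3, map_one]
    change IsOpen (((diagGL F).comp ((residuePair D φ hBC).comp G.subtype)).ker : Set G)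
    rw [this]
    exact ((hφ.isOpen_fiber 1).preimage (continuous_a.comp hval)).inter
      ((hφ.isOpen_fiber 1).preimage (continuous_d.comp hval))
  · refine ⟨(Units.map (residueA D φ hBC)).comp G.subtype,
      (Units.map (residueD D φ hBC)).comp G.subtype, fun h => ?_, 1, fun g => ?_⟩
    · obtain ⟨x, hx, -⟩ := exists_const_sub_one (A := A) hφ hF
      have := congrArg Units.val (DFunLike.congr_fun h ⟨_, hT (x, 1)⟩)
      exact hx (Units.ext (by simpa [hφ.const_eq] using this))
    · rw [one_mul, inv_one, mul_one]
      rfl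
  · exact (continuous_a.comp hval).add (continuous_d.comp hval)
  · exact (Continuous.units_map _ hdet).comp continuous_subtype_val
  · rw [hφ.sub_const_mem_iff]
    change _ = (!![_, _; _, _] : Matrix (Fin 2) (Fin 2) F).trace
    rw [Matrix.trace_fin_two_of, trace, map_add]
    rfl
  · rw [hφ.sub_const_mem_iff]
    change φ (det _) = (!![_, _; _, _] : Matrix (Fin 2) (Fin 2) F).det
    rw [Matrix.det_fin_two_of, det, map_sub, hBC, map_mul, mul_zero]
    rfl
  · obtain ⟨q, u, hu, h⟩ := hG g.2
    exact ⟨_, (map_diag_of_mem hφ hu h).2.2⟩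

end converse

open Filter Topology Pointwise GMA

/-! ### Proof of the converse -/

section converse

variable {p : ℕ} [Fact p.Prime] {F : Type uF} [Field F] [Finite F] [CharP F p]
  {A : Type uA} {B : Type uB} {C : Type uC} [CommRing A] [AddCommGroup B]
  [Module A B] [AddCommGroup C] [Module A C] {D : GMAData A B C}
  [Algebra (WittVector p F) A] [IsLocalRing A] {φ : A →+* F}
  [TopologicalSpace A] [IsTopologicalRing A] [CompactSpace A] [T2Space A]

/-- Π is the closed group G generated by the torus and one Θ-preimage for each element of a finite
set U, and ρ is the inclusion. Finiteness of U gives p-finiteness; U is nevertheless large enough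
for L to be the whole prescribed space. -/
theorem converse_part (hφ : IsResidueMap p φ) (hp : p ≠ 2) [TopologicalSpace B]
    [IsModuleTopology A B] [TopologicalSpace C] [IsModuleTopology A C] (hF : 3 < Nat.card F)
    [IsNoetherianRing A] [Module.Finite A B] [Module.Finite A C] (hD : D.Faithful)
    {I₁ : Submodule (wittSubring p A (⊤ : Subfield F)) A}
    {B₁ : Submodule (wittSubring p A (⊤ : Subfield F)) B}
    {C₁ : Submodule (wittSubring p A (⊤ : Subfield F)) C} (h : IsPinkDatum p D ⊤ I₁ B₁ C₁) :
    ∃ (P : ProfiniteGrp.{max uA uB uC}) (rhobar : P →* GL (Fin 2) F) (t : P → A)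
      (d : P →* Aˣ) (rho : P →* (GMA D)ˣ), IsAdmissible p P rhobar t d ∧
      IsCyclic (projImage rhobar) ∧ 2 < Nat.card (projImage rhobar) ∧ IsTDRep rho t d ∧
      pinkLie rho = matZero D I₁ B₁ C₁ ∧
      (Submodule.span (wittSubring p A (⊤ : Subfield F)) (pinkLie rho) : Set (GMA D)) =
        pinkLie rho := by
  obtain ⟨rfl, rfl, hI⟩ := h.isFullDatum hφ
  set I := I₁.toAddSubgroup with hIdef
  have := IsModuleTopology.toContinuousAdd A B
  have := IsModuleTopology.toContinuousAdd A C
  have := compactSpace_of_finite (A := A) (X := B)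
  have := compactSpace_of_finite (A := A) (X := C)
  have : T2Space B := t2Space_of_separating (fun c : C => D.m.flip c)
    (fun b hb => faithful_left hD hb)
  have : T2Space C := t2Space_of_separating (fun b : B => D.m b)
    (fun b hb => faithful_right hD hb)
  have hm : Continuous fun q : B × C => D.m q.1 q.2 :=
    IsModuleTopology.continuous_bilinear_of_finite_left D.m
  have : ContinuousMul (GMA D) := continuousMul hm
  have hBC : ∀ b c, φ (D.m b c) = 0 := fun b c => hI.map_eq_zero _ (hI.m_mem b c)
  obtain ⟨S, hSf, hSI, hS⟩ := exists_finite_generating hφ hI.isClosed hI.map_eq_zero hI.cube_mem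
    hI.witt_mul_mem hI.exists_eq
  obtain ⟨SB, hSB⟩ := Module.Finite.fg_top (R := A) (M := B)
  obtain ⟨SC, hSC⟩ := Module.Finite.fg_top (R := A) (M := C)
  -- All constant multiples of the generators of I are needed, but only A-module generators of B and
  -- C, where the torus supplies the constants.
  let U : Set (GMA D) := Set.image2 (fun (x : F) s => diagZero D (const p A x * s)) Set.univ S ∪
    upper D '' SB ∪ lower D '' SC
  have hUf : U.Finite := (((Set.toFinite _).image2 _ hSf).union (SB.finite_toSet.image _)).union
    (SC.finite_toSet.image _)
  have hUI : ∀ u ∈ U, u ∈ traceZero D I := by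
    rintro _ ((⟨x, -, s, hs, rfl⟩ | ⟨b, -, rfl⟩) | ⟨c, -, rfl⟩)
    · exact ⟨by simp [trace], hI.witt_mul_mem _ (const_mem_wittSubring trivial) _ (hSI hs)⟩
    · exact ⟨by simp [trace], I.zero_mem⟩
    · exact ⟨by simp [trace], I.zero_mem⟩
  have hex : ∀ u : GMA D, ∃ γ : (GMA D)ˣ, u ∈ U →
      (γ : GMA D) ∈ unipotentSet D φ I ∧ theta (γ : GMA D) = u := fun u => by
    by_cases hu : u ∈ U
    · obtain ⟨γ, hγ⟩ := exists_theta_eq hφ hp hI (hUI u hu)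
      exact ⟨γ, fun _ => hγ⟩
    -- A default value: only units attached to elements of U are used.
    · exact ⟨1, fun h => absurd h hu⟩
  choose γ hγ using hex
  let T : Set (GMA D)ˣ := Set.range (torus p F D) ∪ γ '' U
  have hTf : T.Finite := (Set.toFinite _).union (hUf.image _)
  let G : Subgroup (GMA D)ˣ := (Subgroup.closure T).topologicalClosure
  have hTG : T ⊆ G := fun r hr => subset_closure (Subgroup.subset_closure hr)
  have hG : G ≤ fullGroup hφ hp hI := by
    refine Subgroup.topologicalClosure_minimal _ ((Subgroup.closure_le _).mpr ?_)
      (isClosed_fullGroup hφ hp hI hm)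
    rintro _ (⟨q, rfl⟩ | ⟨u, hu, rfl⟩)
    · exact ⟨q, 1, by simp [unipotentSet, det_one, I.zero_mem], by simp⟩
    · exact ⟨1, _, (hγ u hu).1, by simp⟩
  have hTor : ∀ q, torus p F D q ∈ G := fun q => hTG (Or.inl ⟨q, rfl⟩)
  have hUG : ∀ u ∈ U, ∃ γ ∈ G, (γ : GMA D) ∈ unipotentSet D φ I ∧ theta (γ : GMA D) = u :=
    fun u hu => ⟨γ u, hTG (Or.inr ⟨u, hu, rfl⟩), hγ u hu⟩
  have hGB : ∀ b ∈ (SB : Set B), ∃ γ ∈ G, (γ : GMA D) ∈ unipotentSet D φ I ∧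
      theta (γ : GMA D) = upper D b := fun b hb => hUG _ (Or.inl (Or.inr ⟨b, hb, rfl⟩))
  have hGC : ∀ c ∈ (SC : Set C), ∃ γ ∈ G, (γ : GMA D) ∈ unipotentSet D φ I ∧
      theta (γ : GMA D) = lower D c := fun c hc => hUG _ (Or.inr ⟨c, hc, rfl⟩)
  have hL : pinkLie G.subtype = traceZero D I := pinkLie_subtype_eq hφ hp hI hS hSB hSC hG hTor
    (fun x s hs => hUG _ (Or.inl (Or.inl ⟨x, trivial, s, hs, rfl⟩))) hGB hGC
  have : TotallyDisconnectedSpace A := totallyDisconnectedSpace_of_topNil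
    (topNil_of_fg (IsNoetherian.noetherian (IsLocalRing.maximalIdeal A)) le_rfl)
    (IsLocalRing.isOpen_maximalIdeal_pow A)
  have : TotallyDisconnectedSpace (GMA D)ˣ := totallyDisconnectedSpace_units hD
    (fun c => hm.comp (continuous_id.prodMk continuous_const))
    (fun b => hm.comp (continuous_const.prodMk continuous_id))
  have hGcl : IsClosed (G : Set (GMA D)ˣ) := Subgroup.isClosed_topologicalClosure _
  have : CompactSpace G := isCompact_iff_compactSpace.mp hGcl.isCompact
  have hdense : Dense (Subgroup.closure (Subtype.val ⁻¹' T : Set G) : Set G) := by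
    have himg : ((↑) '' (Subgroup.closure (Subtype.val ⁻¹' T : Set G) : Set G) : Set (GMA D)ˣ) =
        Subgroup.closure T := by
      have := G.subtype.map_closure (Subtype.val ⁻¹' T)
      have himT : (G.subtype '' (Subtype.val ⁻¹' T) : Set (GMA D)ˣ) = T :=
        (Subtype.image_preimage_coe (G : Set (GMA D)ˣ) T).trans (Set.inter_eq_right.mpr hTG)
      rw [himT] at this
      exact congrArg (fun H : Subgroup (GMA D)ˣ => (H : Set (GMA D)ˣ)) this
    intro g
    rw [closure_subtype, himg]
    exact g.2
  have hpf : PFinite p G :=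
    pFinite_of_dense_closure p (hTf.preimage Subtype.val_injective.injOn) hdense
  have hsurj : Function.Surjective ((residuePair D φ hBC).comp G.subtype) := fun q =>
    ⟨⟨_, hTor q⟩, residuePair_torus hφ hBC q⟩
  obtain ⟨e⟩ := exists_projImage_equiv hsurj
  refine ⟨ProfiniteGrp.of G, (diagGL F).comp ((residuePair D φ hBC).comp G.subtype),
    fun g : G => ((g : (GMA D)ˣ) : GMA D).trace, (Units.map (detHom D)).comp G.subtype, G.subtype,
    isAdmissible_of hφ hp (by omega) hI hm hBC hG hTor hpf
      (dense_adjoin_trace hφ hp (by omega) hI hTor hL),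
    isCyclic_of_surjective e e.surjective, ?_, ⟨hD, fun g => rfl, fun g => rfl, ?_⟩, ?_, ?_⟩
  -- The projective image is isomorphic to Fˣ, of order |F| − 1, so |F| > 3 is exactly what makes it
  -- larger than 2.
  · have := Nat.card_congr e.toEquiv
    rw [Nat.card_units] at this
    exact lt_of_lt_of_eq (by omega) this
  · refine span_range_eq_top hφ (by omega) hTor hSB hSC (fun b hb => ?_) (fun c hc => ?_)
    · obtain ⟨γ, h1, -, h2⟩ := hGB b hb
      exact ⟨γ, h1, by rw [← theta_b, h2, upper_apply_b]⟩
    · obtain ⟨γ, h1, -, h2⟩ := hGC c hc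
      exact ⟨γ, h1, by rw [← theta_c, h2, lower_apply_c]⟩
  · exact hL.trans coe_traceZero
  · change (Submodule.span _ (pinkLie G.subtype) : Set (GMA D)) = pinkLie G.subtype
    rw [hL]
    let N : Submodule (wittSubring p A (⊤ : Subfield F)) (GMA D) :=
      { traceZero D I with
        smul_mem' := fun w u hu => ⟨by rw [Subring.smul_def, trace_smul, hu.1, mul_zero],
          hI.witt_mul_mem w w.2 _ hu.2⟩ }
    exact congrArg (fun N : Submodule _ _ => (N : Set (GMA D))) (Submodule.span_eq N)

end converse

end PinkGMA

theorem mainTheorem8 (p : ℕ) [Fact p.Prime] (hp : p ≠ 2)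
    (F : Type uF) [Field F] [Finite F] [CharP F p]
    (A : Type uA) [CommRing A] [TopologicalSpace A] [IsTopologicalRing A] [CompactSpace A]
    [T2Space A] [IsLocalRing A] [Algebra (WittVector p F) A]
    (hA : Function.Surjective
      ((IsLocalRing.residue A).comp (algebraMap (WittVector p F) A)))
    (B : Type uB) [AddCommGroup B] [Module A B] [TopologicalSpace B] [IsModuleTopology A B]
    (C : Type uC) [AddCommGroup C] [Module A C] [TopologicalSpace C] [IsModuleTopology A C]
    (D : PinkGMA.GMAData A B C) :
    (∀ (P : ProfiniteGrp.{uP}) (rhobar : P →* GL (Fin 2) F) (t : P → A) (d : P →* Aˣ)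
        (rho : P →* (PinkGMA.GMA D)ˣ),
      PinkGMA.IsAdmissible p P rhobar t d →
      IsCyclic (PinkGMA.projImage rhobar) →
      2 < Nat.card (PinkGMA.projImage rhobar) →
      PinkGMA.IsTDRep rho t d →
      PinkGMA.IsWellAdaptedCyclic p rhobar rho →
      2 < Nat.gcd (Nat.card (PinkGMA.projImage rhobar)) (Nat.card F - 1) ∧
      ∀ K : Subfield F, 2 < Nat.gcd (Nat.card (PinkGMA.projImage rhobar)) (Nat.card K - 1) →
        ∃ (I₁ : Submodule (PinkGMA.wittSubring p A K) A)
          (B₁ : Submodule (PinkGMA.wittSubring p A K) B)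
          (C₁ : Submodule (PinkGMA.wittSubring p A K) C),
          PinkGMA.IsPinkDatum p D K I₁ B₁ C₁ ∧
          (Submodule.span (PinkGMA.wittSubring p A K) (PinkGMA.pinkLie rho) :
            Set (PinkGMA.GMA D)) = PinkGMA.matZero D I₁ B₁ C₁) ∧
    (3 < Nat.card F → IsNoetherianRing A → Module.Finite A B → Module.Finite A C → D.Faithful →
      ∀ (I₁ : Submodule (PinkGMA.wittSubring p A (⊤ : Subfield F)) A)
        (B₁ : Submodule (PinkGMA.wittSubring p A (⊤ : Subfield F)) B)
        (C₁ : Submodule (PinkGMA.wittSubring p A (⊤ : Subfield F)) C),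
        PinkGMA.IsPinkDatum p D ⊤ I₁ B₁ C₁ →
        ∃ (P : ProfiniteGrp.{max uA uB uC}) (rhobar : P →* GL (Fin 2) F) (t : P → A)
          (d : P →* Aˣ) (rho : P →* (PinkGMA.GMA D)ˣ),
          PinkGMA.IsAdmissible p P rhobar t d ∧
          IsCyclic (PinkGMA.projImage rhobar) ∧
          2 < Nat.card (PinkGMA.projImage rhobar) ∧
          PinkGMA.IsTDRep rho t d ∧
          PinkGMA.pinkLie rho = PinkGMA.matZero D I₁ B₁ C₁ ∧
          (Submodule.span (PinkGMA.wittSubring p A (⊤ : Subfield F)) (PinkGMA.pinkLie rho) :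
            Set (PinkGMA.GMA D)) = PinkGMA.pinkLie rho) := by
  obtain ⟨φ, hφ⟩ := PinkGMA.exists_isResidueMap (p := p) hA
  refine ⟨fun P rhobar t d rho hadm _ hm hrep hwell =>
    PinkGMA.direct_part hφ hp hadm hm hrep hwell, ?_⟩
  intro hF hN hB hC hD I₁ B₁ C₁ h
  exact PinkGMA.converse_part hφ hp hF hD h
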